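/- Finite rings $R$ (associative, with $1$, not necessarily commutative) are encoded by positive integers $d_1,\dots,d_n$ with $R^+ \cong \mathbf Z/d_1\mathbf Z \times \dots \times \mathbf Z/d_n\mathbf Z$ together with the products of the $n$ standard generators; an element of $R$ is encoded by its coordinates $0 \le x_i < d_i$, and an ideal by a list of generators of its additive group. A finite presentation $\langle X \mid T\rangle$ is encoded by the number of generators and the list of relators, which are words over $X \cup X^{-1}$ with exponents written in binary. Running times are measured by bit complexity. **Proposition.** There is a deterministic polynomial-time algorithm that, given a finite ring $R$ and a nilpotent two-sided ideal $I$ of $R$, determines an effective presentation of the group $1+I \subseteq R^\times$. That is, there are a polynomial $q$ and deterministic algorithms $A$, $L$, $E$ such that for every finite ring $R$ and every nilpotent two-sided ideal $I$ of $R$, encoded as above: 1. given $(R,I)$, the algorithm $A$ outputs a finite presentation $P=\langle X \mid T\rangle$; 2. given $(R,I)$ and $g \in 1+I$, the algorithm $L$ outputs a word $\alpha(g)$ over $X \cup X^{-1}$ (discrete logarithm); 3. given $(R,I)$ and a word $w$ over $X \cup X^{-1}$, the algorithm $E$ outputs an element $\alpha^{-1}(w) \in 1+I$ (exponential map); 4.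 the map $g \mapsto \alpha(g)$ induces a group isomorphism $1+I \to \langle X \mid T\rangle$ whose inverse is induced by $w \mapsto \alpha^{-1}(w)$; 5. each of these algorithms, on an input of bit length $\ell$, halts after at most $q(\ell)$ bit operations. -/

import Mathlib

/-! ### Algorithms and their bit complexity

Data are binary trees with integer leaves, their size is their bit length. Programs form a
structured `while` language over such data; the cost of a run is counted with the logarithmic cost
criterion: no step is cheaper than the bit length of the data that it reads and writes, and an
elementary operation is charged the square of this length, which is enough for schoolbook
multiplication and division. Running times thus agree with those of Turing machines up to a
polynomial. -/

/-- Binary trees whose leaves are integers. -/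
inductive Data : Type
  | num (z : ℤ) : Data
  | cons (a b : Data) : Data

namespace Data

/-- The bit length. -/
def size : Data → ℕ
  | num z => z.natAbs.size + 1
  | cons a b => a.size + b.size + 1

/-- A list `[a₁, …, aₙ]` is stored as `cons a₁ (cons a₂ (… (cons aₙ (num 0))))`. -/
def ofList : List Data → Data
  | [] => num 0
  | a :: l => cons a (ofList l)

end Data

/-- The elementary operations. -/
inductive Op : Type
  | id
  | const (c : Data)
  | head
  | tail
  | isNum
  | add
  | sub
  | mul
  | div
  | mod
  | lt

/-- The result of an elementary operation; binary operations on integers expect the pair of their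
arguments. Division and remainder are the Euclidean ones, truth values are `1` and `0`, and the
result on data of the wrong shape is `0`. -/
def Op.apply : Op → Data → Data
  | .id, x => x
  | .const c, _ => c
  | .head, .cons a _ => a
  | .tail, .cons _ b => b
  | .isNum, .num _ => .num 1
  | .add, .cons (.num a) (.num b) => .num (a + b)
  | .sub, .cons (.num a) (.num b) => .num (a - b)
  | .mul, .cons (.num a) (.num b) => .num (a * b)
  | .div, .cons (.num a) (.num b) => .num (a / b)
  | .mod, .cons (.num a) (.num b) => .num (a % b)
  | .lt, .cons (.num a) (.num b) => .num (if a < b then 1 else 0)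
  | _, _ => .num 0

/-- Programs: elementary operations, composition (`comp f g` runs `g` first), pairing of two
results, case distinction, and the loop `loop c f`, which is `while c(x) ≠ 0 do x := f(x)`. -/
inductive Prog : Type
  | op (o : Op) : Prog
  | comp (f g : Prog) : Prog
  | pair (f g : Prog) : Prog
  | ite (c f g : Prog) : Prog
  | loop (c f : Prog) : Prog

/-- `p.Eval x y t`: on input `x` the program `p` halts with output `y`, at cost `t`. -/
inductive Prog.Eval : Prog → Data → Data → ℕ → Prop
  | op (o : Op) (x : Data) :
      Eval (.op o) x (o.apply x) ((1 + x.size + (o.apply x).size) ^ 2)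
  | comp {f g : Prog} {x y z : Data} {s t : ℕ} :
      Eval g x y s → Eval f y z t → Eval (.comp f g) x z (1 + s + t)
  | pair {f g : Prog} {x y z : Data} {s t : ℕ} :
      Eval f x y s → Eval g x z t → Eval (.pair f g) x (.cons y z) (1 + x.size + s + t)
  | ite_true {c f g : Prog} {x b y : Data} {s t : ℕ} :
      Eval c x b s → b ≠ .num 0 → Eval f x y t → Eval (.ite c f g) x y (1 + x.size + s + t)
  | ite_false {c f g : Prog} {x y : Data} {s t : ℕ} :
      Eval c x (.num 0) s → Eval g x y t → Eval (.ite c f g) x y (1 + x.size + s + t)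
  | loop_stop {c f : Prog} {x : Data} {s : ℕ} :
      Eval c x (.num 0) s → Eval (.loop c f) x x (1 + x.size + s)
  | loop_step {c f : Prog} {x b y z : Data} {s t u : ℕ} :
      Eval c x b s → b ≠ .num 0 → Eval f x y t → Eval (.loop c f) y z u →
        Eval (.loop c f) x z (1 + x.size + s + t + u)

/-- Programs are deterministic: input determines output and cost. -/
theorem Prog.Eval.unique {p : Prog} {x y y' : Data} {t t' : ℕ}
    (h : p.Eval x y t) (h' : p.Eval x y' t') : y = y' ∧ t = t' := by
  induction h generalizing y' t' with
  | op o x => cases h'; exact ⟨rfl, rfl⟩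
  | comp _ _ ih1 ih2 =>
    cases h' with
    | comp a b =>
      obtain ⟨rfl, rfl⟩ := ih1 a
      obtain ⟨rfl, rfl⟩ := ih2 b
      exact ⟨rfl, rfl⟩
  | pair _ _ ih1 ih2 =>
    cases h' with
    | pair a b =>
      obtain ⟨rfl, rfl⟩ := ih1 a
      obtain ⟨rfl, rfl⟩ := ih2 b
      exact ⟨rfl, rfl⟩
  | ite_true _ hb _ ih1 ih2 =>
    cases h' with
    | ite_true a _ b =>
      obtain ⟨rfl, rfl⟩ := ih1 a
      obtain ⟨rfl, rfl⟩ := ih2 b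
      exact ⟨rfl, rfl⟩
    | ite_false a b => exact absurd (ih1 a).1 hb
  | ite_false _ _ ih1 ih2 =>
    cases h' with
    | ite_true a hb b => exact absurd (ih1 a).1.symm hb
    | ite_false a b =>
      obtain ⟨-, rfl⟩ := ih1 a
      obtain ⟨rfl, rfl⟩ := ih2 b
      exact ⟨rfl, rfl⟩
  | loop_stop _ ih1 =>
    cases h' with
    | loop_stop a =>
      obtain ⟨-, rfl⟩ := ih1 a
      exact ⟨rfl, rfl⟩
    | loop_step a hb _ _ => exact absurd (ih1 a).1.symm hb
  | loop_step _ hb _ _ ih1 ih2 ih3 =>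
    cases h' with
    | loop_stop a => exact absurd (ih1 a).1 hb
    | loop_step a _ b c =>
      obtain ⟨rfl, rfl⟩ := ih1 a
      obtain ⟨rfl, rfl⟩ := ih2 b
      obtain ⟨rfl, rfl⟩ := ih3 c
      exact ⟨rfl, rfl⟩

/-- On input `x` the program `p` halts with output `y`, and the cost of the run is at most the value
of the polynomial `q` at the bit length of `x`. -/
def Prog.OutputsIn (p : Prog) (q : Polynomial ℕ) (x y : Data) : Prop :=
  ∃ t : ℕ, p.Eval x y t ∧ t ≤ q.eval x.size

/-! ### Finite presentations -/

/-- Words in `x₁, …, xₙ` and their inverses; the syllable `(i, e)` stands for the power `xᵢ ^ e`. -/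
abbrev GroupWord (n : ℕ) : Type := List (Fin n × ℤ)

/-- The element of the free group that a word spells. -/
def GroupWord.toFree {n : ℕ} (w : GroupWord n) : FreeGroup (Fin n) :=
  (w.map fun s => FreeGroup.of s.1 ^ s.2).prod

/-- Words are encoded with binary exponents. -/
def GroupWord.encode {n : ℕ} (w : GroupWord n) : Data :=
  Data.ofList (w.map fun s => .cons (.num ((s.1 : ℕ) : ℤ)) (.num s.2))

/-- A finite group presentation: the number of generators and the list of relators. -/
structure FinPresentation : Type where
  numGens : ℕ
  relators : List (GroupWord numGens)

namespace FinPresentation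

/-- The finitely presented group `⟨X | T⟩`. -/
abbrev Presented (P : FinPresentation) : Type :=
  PresentedGroup {r : FreeGroup (Fin P.numGens) | ∃ w ∈ P.relators, r = GroupWord.toFree w}

/-- The element of the finitely presented group that a word spells. -/
def spell (P : FinPresentation) (w : GroupWord P.numGens) : P.Presented :=
  PresentedGroup.mk _ w.toFree

/-- The encoding of a presentation. -/
def encode (P : FinPresentation) : Data :=
  .cons (.num (P.numGens : ℤ)) (Data.ofList (P.relators.map GroupWord.encode))

end FinPresentation

/-- Let `G` be a group with elements encoded by `enc`, and let `x` be a datum that describes `G`.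
The presentation `P` and the algorithms `logAlg` and `expAlg`, which receive `x` together with a
group element or a word, form an effective presentation of `G`: within time `q`, the algorithm
`logAlg` sends every group element `g` to a word `α(g)` and `expAlg` sends every word to a group
element, such that `α` induces an isomorphism from `G` to the finitely presented group of `P` whose
inverse is induced by `expAlg`. -/
def IsEffectivePresentation {G : Type*} [Group G] (enc : G → Data) (x : Data) (q : Polynomial ℕ)
    (P : FinPresentation) (logAlg expAlg : Prog) : Prop :=
  ∃ φ : G ≃* P.Presented,
    (∀ g : G, ∃ w : GroupWord P.numGens,
      logAlg.OutputsIn q (.cons x (enc g)) w.encode ∧ φ g = P.spell w) ∧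
    (∀ w : GroupWord P.numGens, ∃ g : G,
      expAlg.OutputsIn q (.cons x w.encode) (enc g) ∧ φ.symm (P.spell w) = g)

/-! ### Finite rings and ideals -/

/-- Coordinates on a finite ring: an isomorphism of its additive group with
`ℤ/d₁ × ⋯ × ℤ/dₙ`, for positive integers `d₁, …, dₙ`. -/
structure RingCoordinates (R : Type*) [Ring R] where
  n : ℕ
  d : Fin n → ℕ
  d_pos : ∀ i, 0 < d i
  coord : R ≃+ ((i : Fin n) → ZMod (d i))

namespace RingCoordinates

variable {R : Type*} [Ring R] (C : RingCoordinates R)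

/-- A ring element is encoded by the integers `0 ≤ xᵢ < dᵢ` that represent its coordinates. -/
def encodeElt (a : R) : Data :=
  Data.ofList (List.ofFn fun i => .num ((C.coord a i).val : ℤ))

/-- The generators of the additive group that correspond to the `n` cyclic factors. -/
def gen (i : Fin C.n) : R :=
  C.coord.symm (Pi.single i 1)

/-- A finite ring is encoded by `d₁, …, dₙ` and the multiplication table of the generators. The
multiplicative unit is not part of the encoding. -/
def encodeRing : Data :=
  .cons (Data.ofList (List.ofFn fun i => .num (C.d i : ℤ)))
    (Data.ofList (List.ofFn fun i => Data.ofList (List.ofFn fun j =>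
      C.encodeElt (C.gen i * C.gen j))))

/-- A finite ring together with an ideal, which is given by a list of generators of its additive
group. -/
def encodeRingIdeal (gens : List R) : Data :=
  .cons C.encodeRing (Data.ofList (gens.map C.encodeElt))

end RingCoordinates

/-- The group `1 + I` of unipotent units, for a two-sided ideal `I`. -/
def onePlus {R : Type*} [Ring R] (I : Ideal R) [I.IsTwoSided] : Subgroup Rˣ where
  carrier := {u | ∃ a ∈ I, (u : R) = 1 + a}
  one_mem' := ⟨0, I.zero_mem, by simp⟩
  mul_mem' := by
    rintro u v ⟨a, ha, hu⟩ ⟨b, hb, hv⟩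
    refine ⟨a + b + a * b, I.add_mem (I.add_mem ha hb) (I.mul_mem_left a hb), ?_⟩
    rw [Units.val_mul, hu, hv]
    noncomm_ring
  inv_mem' := by
    rintro u ⟨a, ha, hu⟩
    refine ⟨-(((u⁻¹ : Rˣ) : R) * a), I.neg_mem (I.mul_mem_left _ ha), ?_⟩
    have h : ((u⁻¹ : Rˣ) : R) * (1 + a) = 1 := by rw [← hu, Units.inv_mul]
    rw [mul_add, mul_one] at h
    rw [← sub_eq_add_neg]
    exact eq_sub_of_add_eq h

/-- For a nilpotent ideal `I`, every element `1 + a` with `a ∈ I` is a unit and thus belongs to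
`onePlus I`. -/
theorem exists_mem_onePlus {R : Type*} [Ring R] (I : Ideal R) [I.IsTwoSided] (hI : IsNilpotent I)
    {a : R} (ha : a ∈ I) : ∃ u ∈ onePlus I, (u : R) = 1 + a := by
  obtain ⟨k, hk⟩ := hI
  have h : IsNilpotent a := by
    have h1 : a ^ k ∈ I ^ k := Ideal.pow_mem_pow ha k
    rw [hk] at h1
    exact ⟨k, by simpa using h1⟩
  obtain ⟨u, hu⟩ := h.isUnit_one_add
  exact ⟨u, ⟨a, ha, hu⟩, hu⟩

/-!
Let `1 + I` be the group in question. The powers of `I` form a descending chain of additive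
subgroups that reaches `0` after at most `1 + log₂ |R|` steps. Concatenating lists of additive
generators of the powers gives elements `b₀, …, bₘ₋₁` of `I` such that, with `Jᵢ` the additive group
generated by `bᵢ, …, bₘ₋₁`, both `I Jᵢ` and `Jᵢ I` are contained in `Jᵢ₊₁` (`IsCentralChain`).
Therefore `1 + Jᵢ` is a subgroup of `1 + I`, and `1 + x ↦ x` induces an isomorphism from
`(1 + Jᵢ) / (1 + Jᵢ₊₁)` to `Jᵢ / Jᵢ₊₁` (`mul_sub_one_congr`), which is cyclic and generated by the
class of `bᵢ`.

The generators of the presentation are `xᵢ = 1 + bᵢ`. To find the discrete logarithm of an element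
of `1 + Jᵢ`, it is multiplied by a power of `xᵢ` such that the product belongs to `1 + Jᵢ₊₁`, and so
on (`logWord`). The relators express `xᵢ ^ rᵢ`, with `rᵢ` the order of `Jᵢ / Jᵢ₊₁`, and the
conjugates `xᵢ⁻¹ xⱼ xᵢ` for `j > i` as words in later generators (`relatorsAt`). They suffice to
write each element of the presented group as a product of powers `xᵢ ^ cᵢ`, and since the orders
`rᵢ` are exact in `1 + I`, an element of the kernel of the map to `1 + I` has all `cᵢ` divisible by
`rᵢ` and is trivial (`toGroup_injective`).

All this reduces to linear algebra over `ℤ` in a finite abelian group `ℤ/d₁ × ⋯ × ℤ/dₙ`: exponents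
and orders modulo a subgroup, short generating lists of subgroups, and the unit of `R`, which is not
part of the input. Each of these tasks is solved by elimination of coordinates (`elim`), with the
Euclidean algorithm applied to leading coordinates while all vectors are kept reduced modulo the
`dᵢ`, so that their sizes stay bounded. Powers in `1 + I` are computed by repeated squaring.

The algorithms are functions on lists of integers. That they are computed by programs in polynomial
time follows from closure properties of the class of such functions (`PolyTime`): it is closed under
composition, pairing, case distinction, and folding over a list, provided the accumulator remains of
polynomially bounded size (`PolyTime.foldl`).
-/

/-! ### Polynomial time computability -/

theorem Polynomial.eval_le_eval_nat (q : Polynomial ℕ) {a b : ℕ} (h : a ≤ b) :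
    q.eval a ≤ q.eval b := by
  rw [Polynomial.eval_eq_sum, Polynomial.eval_eq_sum]
  exact Finset.sum_le_sum fun i _ => Nat.mul_le_mul_left _ (Nat.pow_le_pow_left h i)

theorem Data.one_le_size (x : Data) : 1 ≤ x.size := by
  cases x <;> simp [Data.size]

/-- A run is at least as long as its output. -/
theorem Prog.Eval.size_le {p : Prog} {x y : Data} {t : ℕ} (h : p.Eval x y t) : y.size ≤ t := by
  induction h with
  | op o x => nlinarith [Data.one_le_size x]
  | comp _ _ _ ih => omega
  | pair _ _ ih1 ih2 => simp only [Data.size]; omega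
  | ite_true _ _ _ _ ih => omega
  | ite_false _ _ _ ih => omega
  | loop_stop _ _ => omega
  | loop_step _ _ _ _ _ _ ih => omega

/-- The family `y` of data can be computed from the family `x` by one program in polynomial
time. -/
def PolyOn {ι : Type*} (x y : ι → Data) : Prop :=
  ∃ (p : Prog) (q : Polynomial ℕ), ∀ i, p.OutputsIn q (x i) (y i)

namespace PolyOn

variable {ι : Type*} {x y z : ι → Data}

theorem size_le (h : PolyOn x y) : ∃ q : Polynomial ℕ, ∀ i, (y i).size ≤ q.eval (x i).size := by
  obtain ⟨p, q, h⟩ := h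
  refine ⟨q, fun i => ?_⟩
  obtain ⟨t, h1, h2⟩ := h i
  exact h1.size_le.trans h2

/-- An elementary operation is performed in polynomial time as soon as the size of its result is
bounded by a polynomial: its cost is determined by the sizes of argument and result. -/
theorem op (o : Op) (hb : ∃ q : Polynomial ℕ, ∀ i, (o.apply (x i)).size ≤ q.eval (x i).size) :
    PolyOn x fun i => o.apply (x i) := by
  obtain ⟨q, hq⟩ := hb
  refine ⟨.op o, (1 + Polynomial.X + q) ^ 2, fun i => ⟨_, .op o _, ?_⟩⟩
  simp only [Polynomial.eval_pow, Polynomial.eval_add, Polynomial.eval_one, Polynomial.eval_X]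
  have := hq i
  gcongr

theorem comp (h : PolyOn x y) (h' : PolyOn y z) : PolyOn x z := by
  obtain ⟨p, q, h⟩ := h
  obtain ⟨p', q', h'⟩ := h'
  refine ⟨.comp p' p, 1 + q + q'.comp q, fun i => ?_⟩
  obtain ⟨t, h1, h2⟩ := h i
  obtain ⟨t', h3, h4⟩ := h' i
  refine ⟨_, .comp h1 h3, ?_⟩
  simp only [Polynomial.eval_add, Polynomial.eval_one, Polynomial.eval_comp]
  have := q'.eval_le_eval_nat (h1.size_le.trans h2)
  omega

theorem pair (h : PolyOn x y) (h' : PolyOn x z) : PolyOn x fun i => .cons (y i) (z i) := by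
  obtain ⟨p, q, h⟩ := h
  obtain ⟨p', q', h'⟩ := h'
  refine ⟨.pair p p', 1 + Polynomial.X + q + q', fun i => ?_⟩
  obtain ⟨t, h1, h2⟩ := h i
  obtain ⟨t', h3, h4⟩ := h' i
  refine ⟨_, .pair h1 h3, ?_⟩
  simp only [Polynomial.eval_add, Polynomial.eval_one, Polynomial.eval_X]
  omega

/-- Case distinction; each branch need only be computable where it is taken. -/
theorem ite {c : ι → Data} (P : ι → Prop) (hc : PolyOn x c) (hP : ∀ i, P i ↔ c i ≠ .num 0)
    (h : PolyOn (fun j : {i // P i} => x j) fun j => y j)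
    (h' : PolyOn (fun j : {i // ¬ P i} => x j) fun j => y j) : PolyOn x y := by
  obtain ⟨p, q, h⟩ := h
  obtain ⟨p', q', h'⟩ := h'
  obtain ⟨pc, qc, hc⟩ := hc
  refine ⟨.ite pc p p', 1 + Polynomial.X + qc + q + q', fun i => ?_⟩
  obtain ⟨s, h5, h6⟩ := hc i
  by_cases hi : P i
  · obtain ⟨t, h1, h2⟩ := h ⟨i, hi⟩
    refine ⟨_, .ite_true h5 ((hP i).1 hi) h1, ?_⟩
    simp only [Polynomial.eval_add, Polynomial.eval_one, Polynomial.eval_X]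
    dsimp only at h2
    omega
  · obtain ⟨t, h1, h2⟩ := h' ⟨i, hi⟩
    have h0 : c i = .num 0 := by rw [hP] at hi; simpa using hi
    refine ⟨_, .ite_false (h0 ▸ h5) h1, ?_⟩
    simp only [Polynomial.eval_add, Polynomial.eval_one, Polynomial.eval_X]
    dsimp only at h2
    omega

theorem id (x : ι → Data) : PolyOn x x :=
  op (x := x) .id ⟨.X, fun i => by simp [Op.apply]⟩

theorem const (x : ι → Data) (c : Data) : PolyOn x fun _ => c :=
  op (x := x) (.const c) ⟨.C c.size, fun i => by simp [Op.apply]⟩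

theorem head (a b : ι → Data) : PolyOn (fun i => .cons (a i) (b i)) a :=
  op (x := fun i => .cons (a i) (b i)) .head
    ⟨.X, fun i => by simp only [Op.apply, Data.size, Polynomial.eval_X]; omega⟩

theorem tail (a b : ι → Data) : PolyOn (fun i => .cons (a i) (b i)) b :=
  op (x := fun i => .cons (a i) (b i)) .tail
    ⟨.X, fun i => by simp only [Op.apply, Data.size, Polynomial.eval_X]; omega⟩

theorem reindex {κ : Type*} (π : κ → ι) (h : PolyOn x y) :
    PolyOn (fun k => x (π k)) fun k => y (π k) := by
  obtain ⟨p, q, h⟩ := h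
  exact ⟨p, q, fun k => h (π k)⟩

end PolyOn

open Prog.Eval (loop_stop) in
/-- The loop passes through the states `s 0, …, s n`; its cost is bounded in terms of the number `n`
of iterations and a common bound `B` for the states and for the cost of condition and body. -/
theorem Prog.loop_eval (c f : Prog) (s : ℕ → Data) (B : ℕ) (n : ℕ)
    (hc : ∀ k < n, ∃ b t, c.Eval (s k) b t ∧ b ≠ .num 0 ∧ t ≤ B)
    (hc0 : ∃ t, c.Eval (s n) (.num 0) t ∧ t ≤ B)
    (hf : ∀ k < n, ∃ t, f.Eval (s k) (s (k + 1)) t ∧ t ≤ B)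
    (hs : ∀ k ≤ n, (s k).size ≤ B) :
    ∃ t, (Prog.loop c f).Eval (s 0) (s n) t ∧ t ≤ (n + 1) * (3 * B + 1) := by
  induction n generalizing s with
  | zero =>
    obtain ⟨t, h1, h2⟩ := hc0
    have := hs 0 le_rfl
    exact ⟨_, loop_stop h1, by omega⟩
  | succ n ih =>
    obtain ⟨t, h1, h2⟩ := ih (fun k => s (k + 1)) (fun k hk => hc (k + 1) (by omega)) hc0
      (fun k hk => hf (k + 1) (by omega)) (fun k hk => hs (k + 1) (by omega))
    obtain ⟨b, u, h3, h4, h5⟩ := hc 0 (by omega)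
    obtain ⟨v, h6, h7⟩ := hf 0 (by omega)
    have := hs 0 (by omega)
    refine ⟨_, .loop_step h3 h4 h6 h1, ?_⟩
    rw [show (n + 1 + 1) * (3 * B + 1) = (n + 1) * (3 * B + 1) + (3 * B + 1) by ring]
    omega

/-- A loop runs in polynomial time if its number of iterations and the sizes of its intermediate
states `s i 0, s i 1, …` are polynomially bounded. -/
theorem PolyOn.loop {ι : Type*} (s c : ι → ℕ → Data) (n : ι → ℕ) (q : Polynomial ℕ)
    (hn : ∀ i, n i ≤ q.eval (s i 0).size)
    (hs : ∀ i, ∀ k ≤ n i, (s i k).size ≤ q.eval (s i 0).size)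
    (hcond : PolyOn (fun j : {j : ι × ℕ // j.2 ≤ n j.1} => s j.1.1 j.1.2) fun j => c j.1.1 j.1.2)
    (hc : ∀ i, ∀ k < n i, c i k ≠ .num 0) (hc0 : ∀ i, c i (n i) = .num 0)
    (hstep : PolyOn (fun j : {j : ι × ℕ // j.2 < n j.1} => s j.1.1 j.1.2)
      fun j => s j.1.1 (j.1.2 + 1)) :
    PolyOn (fun i => s i 0) fun i => s i (n i) := by
  obtain ⟨pc, qc, hcond⟩ := hcond
  obtain ⟨pf, qf, hstep⟩ := hstep
  refine ⟨.loop pc pf, (q + 1) * (3 * (q + qc.comp q + qf.comp q) + 1), fun i => ?_⟩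
  set S := (s i 0).size
  have hqc (k : ℕ) (hk : k ≤ n i) : qc.eval (s i k).size ≤ (qc.comp q).eval S := by
    rw [Polynomial.eval_comp]; exact qc.eval_le_eval_nat (hs i k hk)
  have hqf (k : ℕ) (hk : k ≤ n i) : qf.eval (s i k).size ≤ (qf.comp q).eval S := by
    rw [Polynomial.eval_comp]; exact qf.eval_le_eval_nat (hs i k hk)
  obtain ⟨t, h1, h2⟩ := Prog.loop_eval pc pf (s i)
    (q.eval S + (qc.comp q).eval S + (qf.comp q).eval S) (n i)
    (fun k hk => by
      obtain ⟨t, h1, h2⟩ := hcond ⟨(i, k), hk.le⟩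
      exact ⟨_, t, h1, hc i k hk, by have := hqc k hk.le; dsimp only at h2; omega⟩)
    (by
      obtain ⟨t, h1, h2⟩ := hcond ⟨(i, n i), le_rfl⟩
      exact ⟨t, hc0 i ▸ h1, by have := hqc _ le_rfl; dsimp only at h2; omega⟩)
    (fun k hk => by
      obtain ⟨t, h1, h2⟩ := hstep ⟨(i, k), hk⟩
      exact ⟨t, h1, by have := hqf k hk.le; dsimp only at h2; omega⟩)
    (fun k hk => by have := hs i k hk; simp only [S]; omega)
  refine ⟨t, h1, h2.trans ?_⟩
  simp only [Polynomial.eval_mul, Polynomial.eval_add, Polynomial.eval_one]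
  have := hn i
  gcongr
  simp

/-- Types whose elements are represented by data. Integers, lists and pairs are represented as in
the encodings of rings, elements and words. -/
class DataEnc (α : Type*) where
  enc : α → Data

instance : DataEnc ℤ := ⟨Data.num⟩

instance {α : Type*} [DataEnc α] : DataEnc (List α) := ⟨fun l => .ofList (l.map DataEnc.enc)⟩

instance {α β : Type*} [DataEnc α] [DataEnc β] : DataEnc (α × β) :=
  ⟨fun p => .cons (DataEnc.enc p.1) (DataEnc.enc p.2)⟩

open DataEnc

/-- The bit length of the datum that represents an element. -/
def esize {α : Type*} [DataEnc α] (a : α) : ℕ := (enc a).size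

section esize

variable {α β : Type*} [DataEnc α] [DataEnc β]

theorem esize_int (z : ℤ) : esize z = z.natAbs.size + 1 := rfl

@[simp] theorem esize_nil : esize ([] : List α) = 1 := rfl

@[simp] theorem esize_cons (a : α) (l : List α) : esize (a :: l) = esize a + esize l + 1 := rfl

@[simp] theorem esize_pair (a : α) (b : β) : esize (a, b) = esize a + esize b + 1 := rfl

theorem esize_pair' (p : α × β) : esize p = esize p.1 + esize p.2 + 1 := rfl

theorem one_le_esize (a : α) : 1 ≤ esize a := Data.one_le_size _

theorem esize_le_of_mem {a : α} {l : List α} (h : a ∈ l) : esize a ≤ esize l := by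
  induction l with
  | nil => simp at h
  | cons b l ih =>
    rw [esize_cons]
    rcases List.mem_cons.1 h with rfl | h
    · omega
    · have := ih h; omega

theorem length_lt_esize (l : List α) : l.length < esize l := by
  induction l with
  | nil => simp
  | cons b l ih => rw [esize_cons, List.length_cons]; omega

theorem esize_le_of_forall {l : List α} {m : ℕ} (h : ∀ a ∈ l, esize a ≤ m) :
    esize l ≤ l.length * (m + 1) + 1 := by
  induction l with
  | nil => simp
  | cons b l ih =>
    have h1 := ih fun a ha => h a (List.mem_cons_of_mem _ ha)
    have h2 := h b List.mem_cons_self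
    rw [esize_cons, List.length_cons, add_mul]; omega

theorem esize_append (l l' : List α) : esize (l ++ l') + 1 = esize l + esize l' := by
  induction l with
  | nil => simp; omega
  | cons b l ih => rw [List.cons_append, esize_cons, esize_cons]; omega

theorem esize_tail_le (l : List α) : esize l.tail ≤ esize l := by
  cases l <;> simp; omega

end esize

/-- The function `f` can be computed in polynomial time, with respect to the representations of
arguments and values by data. Functions of several arguments are treated by letting each argument
depend on a common context `c : γ`. -/
@[fun_prop] def PolyTime {γ α : Type*} [DataEnc γ] [DataEnc α] (f : γ → α) : Prop :=
  PolyOn (fun c => enc c) fun c => enc (f c)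

/-- The natural number `M c` is bounded by a polynomial in the size of `c`. -/
def PolyBound {γ : Type*} [DataEnc γ] (M : γ → ℕ) : Prop :=
  ∃ q : Polynomial ℕ, ∀ c, M c ≤ q.eval (esize c)

namespace PolyBound

variable {γ : Type*} [DataEnc γ] {M N : γ → ℕ}

theorem mono (h : PolyBound M) (h' : ∀ c, N c ≤ M c) : PolyBound N := by
  obtain ⟨q, h⟩ := h
  exact ⟨q, fun c => (h' c).trans (h c)⟩

theorem const (n : ℕ) : PolyBound fun _ : γ => n := ⟨.C n, fun c => by simp⟩

theorem add (h : PolyBound M) (h' : PolyBound N) : PolyBound fun c => M c + N c := by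
  obtain ⟨q, h⟩ := h
  obtain ⟨q', h'⟩ := h'
  exact ⟨q + q', fun c => by rw [Polynomial.eval_add]; exact add_le_add (h c) (h' c)⟩

theorem mul (h : PolyBound M) (h' : PolyBound N) : PolyBound fun c => M c * N c := by
  obtain ⟨q, h⟩ := h
  obtain ⟨q', h'⟩ := h'
  exact ⟨q * q', fun c => by rw [Polynomial.eval_mul]; exact Nat.mul_le_mul (h c) (h' c)⟩

end PolyBound

namespace PolyTime

variable {γ α β δ : Type*} [DataEnc γ] [DataEnc α] [DataEnc β] [DataEnc δ]

theorem bound {f : γ → α} (h : PolyTime f) : PolyBound fun c => esize (f c) :=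
  PolyOn.size_le h

theorem length_bound {f : γ → List α} (h : PolyTime f) : PolyBound fun c => (f c).length :=
  h.bound.mono fun _ => (length_lt_esize _).le

@[fun_prop] theorem id : PolyTime fun c : γ => c := PolyOn.id _

@[fun_prop] theorem const (a : α) : PolyTime fun _ : γ => a := PolyOn.const _ _

@[fun_prop] theorem comp {f : α → β} {g : γ → α} (hf : PolyTime f) (hg : PolyTime g) :
    PolyTime fun c => f (g c) :=
  PolyOn.comp hg (hf.reindex g)

@[fun_prop] theorem pair {f : γ → α} {g : γ → β} (hf : PolyTime f) (hg : PolyTime g) :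
    PolyTime fun c => (f c, g c) :=
  PolyOn.pair hf hg

@[fun_prop] theorem fst {f : γ → α × β} (hf : PolyTime f) : PolyTime fun c => (f c).1 :=
  PolyOn.comp hf (PolyOn.head _ _)

@[fun_prop] theorem snd {f : γ → α × β} (hf : PolyTime f) : PolyTime fun c => (f c).2 :=
  PolyOn.comp hf (PolyOn.tail _ _)

@[fun_prop] theorem cons {f : γ → α} {g : γ → List α} (hf : PolyTime f) (hg : PolyTime g) :
    PolyTime fun c => f c :: g c :=
  PolyOn.pair hf hg

@[fun_prop] theorem tail {f : γ → List α} (hf : PolyTime f) : PolyTime fun c => (f c).tail := by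
  have h (l : List α) : enc l.tail = Op.tail.apply (enc l) := by cases l <;> rfl
  refine PolyOn.comp hf ?_
  simp_rw [h]
  refine PolyOn.op .tail ⟨.X, fun c => ?_⟩
  rw [← h, Polynomial.eval_X]
  exact esize_tail_le _

/-- The results of the arithmetic operations have at most linear size. -/
theorem size_op_int (a b : ℤ) (m : ℤ)
    (hm : m.natAbs ≤ (a.natAbs + 1) * (b.natAbs + 1)) :
    (Data.num m).size ≤ 2 * (Data.cons (.num a) (.num b)).size + 2 := by
  simp only [Data.size]
  have h1 : m.natAbs.size ≤ (a.natAbs.size + 1) + (b.natAbs.size + 1) := by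
    rw [Nat.size_le]
    refine hm.trans_lt ?_
    rw [pow_add]
    have ha := Nat.lt_size_self a.natAbs
    have hb := Nat.lt_size_self b.natAbs
    have h2 : a.natAbs + 1 < 2 ^ (a.natAbs.size + 1) := by rw [pow_succ]; omega
    have h3 : b.natAbs + 1 < 2 ^ (b.natAbs.size + 1) := by rw [pow_succ]; omega
    exact Nat.mul_lt_mul'' h2 h3
  omega

theorem intOp (o : Op) (F : ℤ → ℤ → ℤ)
    (ho : ∀ a b, o.apply (.cons (.num a) (.num b)) = .num (F a b))
    (hF : ∀ a b, (F a b).natAbs ≤ (a.natAbs + 1) * (b.natAbs + 1)) {f g : γ → ℤ}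
    (hf : PolyTime f) (hg : PolyTime g) : PolyTime fun c => F (f c) (g c) := by
  refine PolyOn.comp (PolyOn.pair hf hg) ?_
  have h := PolyOn.op (ι := γ) (x := fun c => .cons (.num (f c)) (.num (g c))) o
    ⟨2 * .X + 2, fun c => by
      rw [ho]
      refine (size_op_int _ _ _ (hF _ _)).trans ?_
      simp⟩
  simp only [ho] at h
  exact h

@[fun_prop] theorem add {f g : γ → ℤ} (hf : PolyTime f) (hg : PolyTime g) :
    PolyTime fun c => f c + g c :=
  intOp .add (· + ·) (fun _ _ => rfl)
    (fun a b => (Int.natAbs_add_le a b).trans (by nlinarith [Nat.zero_le (a.natAbs * b.natAbs)]))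
    hf hg

@[fun_prop] theorem sub {f g : γ → ℤ} (hf : PolyTime f) (hg : PolyTime g) :
    PolyTime fun c => f c - g c :=
  intOp .sub (· - ·) (fun _ _ => rfl)
    (fun a b => (Int.natAbs_sub_le a b).trans (by nlinarith [Nat.zero_le (a.natAbs * b.natAbs)]))
    hf hg

@[fun_prop] theorem mul {f g : γ → ℤ} (hf : PolyTime f) (hg : PolyTime g) :
    PolyTime fun c => f c * g c :=
  intOp .mul (· * ·) (fun _ _ => rfl)
    (fun a b => by rw [Int.natAbs_mul]; exact Nat.mul_le_mul (by omega) (by omega)) hf hg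

@[fun_prop] theorem div {f g : γ → ℤ} (hf : PolyTime f) (hg : PolyTime g) :
    PolyTime fun c => f c / g c :=
  intOp .div (· / ·) (fun _ _ => rfl)
    (fun a b => by
      have := Int.natAbs_ediv_le_natAbs a b
      have : a.natAbs * 1 ≤ (a.natAbs + 1) * (b.natAbs + 1) :=
        Nat.mul_le_mul (by omega) (by omega)
      omega) hf hg

@[fun_prop] theorem mod {f g : γ → ℤ} (hf : PolyTime f) (hg : PolyTime g) :
    PolyTime fun c => f c % g c :=
  intOp .mod (· % ·) (fun _ _ => rfl)
    (fun a b => by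
      have h : (a % b).natAbs ≤ a.natAbs + b.natAbs := by
        rcases eq_or_ne b 0 with rfl | hb
        · simp
        · have h1 := Int.emod_nonneg a hb
          have h2 := Int.emod_lt_abs a hb
          rw [Int.abs_eq_natAbs] at h2
          omega
      nlinarith [Nat.zero_le (a.natAbs * b.natAbs)]) hf hg

@[fun_prop] theorem neg {f : γ → ℤ} (hf : PolyTime f) : PolyTime fun c => - f c := by
  simpa using (const (γ := γ) (0 : ℤ)).sub hf

@[fun_prop] theorem ite_lt {a b : γ → ℤ} {f g : γ → α} (ha : PolyTime a) (hb : PolyTime b)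
    (hf : PolyTime f) (hg : PolyTime g) : PolyTime fun c => if a c < b c then f c else g c := by
  have h := intOp .lt (fun a b => if a < b then 1 else 0) (fun _ _ => rfl)
    (fun a b => by
      have : 1 * 1 ≤ (a.natAbs + 1) * (b.natAbs + 1) := Nat.mul_le_mul (by omega) (by omega)
      split_ifs <;> simp only [Int.natAbs_one, Int.natAbs_zero] <;> omega) ha hb
  refine PolyOn.ite (fun c => a c < b c) h (fun c => by simp [enc]) ?_ ?_
  · have := PolyOn.reindex (fun j : {c // a c < b c} => j.1) hf
    exact cast (congrArg _ (funext fun j => by simp only [if_pos j.2])) this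
  · have := PolyOn.reindex (fun j : {c // ¬ a c < b c} => j.1) hg
    exact cast (congrArg _ (funext fun j => by simp only [if_neg j.2])) this

@[fun_prop] theorem ite_eq {a b : γ → ℤ} {f g : γ → α} (ha : PolyTime a) (hb : PolyTime b)
    (hf : PolyTime f) (hg : PolyTime g) : PolyTime fun c => if a c = b c then f c else g c := by
  have := ha.ite_lt hb hg (hb.ite_lt ha hg hf)
  refine cast (congrArg _ (funext fun c => ?_)) this
  rcases lt_trichotomy (a c) (b c) with h | h | h
  · simp [h, h.ne]
  · simp [h]
  · simp [h.ne', h, h.not_gt]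

theorem isNum_enc (l : List α) : Op.isNum.apply (enc l) = .num (if l = [] then 1 else 0) := by
  cases l <;> simp [Op.apply, enc, Data.ofList]

theorem polyOn_isNil {κ : Type*} (l : κ → List α) :
    PolyOn (fun k => enc (l k)) fun k => .num (if l k = [] then 1 else 0) := by
  have := PolyOn.op (x := fun k => enc (l k)) .isNum
    ⟨2, fun k => by rw [isNum_enc]; split_ifs <;> simp [Data.size]⟩
  simpa only [isNum_enc] using this

/-- Case distinction according to the shape of a list. -/
theorem listCases {l : γ → List α} (hl : PolyTime l) {f : γ → β} (hf : PolyTime f)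
    {h : γ → α → List α → β}
    (hh : PolyTime fun p : γ × α × List α => h p.1 p.2.1 p.2.2) :
    PolyTime fun c => match l c with | [] => f c | a :: t => h c a t := by
  refine PolyOn.ite (fun c => l c = []) (PolyOn.comp hl (polyOn_isNil l))
    (fun c => by simp) ?_ ?_
  · have := PolyOn.reindex (fun j : {c // l c = []} => j.1) hf
    exact cast (congrArg _ (funext fun j => by simp only [j.2])) this
  · have hne (j : {c // ¬ l c = []}) : ∃ a t, l j.1 = a :: t := List.exists_cons_of_ne_nil j.2
    choose a t hat using hne
    have h1 := PolyOn.reindex (fun j : {c // ¬ l c = []} => j.1) hl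
    have h2 : PolyOn (fun j : {c // ¬ l c = []} => enc j.1)
        fun j => .cons (enc (a j)) (enc (t j)) :=
      cast (congrArg _ (funext fun j => by rw [hat]; rfl)) h1
    have h3 := PolyOn.reindex (fun j : {c // ¬ l c = []} => (j.1, a j, t j)) hh
    exact cast (congrArg _ (funext fun j => by simp only [hat])) (((PolyOn.id _).pair h2).comp h3)

@[fun_prop] theorem headI {l : γ → List ℤ} (hl : PolyTime l) : PolyTime fun c => (l c).headI := by
  have := hl.listCases (f := fun _ => (0 : ℤ)) (h := fun _ a _ => a) (by fun_prop) (by fun_prop)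
  refine cast (congrArg _ (funext fun c => ?_)) this
  cases l c <;> rfl

/-- Folding over a list. The invariant `Inv c k` is one of the accumulator after `k` steps, it
serves to bound the sizes of the accumulators. -/
theorem foldl {l : γ → List α} {g : γ → β} {h : γ → β → α → β} (Inv : γ → ℕ → β → Prop)
    (M : γ → ℕ) (hl : PolyTime l) (hg : PolyTime g)
    (hh : PolyTime fun p : γ × β × α => h p.1 p.2.1 p.2.2) (hM : PolyBound M)
    (h0 : ∀ c, Inv c 0 (g c))
    (hstep : ∀ c k b, ∀ a ∈ l c, k < (l c).length → Inv c k b → Inv c (k + 1) (h c b a))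
    (hsize : ∀ c k b, k ≤ (l c).length → Inv c k b → esize b ≤ M c) :
    PolyTime fun c => (l c).foldl (h c) (g c) := by
  let acc (c : γ) (k : ℕ) : β := ((l c).take k).foldl (h c) (g c)
  have hacc (c : γ) (k : ℕ) (hk : k < (l c).length) : acc c (k + 1) = h c (acc c k) (l c)[k] := by
    simp only [acc, ← List.take_concat_get' _ _ hk, List.foldl_append, List.foldl_cons,
      List.foldl_nil]
  have hInv (c : γ) (k : ℕ) (hk : k ≤ (l c).length) : Inv c k (acc c k) := by
    induction k with
    | zero => exact h0 c
    | succ k ih =>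
      rw [hacc c k hk]
      exact hstep c k _ _ (List.getElem_mem _) hk (ih (by omega))
  -- The loop keeps the context, the rest of the list and the accumulator.
  let s (c : γ) (k : ℕ) : Data := enc (c, (l c).drop k, acc c k)
  have hs0 (c : γ) : s c 0 = enc (c, l c, g c) := by simp [s, acc]
  obtain ⟨q, hq⟩ := ((PolyTime.id (γ := γ)).bound.add hl.bound).add (hM.add (PolyBound.const 2))
  have hdrop (c : γ) (k : ℕ) : esize ((l c).drop k) ≤ esize (l c) := by
    induction k with
    | zero => simp
    | succ k ih =>
      rw [← List.tail_drop]
      exact (esize_tail_le _).trans ih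
  have hssize (c : γ) (k : ℕ) (hk : k ≤ (l c).length) : (s c k).size ≤ q.eval (esize c) := by
    have h1 : esize c + esize (l c) + (M c + 2) ≤ _ := hq c
    have h2 := hsize c k _ hk (hInv c k hk)
    have h3 := hdrop c k
    change esize (c, (l c).drop k, acc c k) ≤ _
    rw [esize_pair, esize_pair]
    omega
  have hcs (c : γ) : q.eval (esize c) ≤ q.eval (s c 0).size := by
    refine q.eval_le_eval_nat ?_
    change _ ≤ esize (c, (l c).drop 0, acc c 0)
    rw [esize_pair]
    omega
  have key : PolyOn (fun c => s c 0) fun c => s c (l c).length := by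
    refine PolyOn.loop s (fun c k => .num (if (l c).drop k = [] then 0 else 1))
      (fun c => (l c).length) q (fun c => ?_) (fun c k hk => (hssize c k hk).trans (hcs c)) ?_
      (fun c k hk => ?_) (fun c => ?_) ?_
    · refine le_trans ?_ (hcs c)
      have : esize c + esize (l c) + (M c + 2) ≤ _ := hq c
      have := length_lt_esize (l c)
      omega
    · refine ((PolyOn.tail _ _).comp (PolyOn.head _ _)).comp
        (y := fun j : {j : γ × ℕ // j.2 ≤ (l j.1).length} => enc ((l j.1.1).drop j.1.2)) ?_
      refine PolyOn.ite (fun j => (l j.1.1).drop j.1.2 = []) (polyOn_isNil _) (fun c => by simp)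
        ?_ ?_
      · exact cast (congrArg _ (funext fun j => by rw [if_pos j.2])) (PolyOn.const _ (.num 0))
      · exact cast (congrArg _ (funext fun j => by rw [if_neg j.2])) (PolyOn.const _ (.num 1))
    · simp [hk]
    · simp
    · have hd (j : {j : γ × ℕ // j.2 < (l j.1).length}) :
          (l j.1.1).drop j.1.2 = (l j.1.1)[j.1.2]'j.2 :: (l j.1.1).drop (j.1.2 + 1) :=
        List.drop_eq_getElem_cons j.2
      have e : (fun j : {j : γ × ℕ // j.2 < (l j.1).length} => s j.1.1 j.1.2) = fun j =>
          enc (j.1.1, (l j.1.1)[j.1.2]'j.2 :: (l j.1.1).drop (j.1.2 + 1), acc j.1.1 j.1.2) :=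
        funext fun j => by simp only [s, hd]
      have e' : (fun j : {j : γ × ℕ // j.2 < (l j.1).length} => s j.1.1 (j.1.2 + 1)) = fun j =>
          enc (j.1.1, (l j.1.1).drop (j.1.2 + 1),
            h j.1.1 (acc j.1.1 j.1.2) ((l j.1.1)[j.1.2]'j.2)) :=
        funext fun j => by simp only [s, hacc _ _ j.2]
      rw [e, e']
      have hh' := PolyOn.reindex (fun j : {j : γ × ℕ // j.2 < (l j.1).length} =>
        (j.1.1, acc j.1.1 j.1.2, (l j.1.1)[j.1.2]'j.2)) hh
      refine PolyOn.pair (PolyOn.head _ _) (PolyOn.pair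
        (((PolyOn.tail _ _).comp (PolyOn.head _ _)).comp (PolyOn.tail _ _)) (PolyOn.comp
          (PolyOn.pair (PolyOn.head _ _) (PolyOn.pair ((PolyOn.tail _ _).comp (PolyOn.tail _ _))
            (((PolyOn.tail _ _).comp (PolyOn.head _ _)).comp (PolyOn.head _ _)))) hh'))
  simp only [hs0] at key
  have h1 := PolyOn.comp ((PolyTime.id (γ := γ)).pair (hl.pair hg)) key
  have h2 := h1.comp ((PolyOn.tail _ _).comp (PolyOn.tail _ _))
  exact cast (congrArg _ (funext fun c => by simp only [acc, List.take_length])) h2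

/-- Folding over a list, when the size of the accumulator is bounded by an invariant that does not
refer to the number of steps. -/
theorem foldl_of_inv {l : γ → List α} {g : γ → β} {h : γ → β → α → β} (Inv : γ → β → Prop)
    (M : γ → ℕ) (hl : PolyTime l) (hg : PolyTime g)
    (hh : PolyTime fun p : γ × β × α => h p.1 p.2.1 p.2.2) (hM : PolyBound M)
    (h0 : ∀ c, Inv c (g c)) (hstep : ∀ c b, ∀ a ∈ l c, Inv c b → Inv c (h c b a))
    (hsize : ∀ c b, Inv c b → esize b ≤ M c) :
    PolyTime fun c => (l c).foldl (h c) (g c) :=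
  foldl (fun c _ b => Inv c b) M hl hg hh hM h0 (fun c _ b a ha _ => hstep c b a ha)
    fun c _ b _ => hsize c b

@[fun_prop] theorem reverse {l : γ → List α} (hl : PolyTime l) :
    PolyTime fun c => (l c).reverse := by
  have e : (fun c => (l c).reverse) = fun c => (l c).foldl (fun b a => a :: b) [] := by
    funext c
    rw [List.foldl_flip_cons_eq_append']
    simp
  rw [e]
  refine foldl (fun c k b => b.length ≤ k ∧ ∀ a ∈ b, esize a ≤ esize (l c))
    (fun c => (l c).length * (esize (l c) + 1) + 1) hl (by fun_prop) (by fun_prop)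
    ((hl.length_bound.mul (hl.bound.add (.const 1))).add (.const 1)) (fun c => by simp)
    (fun c k b a ha hk hb => ⟨by simpa using hb.1, ?_⟩) (fun c k b hk hb => ?_)
  · intro a' ha'
    rcases List.mem_cons.1 ha' with rfl | h
    · exact esize_le_of_mem ha
    · exact hb.2 _ h
  · have := esize_le_of_forall hb.2
    have : b.length * (esize (l c) + 1) ≤ (l c).length * (esize (l c) + 1) :=
      Nat.mul_le_mul_right _ (hb.1.trans hk)
    omega

theorem map {l : γ → List α} {h : γ → α → β} (hl : PolyTime l)
    (hh : PolyTime fun p : γ × α => h p.1 p.2) : PolyTime fun c => (l c).map (h c) := by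
  have e : (fun c => (l c).map (h c)) =
      fun c => ((l c).foldl (fun b a => h c a :: b) []).reverse := by
    funext c
    have (m : List β) : (l c).foldl (fun b a => h c a :: b) m = ((l c).map (h c)).reverse ++ m := by
      induction l c generalizing m with
      | nil => simp
      | cons a l ih => simp [ih]
    simp [this]
  rw [e]
  obtain ⟨q, hq⟩ := hh.bound
  have hb (c : γ) (a : α) (ha : a ∈ l c) :
      esize (h c a) ≤ q.eval (esize c + esize (l c) + 1) := by
    refine (hq (c, a)).trans (q.eval_le_eval_nat ?_)
    rw [esize_pair]
    have := esize_le_of_mem ha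
    omega
  have hpb : PolyBound fun c : γ => q.eval (esize c + esize (l c) + 1) := by
    obtain ⟨r, hr⟩ := hl.bound
    refine ⟨q.comp (.X + r + 1), fun c => ?_⟩
    rw [Polynomial.eval_comp]
    refine q.eval_le_eval_nat ?_
    simpa using hr c
  refine reverse ?_
  refine foldl (fun c k b => b.length ≤ k ∧ ∀ a ∈ b, esize a ≤ q.eval (esize c + esize (l c) + 1))
    (fun c => (l c).length * (q.eval (esize c + esize (l c) + 1) + 1) + 1) hl (by fun_prop)
    (h := fun c b a => h c a :: b) (.cons ?_ (by fun_prop))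
    ((hl.length_bound.mul (hpb.add (.const 1))).add (.const 1)) (fun c => by simp)
    (fun c k b a ha hk hb' => ⟨by simpa using hb'.1, ?_⟩) (fun c k b hk hb => ?_)
  · exact hh.comp (g := fun p : γ × List β × α => (p.1, p.2.2)) (by fun_prop)
  · intro a' ha'
    rcases List.mem_cons.1 ha' with rfl | h
    · exact hb _ _ ha
    · exact hb'.2 _ h
  · have := esize_le_of_forall hb.2
    have : b.length * (q.eval (esize c + esize (l c) + 1) + 1) ≤
        (l c).length * (q.eval (esize c + esize (l c) + 1) + 1) :=
      Nat.mul_le_mul_right _ (hb.1.trans hk)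
    omega

@[fun_prop] theorem append {l l' : γ → List α} (hl : PolyTime l) (hl' : PolyTime l') :
    PolyTime fun c => l c ++ l' c := by
  have e : (fun c => l c ++ l' c) = fun c => (l c).reverse.foldl (fun b a => a :: b) (l' c) := by
    funext c
    rw [List.foldl_flip_cons_eq_append']
    simp
  rw [e]
  refine foldl (fun c k b => b.length ≤ k + (l' c).length ∧
      ∀ a ∈ b, esize a ≤ esize (l c) + esize (l' c))
    (fun c => ((l c).length + (l' c).length) * (esize (l c) + esize (l' c) + 1) + 1)
    (by fun_prop) hl' (by fun_prop)
    (((hl.length_bound.add hl'.length_bound).mul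
      ((hl.bound.add hl'.bound).add (.const 1))).add (.const 1))
    (fun c => ⟨by simp, fun a ha => (esize_le_of_mem ha).trans (by omega)⟩)
    (fun c k b a ha hk hb => ⟨by simpa using by omega, ?_⟩) (fun c k b hk hb => ?_)
  · intro a' ha'
    rcases List.mem_cons.1 ha' with rfl | h
    · exact (esize_le_of_mem (List.mem_reverse.1 ha)).trans (by omega)
    · exact hb.2 _ h
  · have := esize_le_of_forall hb.2
    have : b.length * (esize (l c) + esize (l' c) + 1) ≤
        ((l c).length + (l' c).length) * (esize (l c) + esize (l' c) + 1) := by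
      refine Nat.mul_le_mul_right _ ?_
      simp at hk
      omega
    omega

@[fun_prop] theorem flatten {l : γ → List (List α)} (hl : PolyTime l) :
    PolyTime fun c => (l c).flatten := by
  have e : (fun c => (l c).flatten) = fun c => (l c).foldl (fun b a => b ++ a) [] := by
    funext c
    have (l : List (List α)) (m : List α) : l.foldl (fun b a => b ++ a) m = m ++ l.flatten := by
      induction l generalizing m with
      | nil => simp
      | cons a l ih => simp [ih]
    simp [this]
  rw [e]
  refine foldl (fun c k b => esize b ≤ k * esize (l c) + 1)
    (fun c => (l c).length * esize (l c) + 1) hl (by fun_prop) (by fun_prop)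
    ((hl.length_bound.mul hl.bound).add (.const 1)) (fun c => by simp)
    (fun c k b a ha hk hb => ?_) (fun c k b hk hb => ?_)
  · have := esize_append b a
    have := esize_le_of_mem ha
    rw [add_mul]
    omega
  · refine hb.trans ?_
    gcongr

@[fun_prop] theorem zip {l : γ → List α} {l' : γ → List β} (hl : PolyTime l) (hl' : PolyTime l') :
    PolyTime fun c => (l c).zip (l' c) := by
  -- The fold over the first list consumes the second one.
  let step (s : List β × List (α × β)) (a : α) : List β × List (α × β) :=
    match s.1 with
    | [] => s
    | b :: t => (t, (a, b) :: s.2)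
  have e : (fun c => (l c).zip (l' c)) = fun c => ((l c).foldl step (l' c, [])).2.reverse := by
    funext c
    have (l : List α) (l' : List β) (m : List (α × β)) :
        (l.foldl step (l', m)).2 = (l.zip l').reverse ++ m := by
      induction l generalizing l' m with
      | nil => simp
      | cons a l ih => cases l' with
        | nil =>
          have := ih [] m
          simpa [step] using this
        | cons b t => simp [step, ih]
    simp [this]
  rw [e]
  refine (snd ?_).reverse
  refine foldl (h := fun _ => step) (fun c k s => esize s.1 ≤ esize (l' c) ∧ s.2.length ≤ k ∧
      ∀ a ∈ s.2, esize a ≤ esize (l c) + esize (l' c) + 1)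
    (fun c => esize (l' c) + ((l c).length * (esize (l c) + esize (l' c) + 1 + 1) + 1) + 1)
    hl (by fun_prop) ?_ ?_ (fun c => by simp) (fun c k s a ha hk hs => ?_) (fun c k s hk hs => ?_)
  · exact listCases (l := fun p : γ × (List β × List (α × β)) × α => p.2.1.1) (by fun_prop)
      (f := fun p => p.2.1) (h := fun p b t => (t, (p.2.2, b) :: p.2.1.2)) (by fun_prop)
      (by fun_prop)
  · exact (hl'.bound.add ((hl.length_bound.mul (((hl.bound.add hl'.bound).add (.const 1)).add
      (.const 1))).add (.const 1))).add (.const 1)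
  · obtain ⟨l1, m⟩ := s
    cases l1 with
    | nil => exact ⟨hs.1, hs.2.1.trans (by omega), hs.2.2⟩
    | cons b t =>
      have h1 := hs.1
      rw [esize_cons] at h1
      refine ⟨by simp only [step]; omega, by simpa [step] using hs.2.1, fun x hx => ?_⟩
      rcases List.mem_cons.1 hx with rfl | h
      · rw [esize_pair]
        have := esize_le_of_mem ha
        omega
      · exact hs.2.2 _ h
  · have := esize_le_of_forall hs.2.2
    have : s.2.length * (esize (l c) + esize (l' c) + 1 + 1) ≤
        (l c).length * (esize (l c) + esize (l' c) + 1 + 1) :=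
      Nat.mul_le_mul_right _ (hs.2.1.trans hk)
    have := hs.1
    rw [esize_pair']
    omega

end PolyTime

/-! ### Further list functions and binary digits -/

/-- The nonempty suffixes of a list. -/
def suffixes {α : Type*} : List α → List (List α)
  | [] => []
  | a :: l => (a :: l) :: suffixes l

/-- The binary digits of a nonnegative integer, the most significant one first. -/
def bits (z : ℤ) : List ℤ := ((Nat.digits 2 z.toNat).map fun d : ℕ => (d : ℤ)).reverse

theorem length_bits (z : ℤ) : (bits z).length = z.toNat.size := by
  simp only [bits, List.length_reverse, List.length_map]
  rcases Nat.eq_zero_or_pos z.toNat with h | h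
  · simp [h]
  · refine le_antisymm ?_ ?_
    · rw [Nat.digits_length_le_iff one_lt_two]
      exact Nat.lt_size_self _
    · rw [Nat.size_le]
      exact Nat.lt_base_pow_length_digits one_lt_two

namespace PolyTime

variable {γ α β δ : Type*} [DataEnc γ] [DataEnc α] [DataEnc β] [DataEnc δ]

@[fun_prop] theorem suffixes {l : γ → List α} (hl : PolyTime l) :
    PolyTime fun c => suffixes (l c) := by
  have e : (fun c => _root_.suffixes (l c)) = fun c =>
      ((l c).foldl (fun (s : List α × List (List α)) _ => (s.1.tail, s.1 :: s.2))
        (l c, [])).2.reverse := by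
    funext c
    have (l : List α) (m : List (List α)) :
        (l.foldl (fun (s : List α × List (List α)) _ => (s.1.tail, s.1 :: s.2)) (l, m)).2 =
          (_root_.suffixes l).reverse ++ m := by
      induction l generalizing m with
      | nil => simp [_root_.suffixes]
      | cons a l ih => simp [_root_.suffixes, ih]
    simp [this]
  rw [e]
  refine (snd ?_).reverse
  refine foldl (fun c k s => esize s.1 ≤ esize (l c) ∧ s.2.length ≤ k ∧
      ∀ a ∈ s.2, esize a ≤ esize (l c))
    (fun c => esize (l c) + ((l c).length * (esize (l c) + 1) + 1) + 1)
    hl (by fun_prop) (by fun_prop) ?_ (fun c => by simp) (fun c k s a ha hk hs => ?_)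
    (fun c k s hk hs => ?_)
  · exact (hl.bound.add ((hl.length_bound.mul (hl.bound.add (.const 1))).add (.const 1))).add
      (.const 1)
  · refine ⟨(esize_tail_le _).trans hs.1, by simpa using hs.2.1, fun x hx => ?_⟩
    rcases List.mem_cons.1 hx with rfl | h
    · exact hs.1
    · exact hs.2.2 _ h
  · have := esize_le_of_forall hs.2.2
    have : s.2.length * (esize (l c) + 1) ≤ (l c).length * (esize (l c) + 1) :=
      Nat.mul_le_mul_right _ (hs.2.1.trans hk)
    have := hs.1
    rw [esize_pair']
    omega

theorem flatMap {l : γ → List α} {h : γ → α → List β} (hl : PolyTime l)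
    (hh : PolyTime fun p : γ × α => h p.1 p.2) : PolyTime fun c => (l c).flatMap (h c) := by
  simp only [List.flatMap_def]
  exact (hl.map hh).flatten

theorem bits_aux : PolyTime fun n : ℤ => _root_.bits n := by
  -- After `k` divisions by two, the state consists of the quotient and of the last `k` digits.
  let s (z : ℤ) (k : ℕ) : ℤ × List ℤ :=
    if z ≤ 0 then (z, []) else
    ((z.toNat / 2 ^ k : ℕ), (((Nat.digits 2 z.toNat).take k).map fun d : ℕ => (d : ℤ)).reverse)
  have hs0 (z : ℤ) : s z 0 = (z, []) := by
    simp only [s]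
    split_ifs with h
    · rfl
    · simp; omega
  have hlen (z : ℤ) : (Nat.digits 2 z.toNat).length = z.toNat.size := by
    have := length_bits z
    simpa [_root_.bits] using this
  have hpos (z : ℤ) (k : ℕ) (hk : k < z.toNat.size) : ¬ z ≤ 0 ∧ 0 < z.toNat / 2 ^ k := by
    have h := Nat.lt_size.1 hk
    refine ⟨fun h0 => ?_, Nat.div_pos h (by positivity)⟩
    rw [Int.toNat_of_nonpos h0] at h
    have : 0 < 2 ^ k := by positivity
    omega
  have hend (z : ℤ) : (s z z.toNat.size).1 ≤ 0 ∧ (s z z.toNat.size).2 = _root_.bits z := by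
    simp only [s]
    split_ifs with h
    · simp [_root_.bits, Int.toNat_of_nonpos h, h]
    · rw [← hlen, List.take_length, _root_.bits]
      refine ⟨?_, rfl⟩
      rw [hlen, Nat.div_eq_of_lt (Nat.lt_size_self _)]
      simp
  have hsz (n : ℕ) : esize (n : ℤ) = n.size + 1 := by simp [esize_int]
  have hdigit (n d : ℕ) (hd : d ∈ Nat.digits 2 n) : esize (d : ℤ) ≤ 2 := by
    have := Nat.digits_lt_base one_lt_two hd
    rw [hsz]
    interval_cases d <;> simp
  have hsize (z : ℤ) (k : ℕ) (hk : k ≤ z.toNat.size) : esize (s z k) ≤ 5 * esize z + 7 := by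
    have hz : z.toNat.size ≤ esize z := by
      rw [esize_int]
      exact (Nat.size_le_size (show z.toNat ≤ z.natAbs by omega)).trans (by omega)
    simp only [s]
    split_ifs with h
    · rw [esize_pair, esize_nil]; omega
    · rw [esize_pair, hsz]
      have h1 : (z.toNat / 2 ^ k).size ≤ z.toNat.size := Nat.size_le_size (Nat.div_le_self _ _)
      have h2 := esize_le_of_forall
        (l := (((Nat.digits 2 z.toNat).take k).map fun d : ℕ => (d : ℤ)).reverse) (m := 2)
        (fun a ha => by
          simp only [List.mem_reverse, List.mem_map] at ha
          obtain ⟨d, hd, rfl⟩ := ha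
          exact hdigit _ _ (List.mem_of_mem_take hd))
      have h3 : ((((Nat.digits 2 z.toNat).take k).map fun d : ℕ => (d : ℤ)).reverse).length ≤
          z.toNat.size := by
        simp; omega
      omega
  have key : PolyOn (fun z : ℤ => enc (s z 0)) fun z => enc (s z z.toNat.size) := by
    refine PolyOn.loop (fun z k => enc (s z k))
      (fun z k => enc (if 0 < (s z k).1 then (1 : ℤ) else 0))
      (fun z => z.toNat.size) (5 * .X + 7) (fun z => ?_) (fun z k hk => ?_) ?_ (fun z k hk => ?_)
      (fun z => ?_) ?_
    · change _ ≤ Polynomial.eval (esize (s z 0)) _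
      rw [hs0, esize_pair, esize_int]
      have := Nat.size_le_size (show z.toNat ≤ z.natAbs by omega)
      simp
      omega
    · refine (hsize z k hk).trans ?_
      change _ ≤ Polynomial.eval (esize (s z 0)) _
      rw [hs0, esize_pair]
      simp
      omega
    · exact PolyOn.reindex (fun j : {j : ℤ × ℕ // j.2 ≤ j.1.toNat.size} => s j.1.1 j.1.2)
        (show PolyTime fun p : ℤ × List ℤ => if 0 < p.1 then (1 : ℤ) else 0 by fun_prop)
    · have h := hpos z k hk
      have : 0 < (s z k).1 := by simp only [s, if_neg h.1]; exact_mod_cast h.2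
      simp [this, enc]
    · simp [(hend z).1, enc]
    · have hst := PolyOn.reindex (fun j : {j : ℤ × ℕ // j.2 < j.1.toNat.size} => s j.1.1 j.1.2)
        (show PolyTime fun p : ℤ × List ℤ => (p.1 / 2, p.1 % 2 :: p.2) by fun_prop)
      refine cast (congrArg _ (funext fun j => ?_)) hst
      obtain ⟨⟨z, k⟩, hk⟩ := j
      dsimp only at hk ⊢
      have h := hpos z k hk
      congr 1
      simp only [s, if_neg h.1]
      rw [← hlen] at hk
      rw [pow_succ, ← Nat.div_div_eq_div_mul, ← List.take_concat_get' _ _ hk,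
        List.getElem_eq_getD 0, Nat.getD_digits _ _ le_rfl]
      simp
  simp only [hs0] at key
  have h1 := PolyOn.comp (PolyOn.pair (PolyOn.id (fun z : ℤ => enc z))
    (PolyOn.const _ (enc ([] : List ℤ)))) key
  have h2 := PolyOn.comp h1 (PolyOn.tail _ _)
  exact cast (congrArg _ (funext fun z => by rw [(hend z).2])) h2

@[fun_prop] theorem bits {f : γ → ℤ} (hf : PolyTime f) : PolyTime fun c => bits (f c) :=
  bits_aux.comp hf

end PolyTime

/-! ### Vectors modulo a list of moduli -/

/-- The vector `u - q v`, reduced modulo the list `ds` of positive moduli. Coordinates with a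
nonpositive modulus are set to zero, so that the size of the result is bounded by that of `ds` in
all cases. -/
def subSmul (ds : List ℤ) (q : ℤ) (u v : List ℤ) : List ℤ :=
  ((u.zip v).zip ds).map fun t => if 0 < t.2 then (t.1.1 - q * t.1.2) % t.2 else 0

/-- The zero vector with as many coordinates as there are moduli. -/
def zeroVec (ds : List ℤ) : List ℤ := ds.map fun _ => 0

/-- The linear combination `∑ cᵢ vᵢ`. -/
def linComb (ds cs : List ℤ) (vs : List (List ℤ)) : List ℤ :=
  (cs.zip vs).foldl (fun acc t => subSmul ds (-t.1) acc t.2) (zeroVec ds)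

/-- The product of two ring elements, by means of the multiplication table `T`. -/
def mulVec (ds : List ℤ) (T : List (List (List ℤ))) (x y : List ℤ) : List ℤ :=
  linComb ds x (T.map fun row => linComb ds y row)

theorem esize_zero : esize (0 : ℤ) = 1 := rfl

theorem esize_le_of_natAbs_le {a b : ℤ} (h : a.natAbs ≤ b.natAbs) : esize a ≤ esize b := by
  rw [esize_int, esize_int]
  exact Nat.add_le_add_right (Nat.size_le_size h) 1

theorem esize_zeroVec_le (ds : List ℤ) : esize (zeroVec ds) ≤ esize ds := by
  induction ds with
  | nil => simp [zeroVec]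
  | cons d ds ih =>
    simp only [zeroVec, List.map_cons, esize_cons, esize_zero] at ih ⊢
    have := one_le_esize d
    omega

theorem esize_subSmul_le (ds : List ℤ) (q : ℤ) (u v : List ℤ) :
    esize (subSmul ds q u v) ≤ esize ds := by
  rw [subSmul]
  induction ds generalizing u v with
  | nil => simp
  | cons d ds ih =>
    cases u with
    | nil => simp
    | cons a u => cases v with
      | nil => simp
      | cons b v =>
        simp only [List.zip_cons_cons, List.map_cons, esize_cons]
        have h1 := ih u v
        have h2 : esize (if 0 < d then (a - q * b) % d else 0) ≤ esize d := by
          split_ifs with h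
          · refine esize_le_of_natAbs_le ?_
            have := Int.emod_nonneg (a - q * b) h.ne'
            have := Int.emod_lt_of_pos (a - q * b) h
            omega
          · exact one_le_esize d
        omega

theorem esize_linComb_le (ds cs : List ℤ) (vs : List (List ℤ)) :
    esize (linComb ds cs vs) ≤ esize ds := by
  rw [linComb]
  refine List.foldlRecOn (motive := fun b => esize b ≤ esize ds) _ _ (esize_zeroVec_le ds) ?_
  intro b _ a _
  exact esize_subSmul_le _ _ _ _

theorem esize_mulVec_le (ds : List ℤ) (T : List (List (List ℤ))) (x y : List ℤ) :
    esize (mulVec ds T x y) ≤ esize ds := esize_linComb_le _ _ _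

namespace PolyTime

variable {γ α : Type*} [DataEnc γ] [DataEnc α]

@[fun_prop] theorem subSmul {ds u v : γ → List ℤ} {q : γ → ℤ} (hds : PolyTime ds) (hq : PolyTime q)
    (hu : PolyTime u) (hv : PolyTime v) : PolyTime fun c => subSmul (ds c) (q c) (u c) (v c) :=
  map (h := fun c (t : (ℤ × ℤ) × ℤ) => if 0 < t.2 then (t.1.1 - q c * t.1.2) % t.2 else 0)
    (by fun_prop) (by fun_prop)

@[fun_prop] theorem zeroVec {ds : γ → List ℤ} (hds : PolyTime ds) :
    PolyTime fun c => zeroVec (ds c) :=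
  map (h := fun _ _ => 0) (by fun_prop) (by fun_prop)

@[fun_prop] theorem linComb {ds cs : γ → List ℤ} {vs : γ → List (List ℤ)} (hds : PolyTime ds)
    (hcs : PolyTime cs) (hvs : PolyTime vs) : PolyTime fun c => linComb (ds c) (cs c) (vs c) :=
  foldl_of_inv (h := fun c acc (t : ℤ × List ℤ) => _root_.subSmul (ds c) (-t.1) acc t.2)
    (fun c b => esize b ≤ esize (ds c)) _ (by fun_prop) (by fun_prop) (by fun_prop) hds.bound
    (fun c => esize_zeroVec_le _) (fun c b a _ _ => esize_subSmul_le _ _ _ _) fun c b hb => hb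

@[fun_prop] theorem mulVec {ds x y : γ → List ℤ} {T : γ → List (List (List ℤ))}
    (hds : PolyTime ds) (hT : PolyTime T) (hx : PolyTime x) (hy : PolyTime y) :
    PolyTime fun c => mulVec (ds c) (T c) (x c) (y c) :=
  linComb hds hx (map (h := fun c row => _root_.linComb (ds c) (y c) row) hT (by fun_prop))

end PolyTime

/-! ### Elimination -/

/-- One step of the Euclidean algorithm on the leading coordinates of a pair of vectors. A pair
whose second leading coordinate vanishes is left alone, so that supernumerary steps do no harm. -/
def euclidStep (ds : List ℤ) (s : List ℤ × List ℤ) : List ℤ × List ℤ :=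
  if s.2.headI = 0 then s else (s.2, subSmul ds (s.1.headI / s.2.headI) s.1 s.2)

/-- The Euclidean algorithm on the leading coordinates of a pair of vectors; the number of binary
digits of `2 d²`, with `d` the first modulus, bounds the number of steps that it takes. -/
def euclid (ds : List ℤ) (s : List ℤ × List ℤ) : List ℤ × List ℤ :=
  (bits (2 * (ds.headI * ds.headI))).foldl (fun s _ => euclidStep ds s) s

/-- Elimination of the first coordinate from the vectors in `V`: the result consists of a vector
with the pivot as leading coordinate, and of the remaining vectors without their first
coordinate. -/
def colStep (ds : List ℤ) (V : List (List ℤ)) : List ℤ × List (List ℤ) :=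
  V.foldl (fun s v => ((euclid ds (s.1, v)).1, (euclid ds (s.1, v)).2.tail :: s.2))
    (ds.headI :: zeroVec ds.tail, [])

/-- The state of an elimination: the remaining moduli, the vectors that span the lattice, a vector
that is reduced by the pivot vectors, and the list of the pivot vectors. -/
abbrev ElimState : Type := List ℤ × List (List ℤ) × List ℤ × List (List ℤ)

/-- Elimination of one coordinate: the leading coordinate of the vector that is to be reduced is
divided by the pivot, and the first coordinates are dropped. -/
def elimStep (s : ElimState) : ElimState :=
  (s.1.tail, (colStep s.1 s.2.1).2,
    (subSmul s.1 (s.2.2.1.headI / (colStep s.1 s.2.1).1.headI) s.2.2.1 (colStep s.1 s.2.1).1).tail,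
    (colStep s.1 s.2.1).1 :: s.2.2.2)

/-- Elimination of as many coordinates as `cnt` has entries. -/
def elim {α : Type*} (cnt : List α) (s : ElimState) : ElimState :=
  cnt.foldl (fun s _ => elimStep s) s

/-- The vectors of full length that arise from a list of pivot vectors, the last one of which is
given first. -/
def padRows (rows : List (List ℤ)) : List (List ℤ) :=
  rows.foldl (fun out P => P :: out.map fun v => 0 :: v) []

/-- A triangular list of vectors that spans the same group as `V`. -/
def basisRows (ds : List ℤ) (V : List (List ℤ)) : List (List ℤ) :=
  padRows (elim ds (ds, V, zeroVec ds, [])).2.2.2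

theorem euclidStep_size {ds : List ℤ} {m : ℕ} (hds : esize ds ≤ m) {s : List ℤ × List ℤ}
    (h : esize s.1 ≤ m ∧ esize s.2 ≤ m) :
    esize (euclidStep ds s).1 ≤ m ∧ esize (euclidStep ds s).2 ≤ m := by
  rw [euclidStep]
  split_ifs
  · exact h
  · exact ⟨h.2, (esize_subSmul_le _ _ _ _).trans hds⟩

theorem euclid_size {ds : List ℤ} {m : ℕ} (hds : esize ds ≤ m) {s : List ℤ × List ℤ}
    (h : esize s.1 ≤ m ∧ esize s.2 ≤ m) :
    esize (euclid ds s).1 ≤ m ∧ esize (euclid ds s).2 ≤ m := by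
  rw [euclid]
  refine List.foldlRecOn (motive := fun s : List ℤ × List ℤ => esize s.1 ≤ m ∧ esize s.2 ≤ m)
    _ _ h ?_
  intro b hb _ _
  exact euclidStep_size hds hb

theorem esize_pivot_le (ds : List ℤ) : esize (ds.headI :: zeroVec ds.tail) ≤ esize ds + 2 := by
  cases ds with
  | nil => simp [zeroVec, esize_zero]
  | cons d ds =>
    have := esize_zeroVec_le ds
    simp only [List.headI_cons, List.tail_cons, esize_cons]
    omega

theorem colStep_size {ds : List ℤ} {m : ℕ} (hds : esize ds + 2 ≤ m) {V : List (List ℤ)}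
    (hV : ∀ v ∈ V, esize v ≤ m) :
    esize (colStep ds V).1 ≤ m ∧ (colStep ds V).2.length ≤ V.length ∧
      ∀ v ∈ (colStep ds V).2, esize v ≤ m := by
  have key (V : List (List ℤ)) (hV : ∀ v ∈ V, esize v ≤ m) (s : List ℤ × List (List ℤ))
      (hs : esize s.1 ≤ m ∧ ∀ v ∈ s.2, esize v ≤ m) :
      let t := V.foldl (fun s v => ((euclid ds (s.1, v)).1, (euclid ds (s.1, v)).2.tail :: s.2)) s
      esize t.1 ≤ m ∧ t.2.length ≤ V.length + s.2.length ∧ ∀ v ∈ t.2, esize v ≤ m := by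
    induction V generalizing s with
    | nil => exact ⟨hs.1, by simp, hs.2⟩
    | cons v V ih =>
      have h1 := euclid_size (s := (s.1, v)) (show esize ds ≤ m by omega)
        ⟨hs.1, hV v List.mem_cons_self⟩
      have h2 := ih (fun v hv => hV v (List.mem_cons_of_mem _ hv))
        ((euclid ds (s.1, v)).1, (euclid ds (s.1, v)).2.tail :: s.2) ⟨h1.1, fun x hx => by
          rcases List.mem_cons.1 hx with rfl | h
          · exact (esize_tail_le _).trans h1.2
          · exact hs.2 _ h⟩
      refine ⟨h2.1, h2.2.1.trans ?_, h2.2.2⟩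
      simp only [List.length_cons]
      omega
  exact key V hV _ ⟨(esize_pivot_le ds).trans hds, by simp⟩

/-- The sizes in a state of an elimination are bounded by `m`, for at most `N` spanning vectors and
`k` pivot vectors. -/
def ElimState.SizeLe (m N k : ℕ) (s : ElimState) : Prop :=
  esize s.1 + 2 ≤ m ∧ s.2.1.length ≤ N ∧ (∀ v ∈ s.2.1, esize v ≤ m) ∧ esize s.2.2.1 ≤ m ∧
    s.2.2.2.length ≤ k ∧ ∀ v ∈ s.2.2.2, esize v ≤ m

theorem ElimState.SizeLe.step {m N k : ℕ} {s : ElimState} (h : s.SizeLe m N k) :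
    (elimStep s).SizeLe m N (k + 1) := by
  obtain ⟨h1, h2, h3, h4, h5, h6⟩ := h
  obtain ⟨c1, c2, c3⟩ := colStep_size h1 h3
  have := esize_tail_le s.1
  refine ⟨by simp only [elimStep]; omega, c2.trans h2, c3, ?_, by simpa [elimStep] using h5, ?_⟩
  · refine (esize_tail_le _).trans ((esize_subSmul_le _ _ _ _).trans ?_)
    omega
  · intro v hv
    rcases List.mem_cons.1 hv with rfl | h
    · exact c1
    · exact h6 _ h

theorem ElimState.SizeLe.elim {α : Type*} {m N k : ℕ} {s : ElimState} (h : s.SizeLe m N k)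
    (cnt : List α) : (elim cnt s).SizeLe m N (k + cnt.length) := by
  induction cnt generalizing s k with
  | nil => exact h
  | cons a cnt ih =>
    have := ih h.step
    rwa [show k + 1 + cnt.length = k + (a :: cnt).length by simp; omega] at this

theorem ElimState.SizeLe.esize_le {m N k : ℕ} {s : ElimState} (h : s.SizeLe m N k) :
    esize s ≤ 2 * m + (N + k) * (m + 1) + 5 := by
  obtain ⟨h1, h2, h3, h4, h5, h6⟩ := h
  have := esize_le_of_forall h3
  have := esize_le_of_forall h6
  have := Nat.mul_le_mul_right (m + 1) h2
  have := Nat.mul_le_mul_right (m + 1) h5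
  rw [esize_pair', esize_pair', esize_pair', add_mul]
  omega

theorem padRows_size {m : ℕ} {rows : List (List ℤ)} (h : ∀ v ∈ rows, esize v ≤ m) :
    (padRows rows).length = rows.length ∧
      ∀ v ∈ padRows rows, esize v ≤ m + 2 * rows.length := by
  induction rows using List.reverseRecOn with
  | nil => simp [padRows]
  | append_singleton rows P ih =>
    obtain ⟨h1, h2⟩ := ih fun v hv => h v (by simp [hv])
    have e : padRows (rows ++ [P]) = P :: (padRows rows).map fun v => 0 :: v := by
      simp [padRows]
    rw [e]
    refine ⟨by simp [h1], fun v hv => ?_⟩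
    rcases List.mem_cons.1 hv with rfl | hv
    · exact (h _ (by simp)).trans (by omega)
    · obtain ⟨w, hw, rfl⟩ := List.mem_map.1 hv
      have := h2 w hw
      rw [esize_cons, esize_zero, List.length_append, List.length_singleton]
      omega

theorem elimState_initial {ds : List ℤ} {V : List (List ℤ)} {w : List ℤ} {m : ℕ}
    (h1 : esize ds + 2 ≤ m) (h2 : ∀ v ∈ V, esize v ≤ m) (h3 : esize w ≤ m) :
    ElimState.SizeLe m V.length 0 (ds, V, w, []) :=
  ⟨h1, le_rfl, h2, h3, by simp, by simp⟩

theorem basisRows_size {ds : List ℤ} {V : List (List ℤ)} (h : ∀ v ∈ V, esize v ≤ esize ds + 2) :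
    esize (basisRows ds V) ≤ esize ds * (3 * esize ds + 3) + 1 := by
  obtain ⟨-, -, -, -, h5, h6⟩ := (elimState_initial (w := zeroVec ds) le_rfl h
    ((esize_zeroVec_le ds).trans (by omega))).elim ds
  obtain ⟨h7, h8⟩ := padRows_size h6
  have h9 := length_lt_esize ds
  rw [zero_add] at h5
  have h10 := esize_le_of_forall (m := 3 * esize ds + 2) (fun v hv => (h8 v hv).trans (by omega))
  refine h10.trans ?_
  gcongr
  rw [h7]
  omega

namespace PolyTime

variable {γ α : Type*} [DataEnc γ] [DataEnc α]

@[fun_prop] theorem euclid {ds : γ → List ℤ} {s : γ → List ℤ × List ℤ} (hds : PolyTime ds)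
    (hs : PolyTime s) : PolyTime fun c => euclid (ds c) (s c) :=
  foldl_of_inv (h := fun c s _ => euclidStep (ds c) s)
    (fun c b => esize b.1 ≤ esize (ds c) + esize (s c) ∧ esize b.2 ≤ esize (ds c) + esize (s c))
    (fun c => 2 * (esize (ds c) + esize (s c)) + 1) (by fun_prop) hs
    (by unfold euclidStep; fun_prop)
    (((PolyBound.const 2).mul (hds.bound.add hs.bound)).add (.const 1))
    (fun c => by rw [esize_pair' (s c)]; omega)
    (fun c b a _ hb => euclidStep_size (by omega) hb)
    fun c b hb => by rw [esize_pair']; omega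

@[fun_prop] theorem colStep {ds : γ → List ℤ} {V : γ → List (List ℤ)} (hds : PolyTime ds)
    (hV : PolyTime V) : PolyTime fun c => colStep (ds c) (V c) := by
  refine foldl (h := fun c s v => ((_root_.euclid (ds c) (s.1, v)).1,
      (_root_.euclid (ds c) (s.1, v)).2.tail :: s.2))
    (fun c k s => esize s.1 ≤ esize (ds c) + esize (V c) + 2 ∧ s.2.length ≤ k ∧
      ∀ v ∈ s.2, esize v ≤ esize (ds c) + esize (V c) + 2)
    (fun c => (esize (ds c) + esize (V c) + 2) +
      ((V c).length * (esize (ds c) + esize (V c) + 2 + 1) + 1) + 1) hV (by fun_prop)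
    (by fun_prop)
    (((hds.bound.add hV.bound).add (.const 2)).add ((hV.length_bound.mul
      (((hds.bound.add hV.bound).add (.const 2)).add (.const 1))).add (.const 1)) |>.add (.const 1))
    (fun c => ⟨(esize_pivot_le _).trans (by omega), by simp, by simp⟩) ?_ ?_
  · intro c k s v hv _ hs
    have h1 := euclid_size (ds := ds c) (s := (s.1, v)) (m := esize (ds c) + esize (V c) + 2)
      (by omega) ⟨hs.1, (esize_le_of_mem hv).trans (by omega)⟩
    refine ⟨h1.1, by simpa using hs.2.1, fun x hx => ?_⟩
    rcases List.mem_cons.1 hx with rfl | h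
    · exact (esize_tail_le _).trans h1.2
    · exact hs.2.2 _ h
  · intro c k s hk hs
    have := esize_le_of_forall hs.2.2
    have := Nat.mul_le_mul_right (esize (ds c) + esize (V c) + 2 + 1) (hs.2.1.trans hk)
    rw [esize_pair']
    omega

theorem elim {cnt : γ → List α} {ds : γ → List ℤ} {V : γ → List (List ℤ)}
    {w : γ → List ℤ} (hcnt : PolyTime cnt) (hds : PolyTime ds) (hV : PolyTime V)
    (hw : PolyTime w) : PolyTime fun c => elim (cnt c) (ds c, V c, w c, []) := by
  have hm : PolyBound fun c => esize (ds c) + esize (V c) + esize (w c) + 2 :=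
    ((hds.bound.add hV.bound).add hw.bound).add (.const 2)
  refine foldl (h := fun _ s _ => elimStep s)
    (fun c k s => s.SizeLe (esize (ds c) + esize (V c) + esize (w c) + 2) (V c).length k)
    (fun c => 2 * (esize (ds c) + esize (V c) + esize (w c) + 2) + ((V c).length + (cnt c).length) *
      (esize (ds c) + esize (V c) + esize (w c) + 2 + 1) + 5) hcnt (by fun_prop)
    (by unfold elimStep; fun_prop)
    ((((PolyBound.const 2).mul hm).add ((hV.length_bound.add hcnt.length_bound).mul
      (hm.add (.const 1)))).add (.const 5))
    (fun c => elimState_initial (by omega) (fun v hv => (esize_le_of_mem hv).trans (by omega))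
      (by omega)) (fun c k s _ _ _ hs => hs.step) (fun c k s hk hs => hs.esize_le.trans ?_)
  gcongr

@[fun_prop] theorem padRows {rows : γ → List (List ℤ)} (h : PolyTime rows) :
    PolyTime fun c => padRows (rows c) := by
  refine foldl (h := fun _ out P => P :: out.map fun v => 0 :: v)
    (fun c k out => out.length ≤ k ∧ ∀ v ∈ out, esize v ≤ esize (rows c) + 2 * k)
    (fun c => (rows c).length * (esize (rows c) + 2 * (rows c).length + 1) + 1) h (by fun_prop)
    (.cons (by fun_prop) (map (h := fun _ v => 0 :: v) (by fun_prop) (by fun_prop)))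
    ((h.length_bound.mul ((h.bound.add ((PolyBound.const 2).mul h.length_bound)).add
      (.const 1))).add (.const 1)) (fun c => by simp) ?_ ?_
  · intro c k out P hP _ ho
    refine ⟨by simpa using ho.1, fun v hv => ?_⟩
    rcases List.mem_cons.1 hv with rfl | hv
    · exact (esize_le_of_mem hP).trans (by omega)
    · obtain ⟨w, hw, rfl⟩ := List.mem_map.1 hv
      have := ho.2 w hw
      rw [esize_cons, esize_zero]
      omega
  · intro c k out hk ho
    have h1 := esize_le_of_forall (m := esize (rows c) + 2 * (rows c).length)
      fun v hv => (ho.2 v hv).trans (by omega)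
    have := Nat.mul_le_mul_right (esize (rows c) + 2 * (rows c).length + 1) (ho.1.trans hk)
    omega

@[fun_prop] theorem basisRows {ds : γ → List ℤ} {V : γ → List (List ℤ)} (hds : PolyTime ds)
    (hV : PolyTime V) : PolyTime fun c => basisRows (ds c) (V c) := by
  exact (elim hds hds hV hds.zeroVec).snd.snd.snd.padRows

end PolyTime

/-! ### The algorithms -/

/-- The list of pairs of a consecutive number, starting from the given one, and an entry. -/
def indexFrom {α : Type*} : ℤ → List α → List (ℤ × α)
  | _, [] => []
  | k, a :: l => (k, a) :: indexFrom (k + 1) l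

/-- The coordinate vectors of the generators of the additive group `ℤ/d₁ × ⋯ × ℤ/dₙ`. -/
def identityRows (ds : List ℤ) : List (List ℤ) :=
  (indexFrom 0 ds).map fun p => (indexFrom 0 ds).map fun t => if t.1 = p.1 then 1 % t.2 else 0

/-- The unit of the ring with moduli `ds` and multiplication table `T`. With `gᵢ` the generators of
the additive group, the unit is the element `x` such that `(x gᵢ)ᵢ = (gᵢ)ᵢ`; it is found by reducing
the vector `((gᵢ)ᵢ, 0)` modulo the graph of the map `x ↦ (x gᵢ)ᵢ`. -/
def findUnit (ds : List ℤ) (T : List (List (List ℤ))) : List ℤ :=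
  subSmul ds 1 (zeroVec ds)
    (elim (ds.flatMap fun _ => ds) ((ds.flatMap fun _ => ds) ++ ds,
      (T.zip (identityRows ds)).map fun t => t.1.flatten ++ t.2,
      (identityRows ds).flatten ++ zeroVec ds, [])).2.2.1

/-- The power `u ^ e`, computed by repeated squaring, for a unit `u` of order dividing `D`. The
exponent is first reduced modulo `D`, which also takes care of negative exponents. -/
def powVec (ds : List ℤ) (T : List (List (List ℤ))) (D : ℤ) (one u : List ℤ) (e : ℤ) : List ℤ :=
  (bits (e % D)).foldl (fun acc b => if b = 0 then mulVec ds T acc acc else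
    mulVec ds T (mulVec ds T acc acc) u) one

/-- Additive generators of the product of two subgroups with generators `S` and `V`. -/
def nextLevel (ds : List ℤ) (T : List (List (List ℤ))) (S V : List (List ℤ)) : List (List ℤ) :=
  basisRows ds (S.flatMap fun g => V.map fun v => mulVec ds T g v)

/-- The concatenation of lists of additive generators of the powers of the ideal that is generated
by `S`. With `D` the order of the ring, the number of its binary digits bounds the number of nonzero
powers of a nilpotent ideal. -/
def idealBasis (ds : List ℤ) (T : List (List (List ℤ))) (D : ℤ) (S : List (List ℤ)) :
    List (List ℤ) :=
  ((bits D).foldl (fun s _ => (nextLevel ds T S s.1, s.2 ++ nextLevel ds T S s.1)) (S, S)).2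

/-- In order to keep track of multiples of `b`, the vectors are extended by a further coordinate
modulo `D`, with value `1` for `b` and `0` otherwise, and all other coordinates are eliminated.
For an element `w` of the group generated by `b` and `bs`, the first component is an integer `y`
such that `w + y b` belongs to the group generated by `bs`. The second component is the order of `b`
modulo the latter group, regardless of `w`. -/
def discLog (ds : List ℤ) (D : ℤ) (b : List ℤ) (bs : List (List ℤ)) (w : List ℤ) : ℤ × ℤ :=
  let s := elim ds (ds ++ [D], (b ++ [1]) :: bs.map fun v => v ++ [0], w ++ [0], [])
  (s.2.2.1.headI, (colStep s.1 s.2.1).1.headI)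

/-- Step of `logWord`: the element `s.1`, which belongs to `1 + J` for the group `J` generated by
the indexed list `suf`, is multiplied by a power of `1 + b`, for the first entry `b`, such that the
result belongs to `1 + J'` for the group `J'` generated by the other entries; the exponent is
appended to the word `s.2`. -/
def logStep (ds : List ℤ) (T : List (List (List ℤ))) (D : ℤ) (one : List ℤ)
    (s : List ℤ × List (ℤ × ℤ)) (suf : List (ℤ × List ℤ)) : List ℤ × List (ℤ × ℤ) :=
  match suf with
  | [] => s
  | p :: ps =>
    let y := (discLog ds D p.2 (ps.map fun q => q.2) (subSmul ds 1 s.1 one)).1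
    (mulVec ds T s.1 (powVec ds T D one (subSmul ds (-1) one p.2) y), s.2 ++ [(p.1, y)])

/-- A word in the elements `1 + b`, with `b` in the indexed list `B`, that spells the inverse of
`u`. -/
def logWord (ds : List ℤ) (T : List (List (List ℤ))) (D : ℤ) (one : List ℤ)
    (B : List (ℤ × List ℤ)) (u : List ℤ) : List (ℤ × ℤ) :=
  ((suffixes B).foldl (fun s suf => logStep ds T D one s suf) (u, [])).2

/-- The relators that belong to the first entry of the indexed list `suf`: for the generator `x`
that belongs to this entry, and all later generators `y`, they express a power of `x` and the
conjugates `x⁻¹ y x` in terms of later generators. -/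
def relatorsAt (ds : List ℤ) (T : List (List (List ℤ))) (D : ℤ) (one : List ℤ)
    (suf : List (ℤ × List ℤ)) : List (List (ℤ × ℤ)) :=
  match suf with
  | [] => []
  | p :: ps =>
    let g := subSmul ds (-1) one p.2
    let r := (discLog ds D p.2 (ps.map fun q => q.2) (zeroVec ds)).2
    ((p.1, r) :: logWord ds T D one ps (powVec ds T D one g r)) ::
      ps.map fun q => (p.1, -1) :: (q.1, 1) :: (p.1, 1) :: logWord ds T D one ps
        (mulVec ds T (mulVec ds T (powVec ds T D one g (-1)) (subSmul ds (-1) one q.2)) g)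

/-- The relators of all generators. -/
def relators (ds : List ℤ) (T : List (List (List ℤ))) (D : ℤ) (one : List ℤ)
    (B : List (ℤ × List ℤ)) : List (List (ℤ × ℤ)) :=
  (suffixes B).flatMap fun suf => relatorsAt ds T D one suf

/-- The entry with index `i`. -/
def lookup (i : ℤ) (B : List (ℤ × List ℤ)) : List ℤ :=
  B.foldl (fun acc p => if p.1 = i then p.2 else acc) []

/-- The element that is spelled by a word in the elements `1 + b`, with `b` in the indexed list
`B`. -/
def expWord (ds : List ℤ) (T : List (List (List ℤ))) (D : ℤ) (one : List ℤ)
    (B : List (ℤ × List ℤ)) (w : List (ℤ × ℤ)) : List ℤ :=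
  w.foldl (fun acc s => mulVec ds T acc
    (powVec ds T D one (subSmul ds (-1) one (lookup s.1 B)) s.2)) one

/-- The encoding of a ring and an ideal: moduli, multiplication table and generators of the
ideal. -/
abbrev RingIdealCode : Type := (List ℤ × List (List (List ℤ))) × List (List ℤ)

namespace RingIdealCode

variable (x : RingIdealCode)

/-- The moduli. -/
def ds : List ℤ := x.1.1

/-- The multiplication table. -/
def T : List (List (List ℤ)) := x.1.2

/-- The order of the ring. -/
def D : ℤ := x.ds.foldl (fun a d => a * d) 1

/-- The unit of the ring. -/
def one : List ℤ := findUnit x.ds x.T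

/-- The indexed list of all `b` such that `1 + b` is a generator of the group. -/
def basis : List (ℤ × List ℤ) := indexFrom 0 (idealBasis x.ds x.T x.D x.2)

/-- The number of generators and the relators of the presentation of `1 + I`. -/
def presentation : ℤ × List (List (ℤ × ℤ)) :=
  (x.basis.foldl (fun n _ => n + 1) 0, relators x.ds x.T x.D x.one x.basis)

/-- The discrete logarithm; since `logWord` spells the inverse of its argument, it is applied to the
inverse of `u`. -/
def log (u : List ℤ) : List (ℤ × ℤ) :=
  logWord x.ds x.T x.D x.one x.basis (powVec x.ds x.T x.D x.one u (-1))

/-- The exponential map. -/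
def exp (w : List (ℤ × ℤ)) : List ℤ := expWord x.ds x.T x.D x.one x.basis w

end RingIdealCode

/-! ### The algorithms run in polynomial time -/

theorem esize_natCast_le (k : ℕ) : esize (k : ℤ) ≤ k + 1 := by
  rw [esize_int, Int.natAbs_natCast, Nat.add_le_add_iff_right, Nat.size_le]
  exact Nat.lt_two_pow_self

namespace PolyTime

variable {γ α : Type*} [DataEnc γ] [DataEnc α]

@[fun_prop] theorem length {l : γ → List α} (hl : PolyTime l) :
    PolyTime fun c => (l c).foldl (fun (n : ℤ) _ => n + 1) 0 :=
  foldl (fun _ k b => b = k) (fun c => (l c).length + 1) hl (by fun_prop) (by fun_prop)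
    (hl.length_bound.add (.const 1)) (fun _ => rfl) (fun c k b a _ _ h => by simp [h])
    fun c k b hk h => by rw [h]; exact (esize_natCast_le k).trans (by omega)

@[fun_prop] theorem indexFrom {l : γ → List α} (hl : PolyTime l) :
    PolyTime fun c => indexFrom 0 (l c) := by
  have e : (fun c => _root_.indexFrom 0 (l c)) = fun c =>
      ((l c).foldl (fun (s : ℤ × List (ℤ × α)) a => (s.1 + 1, (s.1, a) :: s.2))
        (0, [])).2.reverse := by
    funext c
    have (l : List α) (k : ℤ) (m : List (ℤ × α)) :
        (l.foldl (fun (s : ℤ × List (ℤ × α)) a => (s.1 + 1, (s.1, a) :: s.2)) (k, m)).2 =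
          (_root_.indexFrom k l).reverse ++ m := by
      induction l generalizing k m with
      | nil => simp [_root_.indexFrom]
      | cons a l ih => simp [_root_.indexFrom, ih]
    simp [this]
  rw [e]
  refine (snd ?_).reverse
  refine foldl (fun c k s => s.1 = k ∧ s.2.length ≤ k ∧
      ∀ a ∈ s.2, esize a ≤ (l c).length + 1 + esize (l c) + 1)
    (fun c => ((l c).length + 1) +
      ((l c).length * ((l c).length + 1 + esize (l c) + 1 + 1) + 1) + 1)
    hl (by fun_prop) (by fun_prop) ?_ (fun c => by simp) (fun c k s a ha hk hs => ?_)
    (fun c k s hk hs => ?_)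
  · exact ((hl.length_bound.add (.const 1)).add ((hl.length_bound.mul
      ((((hl.length_bound.add (.const 1)).add hl.bound).add (.const 1)).add (.const 1))).add
      (.const 1))).add (.const 1)
  · refine ⟨by simp [hs.1], by simpa using hs.2.1, fun x hx => ?_⟩
    rcases List.mem_cons.1 hx with rfl | h
    · rw [esize_pair, hs.1]
      have := esize_natCast_le k
      have := esize_le_of_mem ha
      omega
    · exact hs.2.2 _ h
  · have := esize_le_of_forall hs.2.2
    have := Nat.mul_le_mul_right ((l c).length + 1 + esize (l c) + 1 + 1) (hs.2.1.trans hk)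
    have := esize_natCast_le k
    rw [esize_pair', hs.1]
    omega

@[fun_prop] theorem identityRows {ds : γ → List ℤ} (hds : PolyTime ds) :
    PolyTime fun c => identityRows (ds c) :=
  map (h := fun c (p : ℤ × ℤ) => (_root_.indexFrom 0 (ds c)).map fun t : ℤ × ℤ =>
    if t.1 = p.1 then 1 % t.2 else 0) (by fun_prop)
    (map (h := fun (c : γ × ℤ × ℤ) (t : ℤ × ℤ) => if t.1 = c.2.1 then 1 % t.2 else 0)
      (by fun_prop) (by fun_prop))

@[fun_prop] theorem findUnit {ds : γ → List ℤ} {T : γ → List (List (List ℤ))}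
    (hds : PolyTime ds) (hT : PolyTime T) : PolyTime fun c => findUnit (ds c) (T c) := by
  have h1 : PolyTime fun c => (ds c).flatMap fun _ => ds c :=
    flatMap (h := fun c _ => ds c) hds (by fun_prop)
  have h2 : PolyTime fun c => ((T c).zip (_root_.identityRows (ds c))).map
      fun t => t.1.flatten ++ t.2 :=
    map (h := fun _ (t : List (List ℤ) × List ℤ) => t.1.flatten ++ t.2) (by fun_prop) (by fun_prop)
  exact subSmul hds (q := fun _ => 1) (by fun_prop) hds.zeroVec
    (elim h1 (h1.append hds) h2 (hds.identityRows.flatten.append hds.zeroVec)).snd.snd.fst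

@[fun_prop] theorem powVec {ds one u : γ → List ℤ} {T : γ → List (List (List ℤ))} {D e : γ → ℤ}
    (hds : PolyTime ds) (hT : PolyTime T) (hD : PolyTime D) (hone : PolyTime one)
    (hu : PolyTime u) (he : PolyTime e) :
    PolyTime fun c => powVec (ds c) (T c) (D c) (one c) (u c) (e c) := by
  refine foldl_of_inv (h := fun c acc b => if b = 0 then _root_.mulVec (ds c) (T c) acc acc else
    _root_.mulVec (ds c) (T c) (_root_.mulVec (ds c) (T c) acc acc) (u c))
    (fun c b => esize b ≤ esize (one c) + esize (ds c)) _ (by fun_prop) (by fun_prop)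
    (by fun_prop) (hone.bound.add hds.bound) (fun c => by omega) ?_ fun c b hb => hb
  intro c b a _ _
  split_ifs <;> exact (esize_mulVec_le _ _ _ _).trans (by omega)

@[fun_prop] theorem nextLevel {ds : γ → List ℤ} {T : γ → List (List (List ℤ))}
    {S V : γ → List (List ℤ)} (hds : PolyTime ds) (hT : PolyTime T) (hS : PolyTime S)
    (hV : PolyTime V) : PolyTime fun c => nextLevel (ds c) (T c) (S c) (V c) := by
  refine basisRows hds (flatMap
    (h := fun c g => (V c).map fun v => _root_.mulVec (ds c) (T c) g v) hS ?_)
  exact map (h := fun (p : γ × List ℤ) v => _root_.mulVec (ds p.1) (T p.1) p.2 v) (by fun_prop)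
    (by fun_prop)

theorem esize_nextLevel_le (ds : List ℤ) (T : List (List (List ℤ))) (S V : List (List ℤ)) :
    esize (_root_.nextLevel ds T S V) ≤ esize ds * (3 * esize ds + 3) + 1 := by
  refine basisRows_size fun v hv => ?_
  simp only [List.mem_flatMap, List.mem_map] at hv
  obtain ⟨g, -, w, -, rfl⟩ := hv
  exact (esize_mulVec_le _ _ _ _).trans (by omega)

@[fun_prop] theorem idealBasis {ds : γ → List ℤ} {T : γ → List (List (List ℤ))} {D : γ → ℤ}
    {S : γ → List (List ℤ)} (hds : PolyTime ds) (hT : PolyTime T) (hD : PolyTime D)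
    (hS : PolyTime S) : PolyTime fun c => idealBasis (ds c) (T c) (D c) (S c) := by
  have hN : PolyBound fun c => esize (ds c) * (3 * esize (ds c) + 3) + 1 :=
    (hds.bound.mul (((PolyBound.const 3).mul hds.bound).add (.const 3))).add (.const 1)
  refine snd (foldl (h := fun c s _ => (_root_.nextLevel (ds c) (T c) (S c) s.1,
      s.2 ++ _root_.nextLevel (ds c) (T c) (S c) s.1))
    (fun c k s => esize s.1 ≤ esize (S c) + (esize (ds c) * (3 * esize (ds c) + 3) + 1) ∧
      esize s.2 ≤ esize (S c) + k * (esize (ds c) * (3 * esize (ds c) + 3) + 1))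
    (fun c => (esize (S c) + (esize (ds c) * (3 * esize (ds c) + 3) + 1)) +
      (esize (S c) + (_root_.bits (D c)).length * (esize (ds c) * (3 * esize (ds c) + 3) + 1)) + 1)
    hD.bits (by fun_prop) (by fun_prop) ?_ (fun c => ⟨by simp, by simp⟩) ?_ ?_)
  · exact ((hS.bound.add hN).add (hS.bound.add (hD.bits.length_bound.mul hN))).add (.const 1)
  · intro c k s a _ _ hs
    have h1 := esize_nextLevel_le (ds c) (T c) (S c) s.1
    have h2 := esize_append s.2 (_root_.nextLevel (ds c) (T c) (S c) s.1)
    have := hs.2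
    refine ⟨by dsimp only; omega, ?_⟩
    dsimp only
    rw [add_mul k 1]
    omega
  · intro c k s hk hs
    have := Nat.mul_le_mul_right (esize (ds c) * (3 * esize (ds c) + 3) + 1) hk
    have := hs.1
    have := hs.2
    rw [esize_pair']
    omega

@[fun_prop] theorem discLog {ds b w : γ → List ℤ} {D : γ → ℤ} {bs : γ → List (List ℤ)}
    (hds : PolyTime ds) (hD : PolyTime D) (hb : PolyTime b) (hbs : PolyTime bs) (hw : PolyTime w) :
    PolyTime fun c => discLog (ds c) (D c) (b c) (bs c) (w c) := by
  have h1 : PolyTime fun c => (bs c).map fun v => v ++ [(0 : ℤ)] :=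
    map (h := fun _ v => v ++ [(0 : ℤ)]) (by fun_prop) (by fun_prop)
  have h2 := elim hds (ds := fun c => ds c ++ [D c]) (V := fun c => (b c ++ [1]) ::
    (bs c).map fun v => v ++ [(0 : ℤ)]) (w := fun c => w c ++ [0]) (by fun_prop) (by fun_prop)
    (by fun_prop)
  unfold _root_.discLog
  dsimp only
  exact h2.snd.snd.fst.headI.pair ((h2.fst.colStep h2.snd.fst).fst.headI)

@[fun_prop] theorem logStep {ds one : γ → List ℤ} {T : γ → List (List (List ℤ))} {D : γ → ℤ}
    {s : γ → List ℤ × List (ℤ × ℤ)} {suf : γ → List (ℤ × List ℤ)}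
    (hds : PolyTime ds) (hT : PolyTime T) (hD : PolyTime D) (hone : PolyTime one)
    (hs : PolyTime s) (hsuf : PolyTime suf) :
    PolyTime fun c => logStep (ds c) (T c) (D c) (one c) (s c) (suf c) := by
  have h1 : PolyTime fun c : γ × (ℤ × List ℤ) × List (ℤ × List ℤ) => c.2.2.map fun q => q.2 :=
    map (h := fun _ (q : ℤ × List ℤ) => q.2) (by fun_prop) (by fun_prop)
  have := listCases hsuf (f := s) hs (h := fun c p ps =>
    let y := (_root_.discLog (ds c) (D c) p.2 (ps.map fun q => q.2)
      (_root_.subSmul (ds c) 1 (s c).1 (one c))).1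
    (_root_.mulVec (ds c) (T c) (s c).1 (_root_.powVec (ds c) (T c) (D c) (one c)
      (_root_.subSmul (ds c) (-1) (one c) p.2) y), (s c).2 ++ [(p.1, y)]))
    (by dsimp only; fun_prop)
  refine cast (congrArg _ (funext fun c => ?_)) this
  cases suf c <;> rfl

theorem esize_le_of_mem_suffixes {l s : List α} (h : s ∈ _root_.suffixes l) :
    esize s ≤ esize l := by
  induction l with
  | nil => simp [_root_.suffixes] at h
  | cons a l ih =>
    rcases List.mem_cons.1 h with rfl | h
    · exact le_rfl
    · have := ih h
      rw [esize_cons]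
      omega

theorem esize_map_snd_le (l : List (ℤ × List ℤ)) : esize (l.map fun q => q.2) ≤ esize l := by
  induction l with
  | nil => simp
  | cons a l ih =>
    rw [List.map_cons, esize_cons, esize_cons, esize_pair']
    omega

@[fun_prop] theorem logWord {ds one u : γ → List ℤ} {T : γ → List (List (List ℤ))} {D : γ → ℤ}
    {B : γ → List (ℤ × List ℤ)} (hds : PolyTime ds) (hT : PolyTime T) (hD : PolyTime D)
    (hone : PolyTime one) (hB : PolyTime B) (hu : PolyTime u) :
    PolyTime fun c => logWord (ds c) (T c) (D c) (one c) (B c) (u c) := by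
  -- The sizes of all exponents are bounded by one polynomial, since the vectors whose logarithms
  -- are taken are reduced and thus no larger than `ds`.
  obtain ⟨q, hq⟩ := (show PolyTime fun t : List ℤ × ℤ × List ℤ × List (List ℤ) × List ℤ =>
    _root_.discLog t.1 t.2.1 t.2.2.1 t.2.2.2.1 t.2.2.2.2 by fun_prop).bound
  have hin : PolyBound fun c => 2 * esize (ds c) + esize (D c) + 2 * esize (B c) + 4 :=
    ((((PolyBound.const 2).mul hds.bound).add hD.bound).add
      ((PolyBound.const 2).mul hB.bound)).add (.const 4)
  have hm : PolyBound fun c =>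
      esize (B c) + q.eval (2 * esize (ds c) + esize (D c) + 2 * esize (B c) + 4) + 1 := by
    obtain ⟨r, hr⟩ := hin
    exact (hB.bound.add ⟨q.comp r, fun c => by
      rw [Polynomial.eval_comp]; exact q.eval_le_eval_nat (hr c)⟩).add (.const 1)
  generalize hmm : (fun c => esize (B c) +
    q.eval (2 * esize (ds c) + esize (D c) + 2 * esize (B c) + 4) + 1) = m at hm
  refine snd (foldl (h := fun c s suf => _root_.logStep (ds c) (T c) (D c) (one c) s suf)
    (fun c k s => esize s.1 ≤ esize (u c) + esize (ds c) ∧ s.2.length ≤ k ∧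
      ∀ a ∈ s.2, esize a ≤ m c)
    (fun c => (esize (u c) + esize (ds c)) + ((_root_.suffixes (B c)).length * (m c + 1) + 1) + 1)
    hB.suffixes (by fun_prop) (by fun_prop) ?_ (fun c => by simp) ?_ ?_)
  · exact ((hu.bound.add hds.bound).add ((hB.suffixes.length_bound.mul (hm.add (.const 1))).add
      (.const 1))).add (.const 1)
  · intro c k s suf hsuf _ hs
    have h1 := esize_le_of_mem_suffixes hsuf
    cases suf with
    | nil => exact ⟨hs.1, hs.2.1.trans (by omega), hs.2.2⟩
    | cons p ps =>
      refine ⟨(esize_mulVec_le _ _ _ _).trans (by omega), by simpa [_root_.logStep] using hs.2.1,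
        fun a ha => ?_⟩
      rcases List.mem_append.1 ha with ha | ha
      · exact hs.2.2 _ ha
      · rw [List.mem_singleton.1 ha, esize_pair]
        rw [esize_cons, esize_pair'] at h1
        have h2 := hq (ds c, D c, p.2, ps.map fun q => q.2,
          _root_.subSmul (ds c) 1 s.1 (one c))
        dsimp only at h2
        rw [esize_pair'] at h2
        have h3 := esize_subSmul_le (ds c) 1 s.1 (one c)
        have h4 := esize_map_snd_le ps
        have h5 := q.eval_le_eval_nat (a := esize (ds c, D c, p.2, ps.map fun q => q.2,
          _root_.subSmul (ds c) 1 s.1 (one c)))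
          (b := 2 * esize (ds c) + esize (D c) + 2 * esize (B c) + 4)
          (by simp only [esize_pair]; omega)
        rw [← hmm]
        dsimp only
        omega
  · intro c k s hk hs
    have := esize_le_of_forall hs.2.2
    have := Nat.mul_le_mul_right (m c + 1) (hs.2.1.trans hk)
    have := hs.1
    rw [esize_pair']
    omega

@[fun_prop] theorem relatorsAt {ds one : γ → List ℤ} {T : γ → List (List (List ℤ))} {D : γ → ℤ}
    {suf : γ → List (ℤ × List ℤ)} (hds : PolyTime ds) (hT : PolyTime T) (hD : PolyTime D)
    (hone : PolyTime one) (hsuf : PolyTime suf) :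
    PolyTime fun c => relatorsAt (ds c) (T c) (D c) (one c) (suf c) := by
  have h1 : PolyTime fun c : γ × (ℤ × List ℤ) × List (ℤ × List ℤ) => c.2.2.map fun q => q.2 :=
    map (h := fun _ (q : ℤ × List ℤ) => q.2) (by fun_prop) (by fun_prop)
  have h2 : PolyTime fun c : γ × (ℤ × List ℤ) × List (ℤ × List ℤ) => c.2.2.map fun q =>
      (c.2.1.1, (-1 : ℤ)) :: (q.1, 1) :: (c.2.1.1, 1) ::
        _root_.logWord (ds c.1) (T c.1) (D c.1) (one c.1) c.2.2
          (_root_.mulVec (ds c.1) (T c.1) (_root_.mulVec (ds c.1) (T c.1)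
            (_root_.powVec (ds c.1) (T c.1) (D c.1) (one c.1)
              (_root_.subSmul (ds c.1) (-1) (one c.1) c.2.1.2) (-1))
            (_root_.subSmul (ds c.1) (-1) (one c.1) q.2))
            (_root_.subSmul (ds c.1) (-1) (one c.1) c.2.1.2)) :=
    map (h := fun (c : γ × (ℤ × List ℤ) × List (ℤ × List ℤ)) (q : ℤ × List ℤ) =>
      (c.2.1.1, (-1 : ℤ)) :: (q.1, 1) :: (c.2.1.1, 1) ::
        _root_.logWord (ds c.1) (T c.1) (D c.1) (one c.1) c.2.2
          (_root_.mulVec (ds c.1) (T c.1) (_root_.mulVec (ds c.1) (T c.1)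
            (_root_.powVec (ds c.1) (T c.1) (D c.1) (one c.1)
              (_root_.subSmul (ds c.1) (-1) (one c.1) c.2.1.2) (-1))
            (_root_.subSmul (ds c.1) (-1) (one c.1) q.2))
            (_root_.subSmul (ds c.1) (-1) (one c.1) c.2.1.2))) (by fun_prop) (by fun_prop)
  have := listCases hsuf (f := fun _ => ([] : List (List (ℤ × ℤ)))) (by fun_prop)
    (h := fun c p ps => _root_.relatorsAt (ds c) (T c) (D c) (one c) (p :: ps))
    (by unfold _root_.relatorsAt; dsimp only; fun_prop)
  refine cast (congrArg _ (funext fun c => ?_)) this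
  cases suf c <;> rfl

@[fun_prop] theorem relators {ds one : γ → List ℤ} {T : γ → List (List (List ℤ))} {D : γ → ℤ}
    {B : γ → List (ℤ × List ℤ)} (hds : PolyTime ds) (hT : PolyTime T) (hD : PolyTime D)
    (hone : PolyTime one) (hB : PolyTime B) :
    PolyTime fun c => relators (ds c) (T c) (D c) (one c) (B c) :=
  flatMap (h := fun c suf => _root_.relatorsAt (ds c) (T c) (D c) (one c) suf) (by fun_prop)
    (by fun_prop)

@[fun_prop] theorem lookup {i : γ → ℤ} {B : γ → List (ℤ × List ℤ)} (hi : PolyTime i)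
    (hB : PolyTime B) : PolyTime fun c => lookup (i c) (B c) := by
  refine foldl_of_inv (g := fun _ => []) (h := fun c acc p => if p.1 = i c then p.2 else acc)
    (fun c b => esize b ≤ esize (B c)) _ hB (by fun_prop) (by fun_prop) hB.bound
    (fun c => (esize_nil (α := ℤ)).trans_le (one_le_esize _)) ?_ fun c b hb => hb
  intro c b a ha hb
  split_ifs
  · have := esize_le_of_mem ha
    rw [esize_pair'] at this
    omega
  · exact hb

@[fun_prop] theorem expWord {ds one : γ → List ℤ} {T : γ → List (List (List ℤ))} {D : γ → ℤ}
    {B : γ → List (ℤ × List ℤ)} {w : γ → List (ℤ × ℤ)} (hds : PolyTime ds) (hT : PolyTime T)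
    (hD : PolyTime D) (hone : PolyTime one) (hB : PolyTime B) (hw : PolyTime w) :
    PolyTime fun c => expWord (ds c) (T c) (D c) (one c) (B c) (w c) := by
  refine foldl_of_inv (g := one) (h := fun c acc (s : ℤ × ℤ) => _root_.mulVec (ds c) (T c) acc
    (_root_.powVec (ds c) (T c) (D c) (one c)
      (_root_.subSmul (ds c) (-1) (one c) (_root_.lookup s.1 (B c))) s.2))
    (fun c b => esize b ≤ esize (one c) + esize (ds c)) _ (by fun_prop) (by fun_prop)
    (by fun_prop) (hone.bound.add hds.bound) (fun c => by omega) ?_ fun c b hb => hb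
  intro c b a _ _
  exact (esize_mulVec_le _ _ _ _).trans (by omega)

end PolyTime

namespace RingIdealCode

@[fun_prop] theorem polyTime_D : PolyTime D := by
  have hds : PolyTime ds := PolyTime.id.fst.fst
  have hmul (a b : ℤ) : esize (a * b) ≤ esize a + esize b := by
    simp only [esize_int]
    have : (a * b).natAbs.size ≤ a.natAbs.size + b.natAbs.size := by
      rw [Nat.size_le, Int.natAbs_mul, pow_add]
      exact Nat.mul_lt_mul'' (Nat.lt_size_self _) (Nat.lt_size_self _)
    omega
  refine PolyTime.foldl (h := fun _ a d => a * d) (fun c k b => esize b ≤ k * esize c.ds + 2)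
    (fun c => c.ds.length * esize c.ds + 2) hds (by fun_prop) (by fun_prop)
    ((hds.length_bound.mul hds.bound).add (.const 2)) (fun c => by simp [esize_int]) ?_ ?_
  · intro c k b a ha _ hb
    have := esize_le_of_mem ha
    have := hmul b a
    rw [add_mul]
    omega
  · intro c k b hk hb
    refine hb.trans ?_
    gcongr

theorem polyTime_one : PolyTime one := by
  have : PolyTime fun x : RingIdealCode => findUnit x.1.1 x.1.2 := by fun_prop
  exact this

theorem polyTime_basis : PolyTime basis := by
  have := polyTime_D
  have : PolyTime fun x : RingIdealCode => indexFrom 0 (idealBasis x.1.1 x.1.2 x.D x.2) := by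
    fun_prop
  exact this

theorem polyTime_presentation : PolyTime presentation := by
  have h1 := polyTime_D
  have h2 := polyTime_basis
  have h3 := polyTime_one
  have : PolyTime fun x : RingIdealCode => (x.basis.foldl (fun (n : ℤ) _ => n + 1) 0,
      relators x.1.1 x.1.2 x.D x.one x.basis) := by fun_prop
  exact this

theorem polyTime_log : PolyTime fun p : RingIdealCode × List ℤ => p.1.log p.2 := by
  have h1 := polyTime_D
  have h2 := polyTime_basis
  have h3 := polyTime_one
  have : PolyTime fun p : RingIdealCode × List ℤ => logWord p.1.1.1 p.1.1.2 p.1.D p.1.one p.1.basis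
      (powVec p.1.1.1 p.1.1.2 p.1.D p.1.one p.2 (-1)) := by fun_prop
  exact this

theorem polyTime_exp : PolyTime fun p : RingIdealCode × List (ℤ × ℤ) => p.1.exp p.2 := by
  have h1 := polyTime_D
  have h2 := polyTime_basis
  have h3 := polyTime_one
  have : PolyTime fun p : RingIdealCode × List (ℤ × ℤ) =>
    expWord p.1.1.1 p.1.1.2 p.1.D p.1.one p.1.basis p.2 := by fun_prop
  exact this

end RingIdealCode

/-! ### Vectors as elements of a finite abelian group -/

section LatticeSpec

variable {A : Type*} [AddCommGroup A]

/-- The element `∑ vᵢ gᵢ`. Surplus entries of the longer one of the two lists are ignored. -/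
def ev : List A → List ℤ → A
  | g :: gs, a :: v => a • g + ev gs v
  | _, _ => 0

@[simp] theorem ev_nil_left (v : List ℤ) : ev ([] : List A) v = 0 := by cases v <;> rfl

@[simp] theorem ev_nil_right (gs : List A) : ev gs [] = 0 := by cases gs <;> rfl

@[simp] theorem ev_cons (g : A) (gs : List A) (a : ℤ) (v : List ℤ) :
    ev (g :: gs) (a :: v) = a • g + ev gs v := rfl

/-- The subgroup generated by the entries of a list. -/
abbrev spanList (l : List A) : AddSubgroup A := AddSubgroup.closure {a | a ∈ l}

theorem spanList_cons (a : A) (l : List A) :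
    spanList (a :: l) = AddSubgroup.zmultiples a ⊔ spanList l := by
  rw [spanList, spanList, AddSubgroup.zmultiples_eq_closure, ← AddSubgroup.closure_union]
  congr 1
  ext x
  simp

theorem mem_spanList_cons {a : A} {l : List A} {x : A} :
    x ∈ spanList (a :: l) ↔ ∃ c : ℤ, ∃ y ∈ spanList l, x = c • a + y := by
  rw [spanList_cons, AddSubgroup.mem_sup]
  constructor
  · rintro ⟨y, ⟨c, rfl⟩, z, hz, rfl⟩
    exact ⟨c, z, hz, rfl⟩
  · rintro ⟨c, y, hy, rfl⟩
    exact ⟨c • a, ⟨c, rfl⟩, y, hy, rfl⟩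

theorem spanList_le_cons (a : A) (l : List A) : spanList l ≤ spanList (a :: l) := by
  rw [spanList_cons]; exact le_sup_right

theorem mem_spanList {a : A} {l : List A} (h : a ∈ l) : a ∈ spanList l :=
  AddSubgroup.subset_closure h

theorem ev_mem_spanList (gs : List A) (v : List ℤ) : ev gs v ∈ spanList gs := by
  induction gs generalizing v with
  | nil => simp
  | cons g gs ih => cases v with
    | nil => simp
    | cons a v => exact mem_spanList_cons.2 ⟨a, _, ih v, rfl⟩

theorem exists_ev_eq {gs : List A} {x : A} (h : x ∈ spanList gs) :
    ∃ v : List ℤ, v.length = gs.length ∧ ev gs v = x := by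
  induction gs generalizing x with
  | nil => exact ⟨[], rfl, by rw [spanList] at h; simpa [eq_comm] using h⟩
  | cons g gs ih =>
    obtain ⟨c, y, hy, rfl⟩ := mem_spanList_cons.1 h
    obtain ⟨v, hv, rfl⟩ := ih hy
    exact ⟨c :: v, by simp [hv], rfl⟩

theorem ev_map {B : Type*} [AddCommGroup B] (f : A →+ B) (gs : List A) (v : List ℤ) :
    ev (gs.map f) v = f (ev gs v) := by
  induction gs generalizing v with
  | nil => simp
  | cons g gs ih => cases v with
    | nil => simp
    | cons a v => simp [ih]

theorem ev_append (gs hs : List A) (v w : List ℤ) (h : v.length = gs.length) :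
    ev (gs ++ hs) (v ++ w) = ev gs v + ev hs w := by
  induction gs generalizing v with
  | nil => simp_all
  | cons g gs ih => cases v with
    | nil => simp at h
    | cons a v =>
      simp only [List.cons_append, ev_cons, ih v (by simpa using h), add_assoc]

/-- The group that is generated by `gs` is the direct sum of the subgroups generated by the entries
of `gs`, and the orders of these entries are the entries of `ds`. -/
def IsCyclicBasis : List ℤ → List A → Prop
  | [], [] => True
  | d :: ds, g :: gs =>
    0 < d ∧ d • g = 0 ∧ (∀ c : ℤ, c • g ∈ spanList gs → d ∣ c) ∧ IsCyclicBasis ds gs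
  | _, _ => False

namespace IsCyclicBasis

theorem length_eq {ds : List ℤ} {gs : List A} (h : IsCyclicBasis ds gs) :
    ds.length = gs.length := by
  induction ds generalizing gs with
  | nil => cases gs with
    | nil => rfl
    | cons g gs => exact h.elim
  | cons d ds ih => cases gs with
    | nil => exact h.elim
    | cons g gs => simp [ih h.2.2.2]

theorem map {B : Type*} [AddCommGroup B] (f : A →+ B) (hf : Function.Injective f) {ds : List ℤ}
    {gs : List A} (h : IsCyclicBasis ds gs) : IsCyclicBasis ds (gs.map f) := by
  induction ds generalizing gs with
  | nil => cases gs with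
    | nil => trivial
    | cons g gs => exact h.elim
  | cons d ds ih => cases gs with
    | nil => exact h.elim
    | cons g gs =>
      refine ⟨h.1, by rw [← map_zsmul, h.2.1, map_zero], fun c hc => h.2.2.1 c ?_, ih h.2.2.2⟩
      obtain ⟨v, -, hv⟩ := exists_ev_eq hc
      rw [ev_map, ← map_zsmul] at hv
      rw [← hf hv]
      exact ev_mem_spanList _ _

theorem append {ds es : List ℤ} {gs hs : List A} (h : IsCyclicBasis ds gs)
    (h' : IsCyclicBasis es hs) (hd : Disjoint (spanList gs) (spanList hs)) :
    IsCyclicBasis (ds ++ es) (gs ++ hs) := by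
  induction ds generalizing gs with
  | nil => cases gs with
    | nil => exact h'
    | cons g gs => exact h.elim
  | cons d ds ih => cases gs with
    | nil => exact h.elim
    | cons g gs =>
      refine ⟨h.1, h.2.1, fun c hc => h.2.2.1 c ?_,
        ih h.2.2.2 (hd.mono_left (spanList_le_cons _ _))⟩
      obtain ⟨v, hv1, hv⟩ := exists_ev_eq (gs := gs ++ hs) hc
      rw [← List.take_append_drop gs.length v, ev_append _ _ _ _ (by simp [hv1])] at hv
      have h1 := ev_mem_spanList gs (v.take gs.length)
      have h2 := ev_mem_spanList hs (v.drop gs.length)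
      have h3 : ev hs (v.drop gs.length) = 0 := by
        refine AddSubgroup.disjoint_def.1 hd ?_ h2
        rw [eq_sub_of_add_eq' hv]
        exact sub_mem (mem_spanList_cons.2 ⟨c, 0, zero_mem _, by simp⟩)
          (spanList_le_cons _ _ h1)
      rw [← hv, h3, add_zero]
      exact h1

end IsCyclicBasis

/-- The entries of the vector are reduced modulo the entries of `ds`. -/
def ReducedMod : List ℤ → List ℤ → Prop := List.Forall₂ fun d a => 0 ≤ a ∧ a < d

theorem ReducedMod.length_eq {ds v : List ℤ} (h : ReducedMod ds v) : v.length = ds.length :=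
  (List.Forall₂.length_eq h).symm

/-- Elements have unique reduced coordinates. -/
theorem ReducedMod.ext {ds : List ℤ} {gs : List A} (hb : IsCyclicBasis ds gs) {u v : List ℤ}
    (hu : ReducedMod ds u) (hv : ReducedMod ds v) (h : ev gs u = ev gs v) : u = v := by
  induction ds generalizing gs u v with
  | nil => cases hu; cases hv; rfl
  | cons d ds ih =>
    cases gs with
    | nil => exact hb.elim
    | cons g gs =>
      cases hu with | cons ha hu =>
      cases hv with | cons hc hv =>
      rename_i a u c v
      have hsub : ev gs u - ev gs v = (c - a) • g := by
        rw [sub_smul, sub_eq_sub_iff_add_eq_add]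
        simp only [ev_cons] at h
        rw [add_comm, h, add_comm]
      have hd : d ∣ c - a := hb.2.2.1 _ (by
        rw [← hsub]; exact sub_mem (ev_mem_spanList _ _) (ev_mem_spanList _ _))
      have hac : a = c := by
        have h1 := Int.eq_zero_of_abs_lt_dvd hd (by rw [abs_lt]; omega)
        omega
      subst hac
      simp only [ev_cons, add_right_inj] at h
      rw [ih hb.2.2.2 hu hv h]

theorem subSmul_cons (d : ℤ) (ds : List ℤ) (q a b : ℤ) (u v : List ℤ) :
    subSmul (d :: ds) q (a :: u) (b :: v) =
      (if 0 < d then (a - q * b) % d else 0) :: subSmul ds q u v := rfl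

theorem length_subSmul {ds u v : List ℤ} (q : ℤ) (hu : u.length = ds.length)
    (hv : v.length = ds.length) : (subSmul ds q u v).length = ds.length := by
  simp [subSmul, hu, hv]

theorem reducedMod_subSmul {ds : List ℤ} {gs : List A} (hb : IsCyclicBasis ds gs) {u v : List ℤ}
    (q : ℤ) (hu : u.length = ds.length) (hv : v.length = ds.length) :
    ReducedMod ds (subSmul ds q u v) := by
  induction ds generalizing gs u v with
  | nil => simp [subSmul, ReducedMod]
  | cons d ds ih =>
    cases gs with
    | nil => exact hb.elim
    | cons g gs => cases u with
      | nil => simp at hu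
      | cons a u => cases v with
        | nil => simp at hv
        | cons b v =>
          rw [subSmul_cons, if_pos hb.1]
          exact .cons ⟨Int.emod_nonneg _ hb.1.ne', Int.emod_lt_of_pos _ hb.1⟩
            (ih hb.2.2.2 (by simpa using hu) (by simpa using hv))

theorem emod_zsmul {d : ℤ} {g : A} (h : d • g = 0) (a : ℤ) : (a % d) • g = a • g := by
  rw [Int.emod_def, sub_smul, mul_comm, mul_zsmul, h, smul_zero, sub_zero]

theorem ev_subSmul {ds : List ℤ} {gs : List A} (hb : IsCyclicBasis ds gs) {u v : List ℤ}
    (q : ℤ) (hu : u.length = ds.length) (hv : v.length = ds.length) :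
    ev gs (subSmul ds q u v) = ev gs u - q • ev gs v := by
  induction ds generalizing gs u v with
  | nil => cases gs with
    | nil => simp
    | cons g gs => exact hb.elim
  | cons d ds ih =>
    cases gs with
    | nil => exact hb.elim
    | cons g gs => cases u with
      | nil => simp at hu
      | cons a u => cases v with
        | nil => simp at hv
        | cons b v =>
          rw [subSmul_cons, if_pos hb.1, ev_cons, ev_cons, ev_cons, emod_zsmul hb.2.1,
            ih hb.2.2.2 (by simpa using hu) (by simpa using hv), sub_smul, mul_zsmul, smul_add]
          abel

@[simp] theorem length_zeroVec (ds : List ℤ) : (zeroVec ds).length = ds.length := by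
  simp [zeroVec]

@[simp] theorem ev_zeroVec (gs : List A) (ds : List ℤ) : ev gs (zeroVec ds) = 0 := by
  induction ds generalizing gs with
  | nil => simp [zeroVec]
  | cons d ds ih => cases gs with
    | nil => simp
    | cons g gs => simpa [zeroVec] using ih gs

theorem linComb_spec {ds : List ℤ} {gs : List A} (hb : IsCyclicBasis ds gs) (cs : List ℤ)
    {vs : List (List ℤ)} (hvs : ∀ v ∈ vs, v.length = ds.length) :
    (linComb ds cs vs).length = ds.length ∧
      ev gs (linComb ds cs vs) = ev (vs.map (ev gs)) cs := by
  have key (acc : List ℤ) (hacc : acc.length = ds.length) :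
      ((cs.zip vs).foldl (fun acc t => subSmul ds (-t.1) acc t.2) acc).length = ds.length ∧
      ev gs ((cs.zip vs).foldl (fun acc t => subSmul ds (-t.1) acc t.2) acc) =
        ev gs acc + ev (vs.map (ev gs)) cs := by
    induction vs generalizing cs acc with
    | nil => simp [hacc]
    | cons v vs ih => cases cs with
      | nil => simp [hacc]
      | cons c cs =>
        have hv := hvs v List.mem_cons_self
        obtain ⟨h1, h2⟩ := ih cs (fun v hv => hvs v (List.mem_cons_of_mem _ hv))
          (subSmul ds (-c) acc v) (length_subSmul _ hacc hv)
        refine ⟨h1, ?_⟩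
        simp only [List.zip_cons_cons, List.foldl_cons, List.map_cons, ev_cons]
        rw [h2, ev_subSmul hb _ hacc hv, neg_smul, sub_neg_eq_add, add_assoc]
  simpa [linComb] using key (zeroVec ds) (by simp)

theorem reducedMod_zeroVec {ds : List ℤ} {gs : List A} (hb : IsCyclicBasis ds gs) :
    ReducedMod ds (zeroVec ds) := by
  induction ds generalizing gs with
  | nil => simp [zeroVec, ReducedMod]
  | cons d ds ih =>
    cases gs with
    | nil => exact hb.elim
    | cons g gs => exact .cons ⟨le_rfl, hb.1⟩ (ih hb.2.2.2)

theorem reducedMod_linComb {ds : List ℤ} {gs : List A} (hb : IsCyclicBasis ds gs) (cs : List ℤ)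
    {vs : List (List ℤ)} (hvs : ∀ v ∈ vs, v.length = ds.length) :
    ReducedMod ds (linComb ds cs vs) := by
  rw [linComb]
  refine List.foldlRecOn (motive := fun b => ReducedMod ds b) _ _ (reducedMod_zeroVec hb) ?_
  intro b hb' t ht
  exact reducedMod_subSmul hb _ hb'.length_eq (hvs _ (List.of_mem_zip ht).2)

/-! ### Correctness of the elimination -/

/-- The entries of the vector lie between zero and the entries of `ds`, both included. -/
def WeaklyReduced : List ℤ → List ℤ → Prop := List.Forall₂ fun d a => 0 ≤ a ∧ a ≤ d

theorem WeaklyReduced.length_eq {ds v : List ℤ} (h : WeaklyReduced ds v) : v.length = ds.length :=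
  (List.Forall₂.length_eq h).symm

theorem ReducedMod.weaklyReduced {ds v : List ℤ} (h : ReducedMod ds v) : WeaklyReduced ds v :=
  h.imp fun _ _ h => ⟨h.1, h.2.le⟩

/-- Both components of the state are weakly reduced vectors for the moduli `d :: ds`. -/
def EuclidOk (d : ℤ) (ds : List ℤ) (s : List ℤ × List ℤ) : Prop :=
  ∃ p ps a v, s = (p :: ps, a :: v) ∧ WeaklyReduced ds ps ∧ WeaklyReduced ds v ∧
    0 ≤ p ∧ p ≤ d ∧ 0 ≤ a ∧ a ≤ d

/-- The leading coordinate of a vector, and the element that it stands for. Recording the coordinate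
as an integer lifts the first cyclic summand to an infinite cyclic group. -/
def lift (gs : List A) (v : List ℤ) : ℤ × A := (v.headI, ev gs v)

/-- The subgroup of the lifted group that is spanned by the pair. -/
def pairSpan (gs : List A) (s : List ℤ × List ℤ) : AddSubgroup (ℤ × A) :=
  spanList [lift gs s.1, lift gs s.2]

/-- A Euclidean step preserves the span even in the lifted group: as the new leading coordinate is
smaller than the modulus, it is not changed by the reduction. -/
theorem euclidStep_spec {d : ℤ} {ds : List ℤ} {g : A} {gs : List A}
    (hb : IsCyclicBasis (d :: ds) (g :: gs)) {s : List ℤ × List ℤ} (hs : EuclidOk d ds s) :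
    EuclidOk d ds (euclidStep (d :: ds) s) ∧
      pairSpan (g :: gs) (euclidStep (d :: ds) s) = pairSpan (g :: gs) s := by
  obtain ⟨p, ps, a, v, rfl, h1, h2, h3, h4, h5, h6⟩ := hs
  by_cases ha : a = 0
  · rw [euclidStep, if_pos (by simpa using ha)]
    exact ⟨⟨p, ps, a, v, rfl, h1, h2, h3, h4, h5, h6⟩, rfl⟩
  · rw [euclidStep, if_neg (by simpa using ha)]
    simp only [List.headI_cons]
    have ha' : 0 < a := by omega
    have hpa : (p - p / a * a) % d = p - p / a * a := by
      have : p - p / a * a = p % a := by rw [Int.emod_def]; ring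
      rw [this]
      have := Int.emod_nonneg p ha
      have := Int.emod_lt_of_pos p ha'
      exact Int.emod_eq_of_lt (by omega) (by omega)
    have hpb : p - p / a * a = p % a := by rw [Int.emod_def]; ring
    have h7 := ev_subSmul hb (u := p :: ps) (v := a :: v) (p / a)
      (by simp [h1.length_eq]) (by simp [h2.length_eq])
    rw [subSmul_cons, if_pos hb.1, hpa] at h7 ⊢
    refine ⟨⟨a, v, _, _, rfl, h2,
      (reducedMod_subSmul hb.2.2.2 _ h1.length_eq h2.length_eq).weaklyReduced,
      by omega, h6, ?_, ?_⟩, ?_⟩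
    · rw [hpb]; exact Int.emod_nonneg p ha
    · rw [hpb]; have := Int.emod_lt_of_pos p ha'; omega
    · have hl : lift (g :: gs) ((p - p / a * a) :: subSmul ds (p / a) ps v) =
          lift (g :: gs) (p :: ps) - (p / a) • lift (g :: gs) (a :: v) := by
        simp only [lift, h7, List.headI_cons]
        ext <;> simp
      simp only [pairSpan, hl]
      apply le_antisymm
      · rw [AddSubgroup.closure_le]
        intro x hx
        have e1 : lift (g :: gs) (p :: ps) ∈
            spanList [lift (g :: gs) (p :: ps), lift (g :: gs) (a :: v)] :=
          mem_spanList (by simp)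
        have e2 : lift (g :: gs) (a :: v) ∈
            spanList [lift (g :: gs) (p :: ps), lift (g :: gs) (a :: v)] :=
          mem_spanList (by simp)
        simp only [List.mem_cons, List.not_mem_nil, or_false, Set.mem_ofPred_eq] at hx
        rcases hx with rfl | rfl
        · exact e2
        · exact sub_mem e1 (zsmul_mem e2 _)
      · rw [AddSubgroup.closure_le]
        intro x hx
        have e1 := mem_spanList (l := [lift (g :: gs) (a :: v),
          lift (g :: gs) (p :: ps) - (p / a) • lift (g :: gs) (a :: v)])
          (a := lift (g :: gs) (a :: v)) (by simp)
        have e2 := mem_spanList (l := [lift (g :: gs) (a :: v),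
          lift (g :: gs) (p :: ps) - (p / a) • lift (g :: gs) (a :: v)])
          (a := lift (g :: gs) (p :: ps) - (p / a) • lift (g :: gs) (a :: v)) (by simp)
        simp only [List.mem_cons, List.not_mem_nil, or_false, Set.mem_ofPred_eq] at hx
        rcases hx with rfl | rfl
        · have := add_mem e2 (zsmul_mem e1 (p / a))
          rwa [sub_add_cancel] at this
        · exact e1

theorem euclidStep_heads (ds : List ℤ) (p a : ℤ) (ps v : List ℤ) (ha : a ≠ 0) {d : ℤ}
    (h : EuclidOk d ds (p :: ps, a :: v)) (hd : 0 < d) :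
    ((euclidStep (d :: ds) (p :: ps, a :: v)).1.headI,
      (euclidStep (d :: ds) (p :: ps, a :: v)).2.headI) = (a, p % a) := by
  obtain ⟨_, _, _, _, h0, h1, h2, h3, h4, h5, h6⟩ := h
  cases h0
  have hpb : p - p / a * a = p % a := by rw [Int.emod_def]; ring
  have := Int.emod_nonneg p ha
  have := Int.emod_lt_of_pos p (show 0 < a by omega)
  rw [euclidStep, if_neg (by simpa using ha), subSmul_cons, if_pos hd]
  simp only [List.headI_cons]
  rw [hpb, Int.emod_eq_of_lt (by omega) (by omega)]

/-- Once the leading coordinates `p` and `a` satisfy `a ≤ p`, each step at least halves their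
product. -/
theorem euclid_terminates {d : ℤ} {ds : List ℤ} {g : A} {gs : List A}
    (hb : IsCyclicBasis (d :: ds) (g :: gs)) {α : Type*} (l : List α) {s : List ℤ × List ℤ}
    (hs : EuclidOk d ds s)
    (h : s.2.headI ≤ s.1.headI ∧ s.1.headI * s.2.headI < 2 ^ l.length) :
    (l.foldl (fun s _ => euclidStep (d :: ds) s) s).2.headI = 0 := by
  induction l generalizing s with
  | nil =>
    obtain ⟨p, ps, a, v, rfl, h1, h2, h3, h4, h5, h6⟩ := hs
    simp only [List.headI_cons, List.length_nil, pow_zero, List.foldl_nil] at h ⊢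
    by_contra hne
    have : 0 < a := by omega
    have : 0 < p * a := mul_pos (by omega) this
    omega
  | cons x l ih =>
    refine ih (euclidStep_spec hb hs).1 ?_
    obtain ⟨p, ps, a, v, rfl, h1, h2, h3, h4, h5, h6⟩ := id hs
    simp only [List.headI_cons, List.length_cons] at h
    by_cases ha : a = 0
    · have e : euclidStep (d :: ds) (p :: ps, a :: v) = (p :: ps, a :: v) := by
        simp [euclidStep, ha]
      dsimp only
      rw [e]
      subst ha
      exact ⟨h3, by simp⟩
    · have e := euclidStep_heads ds p a ps v ha hs hb.1
      rw [Prod.mk.injEq] at e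
      dsimp only
      rw [e.1, e.2]
      have ha' : 0 < a := by omega
      have e1 := Int.emod_nonneg p ha
      have e2 := Int.emod_lt_of_pos p ha'
      have e3 : a + p % a ≤ p := by
        have := Int.emod_add_mul_ediv p a
        have : 1 ≤ p / a := by rw [Int.le_ediv_iff_mul_le ha']; omega
        nlinarith
      refine ⟨e2.le, ?_⟩
      have : 2 * (a * (p % a)) ≤ p * a := by nlinarith
      rw [pow_succ] at h
      omega

/-- The Euclidean algorithm preserves the span in the lifted group, and in the end the second vector
has leading coordinate zero. -/
theorem euclid_spec {d : ℤ} {ds : List ℤ} {g : A} {gs : List A}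
    (hb : IsCyclicBasis (d :: ds) (g :: gs)) {s : List ℤ × List ℤ} (hs : EuclidOk d ds s) :
    EuclidOk d ds (euclid (d :: ds) s) ∧
      pairSpan (g :: gs) (euclid (d :: ds) s) = pairSpan (g :: gs) s ∧
      (euclid (d :: ds) s).2.headI = 0 := by
  have key {α : Type} (l : List α) (s : List ℤ × List ℤ) (hs : EuclidOk d ds s) :
      EuclidOk d ds (l.foldl (fun s _ => euclidStep (d :: ds) s) s) ∧
      pairSpan (g :: gs) (l.foldl (fun s _ => euclidStep (d :: ds) s) s) =
        pairSpan (g :: gs) s := by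
    induction l generalizing s with
    | nil => exact ⟨hs, rfl⟩
    | cons x l ih =>
      have h1 := euclidStep_spec hb hs
      have h2 := ih _ h1.1
      exact ⟨h2.1, h2.2.trans h1.2⟩
  refine ⟨(key _ s hs).1, (key _ s hs).2, ?_⟩
  -- The first step establishes `a ≤ p`, the others halve a product that is at most `d * d`.
  have hlen : (bits (2 * (d * d))).length = (d * d).toNat.size + 1 := by
    have hdd : 0 < d * d := mul_pos hb.1 hb.1
    rw [length_bits, show (2 * (d * d)).toNat = 2 ^ 1 * (d * d).toNat by omega, mul_comm,
      ← Nat.shiftLeft_eq, Nat.size_shiftLeft (by omega)]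
  rw [euclid, List.headI_cons]
  obtain ⟨x, l, hl⟩ : ∃ x l, bits (2 * (d * d)) = x :: l :=
    List.exists_cons_of_length_pos (by omega)
  rw [hl]
  refine euclid_terminates hb l (euclidStep_spec hb hs).1 ?_
  have hl' : l.length = (d * d).toNat.size := by
    rw [hl, List.length_cons] at hlen; omega
  have hdd : d * d < 2 ^ l.length := by
    rw [hl']
    have h := Nat.lt_size_self (d * d).toNat
    have h2 := mul_pos hb.1 hb.1
    zify at h
    rwa [Int.toNat_of_nonneg h2.le] at h
  obtain ⟨p, ps, a, v, rfl, h1, h2, h3, h4, h5, h6⟩ := id hs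
  by_cases ha : a = 0
  · have e : euclidStep (d :: ds) (p :: ps, a :: v) = (p :: ps, a :: v) := by
      simp [euclidStep, ha]
    dsimp only
    rw [e]
    subst ha
    exact ⟨h3, by simp⟩
  · have e := euclidStep_heads ds p a ps v ha hs hb.1
    rw [Prod.mk.injEq] at e
    dsimp only
    rw [e.1, e.2]
    have e1 := Int.emod_nonneg p ha
    have e2 := Int.emod_lt_of_pos p (show 0 < a by omega)
    refine ⟨e2.le, lt_of_le_of_lt ?_ hdd⟩
    exact mul_le_mul h6 (by omega) e1 (by omega)

end LatticeSpec

section LatticeSpec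

variable {A : Type*} [AddCommGroup A]

theorem map_spanList {B : Type*} [AddCommGroup B] (f : A →+ B) (l : List A) :
    (spanList l).map f = spanList (l.map f) := by
  rw [spanList, AddMonoidHom.map_closure]
  congr 1
  ext x
  simp

theorem spanList_append (l l' : List A) : spanList (l ++ l') = spanList l ⊔ spanList l' := by
  rw [spanList, spanList, spanList, ← AddSubgroup.closure_union]
  congr 1
  ext x
  simp

theorem pairSpan_eq (gs : List A) (s : List ℤ × List ℤ) :
    pairSpan gs s =
      AddSubgroup.zmultiples (lift gs s.1) ⊔ AddSubgroup.zmultiples (lift gs s.2) := by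
  rw [pairSpan, spanList_cons, spanList_cons]
  simp [spanList]

theorem weaklyReduced_zeroVec {ds : List ℤ} {gs : List A} (hb : IsCyclicBasis ds gs) :
    WeaklyReduced ds (zeroVec ds) := (reducedMod_zeroVec hb).weaklyReduced

/-- The span in the lifted group is not changed by the elimination of a coordinate. The generator
`(d, 0)` is the lift of the vector with which `colStep` starts. -/
theorem colStep_lift {d : ℤ} {ds : List ℤ} {g : A} {gs : List A}
    (hb : IsCyclicBasis (d :: ds) (g :: gs)) {V : List (List ℤ)}
    (hV : ∀ v ∈ V, WeaklyReduced (d :: ds) v) :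
    WeaklyReduced (d :: ds) (colStep (d :: ds) V).1 ∧
      (∀ w ∈ (colStep (d :: ds) V).2, WeaklyReduced ds w) ∧
      spanList ((d, 0) :: V.map (lift (g :: gs))) =
        spanList (lift (g :: gs) (colStep (d :: ds) V).1 ::
          ((colStep (d :: ds) V).2.map (ev gs)).map (AddMonoidHom.inr ℤ A)) := by
  have key (V : List (List ℤ)) (hV : ∀ v ∈ V, WeaklyReduced (d :: ds) v)
      (s : List ℤ × List (List ℤ)) (hs : WeaklyReduced (d :: ds) s.1)
      (hs' : ∀ w ∈ s.2, WeaklyReduced ds w) :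
      let t := V.foldl (fun s v => ((euclid (d :: ds) (s.1, v)).1,
        (euclid (d :: ds) (s.1, v)).2.tail :: s.2)) s
      WeaklyReduced (d :: ds) t.1 ∧ (∀ w ∈ t.2, WeaklyReduced ds w) ∧
        spanList (lift (g :: gs) s.1 :: (s.2.map (ev gs)).map (AddMonoidHom.inr ℤ A)) ⊔
          spanList (V.map (lift (g :: gs))) =
        spanList (lift (g :: gs) t.1 :: (t.2.map (ev gs)).map (AddMonoidHom.inr ℤ A)) := by
    induction V generalizing s with
    | nil => exact ⟨hs, hs', by simp [spanList]⟩
    | cons v V ih =>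
      have hok : EuclidOk d ds (s.1, v) := by
        have hv := hV v List.mem_cons_self
        obtain ⟨P, W⟩ := s
        dsimp only at hs
        cases hs with | cons h1 h2 =>
        cases hv with | cons h3 h4 =>
        exact ⟨_, _, _, _, rfl, h2, h4, h1.1, h1.2, h3.1, h3.2⟩
      obtain ⟨⟨p, ps, a, v', he, h1, h2, h3, h4, h5, h6⟩, h7, h8⟩ := euclid_spec hb hok
      have h9 := ih (fun v hv => hV v (List.mem_cons_of_mem _ hv))
        ((euclid (d :: ds) (s.1, v)).1, (euclid (d :: ds) (s.1, v)).2.tail :: s.2)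
        (by rw [he]; exact .cons ⟨h3, h4⟩ h1)
        (fun w hw => by
          rcases List.mem_cons.1 hw with rfl | hw
          · rw [he]; exact h2
          · exact hs' _ hw)
      refine ⟨h9.1, h9.2.1, ?_⟩
      rw [List.foldl_cons, ← h9.2.2]
      have h10 : (AddMonoidHom.inr ℤ A) (ev gs (euclid (d :: ds) (s.1, v)).2.tail) =
          lift (g :: gs) (euclid (d :: ds) (s.1, v)).2 := by
        rw [he] at h8 ⊢
        simp only [List.headI_cons] at h8
        simp [lift, h8]
      rw [pairSpan_eq, pairSpan_eq] at h7
      simp only [List.map_cons, spanList_cons, h10]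
      dsimp only at h7
      rw [sup_assoc, sup_left_comm (spanList _), ← sup_assoc, ← h7]
      simp only [sup_assoc]
  obtain ⟨h1, h2, h3⟩ := key V hV ((d :: ds).headI :: zeroVec (d :: ds).tail, [])
    (.cons ⟨hb.1.le, le_rfl⟩ (weaklyReduced_zeroVec hb.2.2.2)) (by simp)
  refine ⟨h1, h2, Eq.trans ?_ h3⟩
  have e : lift (g :: gs) (d :: zeroVec ds) = (d, 0) := by
    simp [lift, hb.2.1]
  have e0 : spanList ([] : List (ℤ × A)) = ⊥ := by simp [spanList]
  simp only [List.headI_cons, List.tail_cons, e, List.map_nil]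
  rw [spanList_cons, spanList_cons, e0, sup_bot_eq]

/-- The recorded integer of an element of the lifted span is a first coordinate of this element. -/
theorem lift_sub_mem {d : ℤ} {g : A} {gs : List A} (hg : d • g = 0) {V : List (List ℤ)}
    {x : ℤ × A} (hx : x ∈ spanList ((d, 0) :: V.map (lift (g :: gs)))) :
    x.2 - x.1 • g ∈ spanList gs := by
  induction hx using AddSubgroup.closure_induction with
  | mem x hx =>
    rcases List.mem_cons.1 hx with rfl | hx
    · simp [hg]
    · obtain ⟨v, -, rfl⟩ := List.mem_map.1 hx
      cases v with
      | nil => simp [lift]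
      | cons a v => simpa [lift] using ev_mem_spanList gs v
  | zero => simp
  | add x y _ _ h1 h2 =>
    have := add_mem h1 h2
    rw [Prod.snd_add, Prod.fst_add, add_smul]
    convert this using 1
    abel
  | neg x _ h =>
    have := neg_mem h
    rw [Prod.snd_neg, Prod.fst_neg, neg_smul]
    convert this using 1
    abel

/-- After the elimination of the first coordinate, the pivot `p` divides the first coordinates of
all elements of the span, and the remaining vectors generate the subgroup of the elements with first
coordinate zero. -/
theorem colStep_spec {d : ℤ} {ds : List ℤ} {g : A} {gs : List A}
    (hb : IsCyclicBasis (d :: ds) (g :: gs)) {V : List (List ℤ)}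
    (hV : ∀ v ∈ V, WeaklyReduced (d :: ds) v) :
    ∃ p ps W, colStep (d :: ds) V = (p :: ps, W) ∧ 0 < p ∧ WeaklyReduced ds ps ∧
      (∀ w ∈ W, WeaklyReduced ds w) ∧
      spanList (V.map (ev (g :: gs))) = spanList (ev (g :: gs) (p :: ps) :: W.map (ev gs)) ∧
      (∀ a : ℤ, ∀ t ∈ spanList gs, a • g + t ∈ spanList (V.map (ev (g :: gs))) → p ∣ a) ∧
      spanList (W.map (ev gs)) = spanList (V.map (ev (g :: gs))) ⊓ spanList gs := by
  obtain ⟨h1, h2, h3⟩ := colStep_lift hb hV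
  obtain ⟨P, W, hPW⟩ : ∃ P W, colStep (d :: ds) V = (P, W) := ⟨_, _, rfl⟩
  rw [hPW] at h1 h2 h3
  dsimp only at h1 h2 h3
  cases h1 with | cons hp h1 =>
  rename_i p ps
  have hlift {x : ℤ × A} (hx : x ∈ spanList ((d, 0) :: V.map (lift (g :: gs)))) :
      ∃ c : ℤ, ∃ y ∈ spanList (W.map (ev gs)), x = (c * p, c • ev (g :: gs) (p :: ps) + y) := by
    rw [h3] at hx
    obtain ⟨c, z, hz, rfl⟩ := mem_spanList_cons.1 hx
    rw [← map_spanList] at hz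
    obtain ⟨y, hy, rfl⟩ := hz
    exact ⟨c, y, hy, by simp [lift]⟩
  have hspan : spanList (V.map (ev (g :: gs))) =
      spanList (ev (g :: gs) (p :: ps) :: W.map (ev gs)) := by
    have := congrArg (AddSubgroup.map (AddMonoidHom.snd ℤ A)) h3
    rw [map_spanList, map_spanList] at this
    simp only [List.map_cons, List.map_map] at this
    rw [spanList_cons] at this
    have e1 : (AddMonoidHom.snd ℤ A) (d, 0) = 0 := rfl
    have e2 : (AddMonoidHom.snd ℤ A) ∘ lift (g :: gs) = ev (g :: gs) := rfl
    have e3 : (AddMonoidHom.snd ℤ A) ∘ (AddMonoidHom.inr ℤ A) ∘ ev gs = ev gs := rfl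
    rw [e1, e2, AddSubgroup.zmultiples_zero_eq_bot, bot_sup_eq] at this
    exact this
  have hup {h : A} (hh : h ∈ spanList (V.map (ev (g :: gs)))) :
      ∃ a, (a, h) ∈ spanList ((d, 0) :: V.map (lift (g :: gs))) := by
    have e2 : (AddMonoidHom.snd ℤ A) ∘ lift (g :: gs) = ev (g :: gs) := rfl
    rw [← e2, ← List.map_map, ← map_spanList] at hh
    obtain ⟨⟨a, h'⟩, hx, rfl⟩ := hh
    exact ⟨a, spanList_le_cons _ _ hx⟩
  obtain ⟨α, y, hy, hd⟩ := hlift (mem_spanList (a := ((d, 0) : ℤ × A)) List.mem_cons_self)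
  rw [Prod.mk.injEq] at hd
  have hp0 : 0 < p := by
    rcases hp.1.lt_or_eq with h | h
    · exact h
    · rw [← h, mul_zero] at hd
      exact absurd hd.1 hb.1.ne'
  have hpd : p ∣ d := ⟨α, by rw [hd.1, mul_comm]⟩
  have hdvd (a : ℤ) (t : A) (ht : t ∈ spanList gs)
      (hat : a • g + t ∈ spanList (V.map (ev (g :: gs)))) {b : ℤ}
      (hb' : (b, a • g + t) ∈ spanList ((d, 0) :: V.map (lift (g :: gs)))) : d ∣ a - b := by
    have := lift_sub_mem hb.2.1 hb'
    dsimp only at this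
    refine hb.2.2.1 _ ?_
    have h := sub_mem this ht
    convert h using 1
    rw [sub_smul]
    abel
  refine ⟨p, ps, W, hPW, hp0, h1, h2, hspan, fun a t ht hat => ?_, le_antisymm ?_ ?_⟩
  · obtain ⟨b, hb'⟩ := hup hat
    obtain ⟨c, y', -, hc⟩ := hlift hb'
    rw [Prod.mk.injEq] at hc
    have h4 := hpd.trans (hdvd a t ht hat hb')
    have h5 : p ∣ b := ⟨c, by rw [hc.1, mul_comm]⟩
    exact (dvd_sub_left h5).1 h4
  · refine le_inf ?_ ?_
    · rw [hspan]; exact spanList_le_cons _ _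
    · rw [spanList, AddSubgroup.closure_le]
      intro x hx
      obtain ⟨w, -, rfl⟩ := List.mem_map.1 hx
      exact ev_mem_spanList _ _
  · rintro h ⟨hh, hg⟩
    obtain ⟨b, hb'⟩ := hup hh
    obtain ⟨c, y', hy', hc⟩ := hlift hb'
    rw [Prod.mk.injEq] at hc
    have h4 : d ∣ b := by
      have := hdvd 0 h hg (by simpa using hh) (b := b) (by simpa using hb')
      simpa using this
    obtain ⟨m, hm⟩ := h4
    have h5 : c = m * α := by
      have : c * p = m * α * p := by rw [← hc.1, hm, mul_assoc, ← hd.1, mul_comm]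
      exact mul_right_cancel₀ hp0.ne' this
    have h6 : α • ev (g :: gs) (p :: ps) ∈ spanList (W.map (ev gs)) := by
      rw [eq_neg_of_add_eq_zero_left hd.2.symm]
      exact neg_mem hy
    rw [hc.2, h5, mul_zsmul]
    exact add_mem (zsmul_mem h6 m) hy'

/-- Elimination of the first coordinates, as many as `cnt` has entries. The span of the remaining
vectors is the intersection of the original span with the span of the remaining generators; if the
vector `w` is congruent modulo the span to an element of the latter, it is reduced to such an
element. -/
theorem elim_spec {α : Type*} (cnt : List α) {ds : List ℤ} {gs : List A}
    (hb : IsCyclicBasis ds gs) {V : List (List ℤ)} (hV : ∀ v ∈ V, WeaklyReduced ds v)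
    {w : List ℤ} (hw : w.length = ds.length) (rows : List (List ℤ)) (hlen : cnt.length ≤ ds.length)
    {x : A} (hx : x ∈ spanList (gs.drop cnt.length))
    (hwx : ev gs w - x ∈ spanList (V.map (ev gs))) :
    ∃ V' w' rows', elim cnt (ds, V, w, rows) = (ds.drop cnt.length, V', w', rows') ∧
      IsCyclicBasis (ds.drop cnt.length) (gs.drop cnt.length) ∧
      (∀ v ∈ V', WeaklyReduced (ds.drop cnt.length) v) ∧
      w'.length = (ds.drop cnt.length).length ∧
      spanList (V'.map (ev (gs.drop cnt.length))) =
        spanList (V.map (ev gs)) ⊓ spanList (gs.drop cnt.length) ∧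
      ev gs w - ev (gs.drop cnt.length) w' ∈ spanList (V.map (ev gs)) := by
  induction cnt generalizing ds gs V w rows with
  | nil =>
    refine ⟨V, w, rows, rfl, hb, hV, hw, ?_, by simp⟩
    rw [List.length_nil, List.drop_zero, eq_comm, inf_eq_left, spanList, AddSubgroup.closure_le]
    intro x hx
    obtain ⟨v, -, rfl⟩ := List.mem_map.1 hx
    exact ev_mem_spanList _ _
  | cons c cnt ih =>
    cases ds with
    | nil => simp at hlen
    | cons d ds => cases gs with
      | nil => exact hb.elim
      | cons g gs => cases w with
        | nil => simp at hw
        | cons a w =>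
          obtain ⟨p, ps, W, hc, hp0, hps, hW, h1, h2, h3⟩ := colStep_spec hb hV
          have hw' : w.length = ds.length := by simpa using hw
          simp only [List.length_cons, List.drop_succ_cons] at hx hlen ⊢
          have hsub : spanList (gs.drop cnt.length) ≤ spanList gs :=
            AddSubgroup.closure_mono fun y hy => List.mem_of_mem_drop hy
          have hpa : p ∣ a := by
            refine h2 a (ev gs w - x) (sub_mem (ev_mem_spanList _ _) (hsub hx)) ?_
            rwa [← add_sub_assoc]
          have hstep : elimStep ((d :: ds), V, a :: w, rows) =
              (ds, W, subSmul ds (a / p) w ps, (p :: ps) :: rows) := by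
            rw [elimStep, hc]
            simp [subSmul_cons]
          have he1 := ev_subSmul hb.2.2.2 (a / p) hw' hps.length_eq
          have he2 : ev gs (subSmul ds (a / p) w ps) =
              ev (g :: gs) (a :: w) - (a / p) • ev (g :: gs) (p :: ps) := by
            rw [he1, ev_cons, ev_cons, smul_add, ← mul_zsmul, Int.ediv_mul_cancel hpa]
            abel
          have hP : ev (g :: gs) (p :: ps) ∈ spanList (V.map (ev (g :: gs))) := by
            rw [h1]; exact mem_spanList List.mem_cons_self
          have hwx' : ev gs (subSmul ds (a / p) w ps) - x ∈ spanList (W.map (ev gs)) := by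
            rw [h3]
            refine AddSubgroup.mem_inf.2 ⟨?_, sub_mem (ev_mem_spanList _ _) (hsub hx)⟩
            rw [he2, sub_right_comm]
            exact sub_mem hwx (zsmul_mem hP _)
          obtain ⟨V', w', rows', e1, e2, e3, e5, e6, e7⟩ := ih hb.2.2.2 hW
            (length_subSmul (a / p) hw' hps.length_eq) ((p :: ps) :: rows) (by omega) hx hwx'
          refine ⟨V', w', rows', ?_, e2, e3, e5, ?_, ?_⟩
          · rw [← e1, elim, List.foldl_cons, hstep]
            rfl
          · rw [e6, h3, inf_assoc, inf_eq_right.2 hsub]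
          · have hWV : spanList (W.map (ev gs)) ≤ spanList (V.map (ev (g :: gs))) := by
              rw [h3]; exact inf_le_left
            have := add_mem (hWV e7) (zsmul_mem hP (a / p))
            rw [he2] at this
            convert this using 1
            abel

theorem padRows_append_singleton (rows : List (List ℤ)) (P : List ℤ) :
    padRows (rows ++ [P]) = P :: (padRows rows).map fun v => 0 :: v := by
  simp [padRows]

/-- The rows of the triangular list span the same group as the original vectors. -/
theorem basisRows_spec {ds : List ℤ} {gs : List A} (hb : IsCyclicBasis ds gs) {V : List (List ℤ)}
    (hV : ∀ v ∈ V, WeaklyReduced ds v) :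
    (∀ v ∈ basisRows ds V, WeaklyReduced ds v) ∧
      spanList ((basisRows ds V).map (ev gs)) = spanList (V.map (ev gs)) := by
  have key {ds : List ℤ} {gs : List A} (hb : IsCyclicBasis ds gs) {V : List (List ℤ)}
      (hV : ∀ v ∈ V, WeaklyReduced ds v) (w : List ℤ) (rows : List (List ℤ)) :
      ∃ R, (elim ds (ds, V, w, rows)).2.2.2 = R ++ rows ∧
        (∀ v ∈ padRows R, WeaklyReduced ds v) ∧
        spanList ((padRows R).map (ev gs)) = spanList (V.map (ev gs)) := by
    induction ds generalizing gs V w rows with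
    | nil =>
      cases gs with
      | cons g gs => exact hb.elim
      | nil =>
        refine ⟨[], rfl, by simp [padRows], ?_⟩
        refine le_antisymm ?_ ?_ <;> rw [spanList, AddSubgroup.closure_le] <;> intro x hx
        · simp [padRows] at hx
        · obtain ⟨v, -, rfl⟩ := List.mem_map.1 hx
          simp
    | cons d ds ih =>
      cases gs with
      | nil => exact hb.elim
      | cons g gs =>
        obtain ⟨p, ps, W, hc, hp0, hps, hW, h1, h2, h3⟩ := colStep_spec hb hV
        obtain ⟨R, e1, e2, e3⟩ := ih hb.2.2.2 hW (elimStep (d :: ds, V, w, rows)).2.2.1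
          ((p :: ps) :: rows)
        refine ⟨R ++ [p :: ps], ?_, ?_, ?_⟩
        · rw [List.append_assoc, List.singleton_append, ← e1]
          have : elimStep (d :: ds, V, w, rows) =
              (ds, W, (elimStep (d :: ds, V, w, rows)).2.2.1, (p :: ps) :: rows) := by
            simp only [elimStep, hc, List.tail_cons]
          conv_lhs => rw [elim, List.foldl_cons, this]
          rfl
        · rw [padRows_append_singleton]
          intro v hv
          rcases List.mem_cons.1 hv with rfl | hv
          · have := (colStep_lift hb hV).1
            rwa [hc] at this
          · obtain ⟨u, hu, rfl⟩ := List.mem_map.1 hv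
            exact .cons ⟨le_rfl, hb.1.le⟩ (e2 u hu)
        · rw [padRows_append_singleton, List.map_cons, List.map_map, h1, spanList_cons,
            spanList_cons, ← e3]
          congr 3
          funext v
          simp
  obtain ⟨R, e1, e2, e3⟩ := key hb hV (zeroVec ds) []
  rw [basisRows, e1, List.append_nil]
  exact ⟨e2, e3⟩

end LatticeSpec

/-! ### Arithmetic in the ring -/

section RingSpec

variable {R : Type*} [Ring R]

/-- The moduli `ds` and the multiplication table `T` describe the ring `R` with respect to the
generators `gs` of its additive group. -/
structure IsRingCode (ds : List ℤ) (T : List (List (List ℤ))) (gs : List R) : Prop where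
  basis : IsCyclicBasis ds gs
  span : ∀ x : R, x ∈ spanList gs
  weaklyReduced : ∀ row ∈ T, ∀ v ∈ row, WeaklyReduced ds v
  table : (T.map fun row => row.map (ev gs)) = gs.map fun g => gs.map fun h => g * h

theorem IsRingCode.mulVec_spec {ds : List ℤ} {T : List (List (List ℤ))} {gs : List R}
    (h : IsRingCode ds T gs) (x y : List ℤ) :
    ReducedMod ds (mulVec ds T x y) ∧ ev gs (mulVec ds T x y) = ev gs x * ev gs y := by
  have hrow (row : List (List ℤ)) (hr : row ∈ T) :=
    linComb_spec h.basis y fun v hv => (h.weaklyReduced row hr v hv).length_eq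
  have hlen : ∀ v ∈ T.map fun row => linComb ds y row, v.length = ds.length := by
    intro v hv
    obtain ⟨row, hr, rfl⟩ := List.mem_map.1 hv
    exact (hrow row hr).1
  refine ⟨reducedMod_linComb h.basis _ hlen, ?_⟩
  rw [mulVec, (linComb_spec h.basis x hlen).2, List.map_map]
  have e1 : T.map (ev gs ∘ fun row => linComb ds y row) =
      (T.map fun row => row.map (ev gs)).map fun l => ev l y := by
    rw [List.map_map]
    exact List.map_congr_left fun row hr => (hrow row hr).2
  rw [e1, h.table, List.map_map]
  have e2 : (fun l => ev l y) ∘ (fun g => gs.map fun h => g * h) =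
      fun g => AddMonoidHom.mulRight (ev gs y) g := by
    funext g
    exact ev_map (AddMonoidHom.mulLeft g) gs y
  rw [e2]
  exact ev_map (AddMonoidHom.mulRight (ev gs y)) gs x

/-! ### The unit -/

/-- The sequence with the entries of the list from position `k` on, and zeros elsewhere. -/
def place (k : ℕ) : List R → ℕ → R
  | [] => 0
  | w :: ws => Pi.single k w + place (k + 1) ws

theorem place_apply_of_lt {k j : ℕ} (ws : List R) (h : j < k) : place k ws j = 0 := by
  induction ws generalizing k with
  | nil => rfl
  | cons w ws ih =>
    rw [place, Pi.add_apply, ih (by omega), Pi.single_eq_of_ne (by omega), add_zero]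

theorem place_apply_of_le {k j : ℕ} (ws : List R) (h : k + ws.length ≤ j) : place k ws j = 0 := by
  induction ws generalizing k with
  | nil => rfl
  | cons w ws ih =>
    rw [List.length_cons] at h
    rw [place, Pi.add_apply, ih (by omega), Pi.single_eq_of_ne (by omega), add_zero]

theorem place_injective {k : ℕ} {ws ws' : List R} (hl : ws.length = ws'.length)
    (h : ∀ j < k + ws.length, place k ws j = place k ws' j) : ws = ws' := by
  induction ws generalizing k ws' with
  | nil => cases ws' with
    | nil => rfl
    | cons _ _ => simp at hl
  | cons w ws ih => cases ws' with
    | nil => simp at hl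
    | cons w' ws' =>
      have h0 := h k (by simp)
      simp only [place, Pi.add_apply, Pi.single_eq_same, place_apply_of_lt _ (Nat.lt_succ_self k),
        add_zero] at h0
      subst h0
      rw [ih (k := k + 1) (by simpa using hl) fun j hj => ?_]
      have := h j (by rw [List.length_cons]; omega)
      simpa [place] using this

theorem place_add {k : ℕ} (gs : List R) (x y : R) :
    place k (gs.map fun g => (x + y) * g) =
      place k (gs.map fun g => x * g) + place k (gs.map fun g => y * g) := by
  induction gs generalizing k with
  | nil => simp [place]
  | cons g gs ih =>
    rw [List.map_cons, List.map_cons, List.map_cons, place, place, place, ih, add_mul,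
      Pi.single_add]
    abel

/-- The generators of the direct sum of copies of `R` that are indexed by `k`, `k + 1`, …; there are
as many copies as `l` has entries. -/
def blockGens {α : Type*} (gs : List R) : ℕ → List α → List (ℕ → R)
  | _, [] => []
  | k, _ :: l => gs.map (AddMonoidHom.single (fun _ : ℕ => R) k) ++ blockGens gs (k + 1) l

theorem spanList_blockGens {α : Type*} (gs : List R) (k : ℕ) (l : List α) {f : ℕ → R}
    (hf : f ∈ spanList (blockGens gs k l)) : ∀ j, j < k ∨ k + l.length ≤ j → f j = 0 := by
  induction l generalizing k f with
  | nil =>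
    have : f = 0 := by simpa [blockGens, spanList] using hf
    simp [this]
  | cons a l ih =>
    rw [blockGens, spanList_append, ← map_spanList] at hf
    obtain ⟨-, ⟨x, -, rfl⟩, y, hy, rfl⟩ := AddSubgroup.mem_sup.1 hf
    intro j hj
    rw [List.length_cons] at hj
    rw [Pi.add_apply, ih (k + 1) hy j (by omega), add_zero]
    exact Pi.single_eq_of_ne (by omega) _

theorem isCyclicBasis_blockGens {α : Type*} {ds : List ℤ} {gs : List R}
    (hb : IsCyclicBasis ds gs) (k : ℕ) (l : List α) :
    IsCyclicBasis (l.flatMap fun _ => ds) (blockGens gs k l) := by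
  induction l generalizing k with
  | nil => trivial
  | cons a l ih =>
    rw [List.flatMap_cons, blockGens]
    refine (hb.map _ (Pi.single_injective (M := fun _ : ℕ => R) k)).append (ih (k + 1)) ?_
    rw [AddSubgroup.disjoint_def]
    intro f hf hf'
    rw [← map_spanList] at hf
    obtain ⟨x, -, rfl⟩ := hf
    have := spanList_blockGens gs (k + 1) l hf' k (by omega)
    rw [AddMonoidHom.single_apply, Pi.single_eq_same] at this
    simp [this]

theorem ev_blockGens {α : Type*} (gs : List R) (k : ℕ) (l : List α) (vs : List (List ℤ))
    (hl : vs.length = l.length) (hvs : ∀ v ∈ vs, v.length = gs.length) :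
    ev (blockGens gs k l) vs.flatten = place k (vs.map (ev gs)) ∧
      vs.flatten.length = (blockGens gs k l).length := by
  induction vs generalizing l k with
  | nil => cases l with
    | nil => simp [place, blockGens]
    | cons _ _ => simp at hl
  | cons v vs ih => cases l with
    | nil => simp at hl
    | cons a l =>
      have hv := hvs v List.mem_cons_self
      obtain ⟨h1, h2⟩ := ih (k + 1) l (by simpa using hl)
        fun v hv => hvs v (List.mem_cons_of_mem _ hv)
      rw [blockGens, List.flatten_cons, ev_append _ _ _ _ (by simpa using hv), h1, ev_map]
      exact ⟨rfl, by simp [hv, h2]⟩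

theorem length_indexFrom {α : Type*} (k : ℤ) (l : List α) : (indexFrom k l).length = l.length := by
  induction l generalizing k with
  | nil => rfl
  | cons a l ih => simp [indexFrom, ih]

theorem getElem_indexFrom {α : Type*} (k : ℤ) (l : List α) (i : ℕ)
    (hi : i < (indexFrom k l).length) :
    (indexFrom k l)[i] = (k + i, l[i]'(by rwa [length_indexFrom] at hi)) := by
  induction l generalizing k i with
  | nil => simp [indexFrom] at hi
  | cons a l ih => cases i with
    | zero => simp [indexFrom]
    | succ i =>
      simp only [indexFrom, List.getElem_cons_succ, ih]
      push_cast
      rw [add_assoc, add_comm 1 (i : ℤ)]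

theorem ev_identityRow {ds : List ℤ} {gs : List R} (hb : IsCyclicBasis ds gs) (k : ℤ) (i : ℕ)
    (hi : i < gs.length) :
    ev gs ((indexFrom k ds).map fun t => if t.1 = k + i then 1 % t.2 else 0) = gs[i] := by
  have hzero (ds : List ℤ) (gs : List R) (k j : ℤ) (hj : j < k) :
      ev gs ((indexFrom k ds).map fun t => if t.1 = j then 1 % t.2 else 0) = 0 := by
    induction ds generalizing k gs with
    | nil => simp [indexFrom]
    | cons d ds ih => cases gs with
      | nil => simp
      | cons g gs => simp [indexFrom, ih gs (k + 1) (by omega), show k ≠ j by omega]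
  induction ds generalizing gs k i with
  | nil => cases gs with
    | nil => simp at hi
    | cons g gs => exact hb.elim
  | cons d ds ih => cases gs with
    | nil => exact hb.elim
    | cons g gs => cases i with
      | zero =>
        simp only [indexFrom, List.map_cons, ev_cons, Nat.cast_zero, add_zero]
        rw [hzero _ _ _ _ (by omega), if_pos trivial, emod_zsmul hb.2.1, one_smul, add_zero]
        rfl
      | succ i =>
        have := ih hb.2.2.2 (k + 1) i (by simpa using hi)
        rw [show k + 1 + (i : ℤ) = k + (i + 1 : ℕ) by push_cast; ring] at this
        simp only [indexFrom, List.map_cons, ev_cons]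
        rw [this, if_neg (by push_cast; omega)]
        simp

theorem weaklyReduced_identityRow {ds : List ℤ} {gs : List R} (hb : IsCyclicBasis ds gs)
    (k j : ℤ) :
    WeaklyReduced ds ((indexFrom k ds).map fun t => if t.1 = j then 1 % t.2 else 0) := by
  induction ds generalizing gs k with
  | nil => simp [indexFrom, WeaklyReduced]
  | cons d ds ih => cases gs with
    | nil => exact hb.elim
    | cons g gs =>
      refine .cons ?_ (ih hb.2.2.2 (k + 1))
      dsimp only
      have := Int.emod_nonneg 1 hb.1.ne'
      have := Int.emod_lt_of_pos 1 hb.1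
      have := hb.1
      split_ifs <;> omega

theorem identityRows_spec {ds : List ℤ} {gs : List R} (hb : IsCyclicBasis ds gs) :
    (identityRows ds).map (ev gs) = gs ∧ ∀ v ∈ identityRows ds, WeaklyReduced ds v := by
  refine ⟨?_, fun v hv => ?_⟩
  · refine List.ext_getElem (by simp [identityRows, length_indexFrom, hb.length_eq])
      fun i hi1 hi2 => ?_
    simp only [identityRows, List.map_map, List.getElem_map, Function.comp_apply,
      getElem_indexFrom]
    exact ev_identityRow hb 0 i hi2
  · obtain ⟨p, -, rfl⟩ := List.mem_map.1 hv
    exact weaklyReduced_identityRow hb _ _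

theorem WeaklyReduced.append {ds ds' v v' : List ℤ} (h : WeaklyReduced ds v)
    (h' : WeaklyReduced ds' v') : WeaklyReduced (ds ++ ds') (v ++ v') :=
  List.rel_append h h'

theorem WeaklyReduced.flatten {α : Type*} {ds : List ℤ} {vs : List (List ℤ)} (l : List α)
    (hl : vs.length = l.length) (h : ∀ v ∈ vs, WeaklyReduced ds v) :
    WeaklyReduced (l.flatMap fun _ => ds) vs.flatten := by
  induction vs generalizing l with
  | nil => cases l with
    | nil => exact .nil
    | cons _ _ => simp at hl
  | cons v vs ih => cases l with
    | nil => simp at hl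
    | cons a l =>
      rw [List.flatMap_cons, List.flatten_cons]
      exact (h v List.mem_cons_self).append
        (ih l (by simpa using hl) fun v hv => h v (List.mem_cons_of_mem _ hv))

/-- The map `x ↦ (x g₁, …, x gₙ, x)`, with values in the sequences in `R`. -/
def actionHom (gs : List R) : R →+ (ℕ → R) :=
  AddMonoidHom.mk' (fun x => place 0 (gs.map fun g => x * g) + Pi.single gs.length x) fun x y => by
    rw [place_add, Pi.single_add]
    abel

/-- The span of the vectors to which the elimination is applied is the graph of `x ↦ (x gᵢ)ᵢ`. It
contains `((gᵢ)ᵢ, 1)`, whence `((gᵢ)ᵢ, 0)` can be reduced to an element `(0, y)`. Then `(gᵢ)ᵢ` is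
the value of the map at `x = -y`, so that `x` is a left unit and thus equal to `1`. -/
theorem IsRingCode.findUnit_spec {ds : List ℤ} {T : List (List (List ℤ))} {gs : List R}
    (h : IsRingCode ds T gs) : ReducedMod ds (findUnit ds T) ∧ ev gs (findUnit ds T) = 1 := by
  obtain ⟨hid, hid'⟩ := identityRows_spec h.basis
  have hlenid : (identityRows ds).length = ds.length := by
    have := congrArg List.length hid
    simpa [h.basis.length_eq] using this
  have hn := h.basis.length_eq
  set es := ds.flatMap fun _ => ds with hes
  set hs := gs.map (AddMonoidHom.single (fun _ : ℕ => R) gs.length) with hhs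
  have hb1 := isCyclicBasis_blockGens h.basis 0 ds
  have hb : IsCyclicBasis (es ++ ds) (blockGens gs 0 ds ++ hs) := by
    refine hb1.append (h.basis.map _ (Pi.single_injective (M := fun _ : ℕ => R) _)) ?_
    rw [AddSubgroup.disjoint_def]
    intro f hf hf'
    rw [← map_spanList] at hf'
    obtain ⟨x, -, rfl⟩ := hf'
    have := spanList_blockGens gs 0 ds hf gs.length (by omega)
    rw [AddMonoidHom.single_apply, Pi.single_eq_same] at this
    simp [this]
  have hdrop1 : (es ++ ds).drop es.length = ds := List.drop_left
  have hdrop2 : (blockGens gs 0 ds ++ hs).drop es.length = hs := by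
    rw [hb1.length_eq]; exact List.drop_left
  set V := (T.zip (identityRows ds)).map fun t => t.1.flatten ++ t.2 with hVdef
  set w := (identityRows ds).flatten ++ zeroVec ds with hwdef
  have hTlen : T.length = gs.length := by simpa using congrArg List.length h.table
  have hrowlen (row : List (List ℤ)) (hr : row ∈ T) : row.length = ds.length := by
    have h1 : row.map (ev gs) ∈ gs.map fun g => gs.map fun h => g * h := by
      rw [← h.table]; exact List.mem_map_of_mem hr
    obtain ⟨g, -, hg⟩ := List.mem_map.1 h1
    simpa [hn] using (congrArg List.length hg).symm
  have hV : ∀ v ∈ V, WeaklyReduced (es ++ ds) v := by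
    intro v hv
    obtain ⟨t, ht, rfl⟩ := List.mem_map.1 hv
    have ht' := List.of_mem_zip ht
    exact (WeaklyReduced.flatten ds (hrowlen _ ht'.1) (h.weaklyReduced _ ht'.1)).append
      (hid' _ ht'.2)
  have hVev : V.map (ev (blockGens gs 0 ds ++ hs)) = gs.map (actionHom gs) := by
    have hz : ∀ (T : List (List (List ℤ))) (I : List (List ℤ)) (gs' : List R),
        (∀ row ∈ T, row.length = ds.length ∧ ∀ v ∈ row, WeaklyReduced ds v) →
        (T.map fun row => row.map (ev gs)) = gs'.map (fun g => gs.map fun h => g * h) →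
        I.map (ev gs) = gs' →
        ((T.zip I).map fun t => t.1.flatten ++ t.2).map (ev (blockGens gs 0 ds ++ hs)) =
          gs'.map (actionHom gs) := by
      intro T I gs' hT1 hT2 hI
      subst hI
      induction T generalizing I with
      | nil => cases I with
        | nil => rfl
        | cons _ _ => simp at hT2
      | cons row T ih => cases I with
        | nil => simp at hT2
        | cons v I =>
          simp only [List.map_cons, List.cons.injEq] at hT2
          obtain ⟨hr1, hr2⟩ := hT1 row List.mem_cons_self
          have hr3 := ev_blockGens gs 0 ds row hr1 fun v hv => (hr2 v hv).length_eq.trans hn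
          simp only [List.zip_cons_cons, List.map_cons]
          rw [ih I (fun row hr => hT1 row (List.mem_cons_of_mem _ hr)) hT2.2,
            ev_append _ _ _ _ hr3.2, hr3.1, hT2.1, hhs, ev_map]
          rfl
    exact hz T _ gs (fun row hr => ⟨hrowlen row hr, h.weaklyReduced row hr⟩) h.table hid
  have hspan : spanList (V.map (ev (blockGens gs 0 ds ++ hs))) = (⊤ : AddSubgroup R).map
      (actionHom gs) := by
    rw [hVev, ← map_spanList]
    congr 1
    exact eq_top_iff.2 fun x _ => h.span x
  have hw1 := ev_blockGens gs 0 ds (identityRows ds) hlenid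
    fun v hv => (hid' v hv).length_eq.trans hn
  have hwev : ev (blockGens gs 0 ds ++ hs) w = place 0 gs := by
    rw [hwdef, ev_append _ _ _ _ hw1.2, hw1.1, hid, ev_zeroVec, add_zero]
  have hwlen : w.length = (es ++ ds).length := by
    rw [hwdef, List.length_append, List.length_append, hw1.2, length_zeroVec, hes, hb1.length_eq]
  have hone : place 0 gs + Pi.single gs.length 1 = actionHom gs 1 := by
    simp [actionHom]
  obtain ⟨V', w', rows', e1, e2, e3, e4, e5, e6⟩ := elim_spec es hb hV hwlen [] (by simp)
    (x := AddMonoidHom.single (fun _ : ℕ => R) gs.length (-1)) (by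
      rw [hdrop2, hhs, ← map_spanList]
      exact ⟨-1, h.span _, rfl⟩) (by
      rw [hspan, hwev]
      refine ⟨1, trivial, ?_⟩
      rw [← hone, map_neg, sub_neg_eq_add]
      rfl)
  rw [hdrop1] at e4
  have hfu : findUnit ds T = subSmul ds 1 (zeroVec ds) w' := by
    rw [findUnit, e1]
  rw [hfu]
  refine ⟨reducedMod_subSmul h.basis _ (length_zeroVec _) e4, ?_⟩
  rw [ev_subSmul h.basis _ (length_zeroVec _) e4, ev_zeroVec, one_smul, zero_sub]
  rw [hspan, hdrop2, hwev, hhs, ev_map] at e6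
  obtain ⟨x, -, hx⟩ := e6
  set y := ev gs w'
  have hx' (j : ℕ) : place 0 (gs.map fun g => x * g) j + (Pi.single gs.length x : ℕ → R) j =
      place 0 gs j - (Pi.single gs.length y : ℕ → R) j := congrFun hx j
  have hxy : x = -y := by
    have := hx' gs.length
    rwa [place_apply_of_le _ (by simp), place_apply_of_le _ (by simp), Pi.single_eq_same,
      Pi.single_eq_same, zero_add, zero_sub] at this
  have hxg : (gs.map fun g => x * g) = gs := by
    refine place_injective (k := 0) (by simp) fun j hj => ?_
    have := hx' j
    rw [zero_add, List.length_map] at hj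
    rwa [Pi.single_eq_of_ne hj.ne, Pi.single_eq_of_ne hj.ne, add_zero, sub_zero] at this
  rw [← hxy, ← mul_one x]
  -- The element `x` fixes the generators from the left, hence all elements.
  have hall (z : R) : x * z = z := by
    have hz := h.span z
    induction hz using AddSubgroup.closure_induction with
    | mem g hg =>
      obtain ⟨i, hi, rfl⟩ := List.getElem_of_mem hg
      have := List.getElem_of_eq hxg (i := i) (by simpa using hi)
      simpa using this
    | zero => simp
    | add a b _ _ h1 h2 => rw [mul_add, h1, h2]
    | neg a _ h1 => rw [mul_neg, h1]
  exact hall 1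

/-! ### Powers of units -/

/-- Repeated squaring. -/
theorem foldl_bits {M : Type*} [Monoid M] (u : M) (e : ℤ) :
    (bits e).foldl (fun acc b => if b = 0 then acc * acc else acc * acc * u) 1 = u ^ e.toNat := by
  have key (l : List ℕ) (hl : ∀ d ∈ l, d < 2) :
      ((l.map fun d : ℕ => (d : ℤ)).reverse).foldl
        (fun acc b => if b = 0 then acc * acc else acc * acc * u) 1 = u ^ Nat.ofDigits 2 l := by
    induction l with
    | nil => simp
    | cons d l ih =>
      rw [List.map_cons, List.reverse_cons, List.foldl_append, ih fun d hd =>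
        hl d (List.mem_cons_of_mem _ hd), Nat.ofDigits_cons]
      have := hl d List.mem_cons_self
      simp only [List.foldl_cons, List.foldl_nil]
      interval_cases d
      · simp [← pow_add, two_mul]
      · simp only [Nat.cast_one, one_ne_zero, if_false]
        rw [← pow_add, ← pow_succ]
        congr 1
        ring
  rw [bits, key _ fun d hd => Nat.digits_lt_base one_lt_two hd, Nat.ofDigits_digits]

theorem IsRingCode.powVec_spec {ds : List ℤ} {T : List (List (List ℤ))} {gs : List R}
    (h : IsRingCode ds T gs) {D : ℤ} (hD : 0 < D) {one u : List ℤ} (hone : ReducedMod ds one)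
    (hone' : ev gs one = 1) {U : Rˣ} (hu : ev gs u = U) (hU : U ^ D = 1) (e : ℤ) :
    ReducedMod ds (powVec ds T D one u e) ∧ ev gs (powVec ds T D one u e) = ((U ^ e : Rˣ) : R) := by
  have key (l : List ℤ) (acc : List ℤ) (hacc : ReducedMod ds acc) :
      let r := l.foldl (fun acc b => if b = 0 then mulVec ds T acc acc else
        mulVec ds T (mulVec ds T acc acc) u) acc
      ReducedMod ds r ∧ ev gs r =
        l.foldl (fun acc b => if b = 0 then acc * acc else acc * acc * (U : R)) (ev gs acc) := by
    induction l generalizing acc with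
    | nil => exact ⟨hacc, rfl⟩
    | cons b l ih =>
      simp only [List.foldl_cons]
      split_ifs
      · have := ih _ (h.mulVec_spec acc acc).1
        rwa [(h.mulVec_spec acc acc).2] at this
      · have := ih _ (h.mulVec_spec (mulVec ds T acc acc) u).1
        rwa [(h.mulVec_spec _ u).2, (h.mulVec_spec acc acc).2, hu] at this
  obtain ⟨h1, h2⟩ := key (bits (e % D)) one hone
  refine ⟨h1, h2.trans ?_⟩
  rw [hone', foldl_bits, ← Units.val_pow_eq_pow_val]
  congr 1
  rw [← zpow_natCast, Int.toNat_of_nonneg (Int.emod_nonneg _ hD.ne'), Int.emod_def, zpow_sub,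
    zpow_mul, hU, one_zpow, inv_one, mul_one]

end RingSpec

section RingSpec

variable {R : Type*} [Ring R]

/-! ### The powers of the ideal -/

/-- The additive subgroups `I, I², I³, …`; the one with index `j` is `I ^ (j + 1)`. -/
def idealPower (I : Ideal R) : ℕ → AddSubgroup R
  | 0 => I.toAddSubgroup
  | j + 1 => AddSubgroup.closure {x | ∃ a ∈ I, ∃ b ∈ idealPower I j, x = a * b}

variable {I : Ideal R}

theorem mul_mem_idealPower {a b : R} (ha : a ∈ I) {j : ℕ} (hb : b ∈ idealPower I j) :
    a * b ∈ idealPower I (j + 1) :=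
  AddSubgroup.subset_closure ⟨a, ha, b, hb, rfl⟩

/-- The entries of the list lie in `I`, and the subgroup generated by `Q` and a suffix of the list
is mapped by multiplication with elements of `I` into the subgroup generated by `Q` and the next
shorter suffix. -/
def IsCentralChain (I : Ideal R) (Q : AddSubgroup R) : List R → Prop
  | [] => True
  | b :: bs => b ∈ I ∧ (∀ a ∈ I, a * b ∈ spanList bs ⊔ Q ∧ b * a ∈ spanList bs ⊔ Q) ∧
    IsCentralChain I Q bs

theorem IsCentralChain.append {Q Q' : AddSubgroup R} {l l' : List R} (h : IsCentralChain I Q l)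
    (hQ : Q ≤ spanList l' ⊔ Q') (h' : IsCentralChain I Q' l') : IsCentralChain I Q' (l ++ l') := by
  induction l with
  | nil => exact h'
  | cons b l ih =>
    have hle : spanList l ⊔ Q ≤ spanList (l ++ l') ⊔ Q' := by
      rw [spanList_append, sup_assoc]
      exact sup_le_sup_left hQ _
    exact ⟨h.1, fun a ha => ⟨hle (h.2.1 a ha).1, hle (h.2.1 a ha).2⟩, ih h.2.2⟩

theorem mul_mem_idealPower' {a b : R} (ha : a ∈ I) {j : ℕ} (hb : b ∈ idealPower I j) :
    b * a ∈ idealPower I (j + 1) := by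
  induction j generalizing b with
  | zero => exact mul_mem_idealPower (j := 0) hb ha
  | succ j ih =>
    induction hb using AddSubgroup.closure_induction with
    | mem x hx =>
      obtain ⟨c, hc, d, hd, rfl⟩ := hx
      rw [mul_assoc]
      exact mul_mem_idealPower hc (ih hd)
    | zero => rw [zero_mul]; exact zero_mem _
    | add x y _ _ h1 h2 => rw [add_mul]; exact add_mem h1 h2
    | neg x _ h1 => rw [neg_mul]; exact neg_mem h1

theorem idealPower_succ_le (j : ℕ) : idealPower I (j + 1) ≤ idealPower I j := by
  induction j with
  | zero =>
    refine (AddSubgroup.closure_le _).2 ?_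
    rintro x ⟨a, ha, b, hb, rfl⟩
    exact I.mul_mem_left a hb
  | succ j ih =>
    refine (AddSubgroup.closure_le _).2 ?_
    rintro x ⟨a, ha, b, hb, rfl⟩
    exact mul_mem_idealPower ha (ih hb)

theorem idealPower_le (j : ℕ) : idealPower I j ≤ I.toAddSubgroup := by
  induction j with
  | zero => exact le_rfl
  | succ j ih => exact (idealPower_succ_le j).trans ih

theorem idealPower_le_pow [I.IsTwoSided] (j : ℕ) :
    idealPower I j ≤ (I ^ (j + 1)).toAddSubgroup := by
  induction j with
  | zero =>
    rw [zero_add, show I ^ 1 = I from Submodule.pow_one _]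
    exact le_rfl
  | succ j ih =>
    refine (AddSubgroup.closure_le _).2 ?_
    rintro x ⟨a, ha, b, hb, rfl⟩
    have := Ideal.mul_mem_mul ha (ih hb)
    rw [← Ideal.IsTwoSided.pow_succ] at this
    exact this

/-- The powers of a nilpotent ideal decrease strictly until they vanish, whence the power with
exponent `1 + log₂ |R|` vanishes. -/
theorem idealPower_eq_bot [I.IsTwoSided] [Finite R] (hI : IsNilpotent I) {j : ℕ}
    (hj : Nat.card R < 2 ^ j) :
    idealPower I j = ⊥ := by
  have hconst (j : ℕ) (h : idealPower I (j + 1) = idealPower I j) : idealPower I j = ⊥ := by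
    have hall (i : ℕ) : idealPower I (j + i) = idealPower I j := by
      induction i with
      | zero => rfl
      | succ i ih =>
        rw [← add_assoc]
        conv_rhs => rw [← h]
        rw [idealPower, idealPower, ih]
    obtain ⟨k, hk⟩ := hI
    rw [eq_bot_iff, ← hall k]
    intro x hx
    have h1 := idealPower_le_pow _ hx
    have h2 : I ^ (j + k + 1) ≤ I ^ k := Ideal.pow_le_pow_right (by omega)
    have h3 : x ∈ I ^ k := h2 h1
    rw [hk] at h3
    exact h3
  have key (j : ℕ) : idealPower I j = ⊥ ∨ Nat.card (idealPower I j) * 2 ^ j ≤ Nat.card R := by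
    induction j with
    | zero =>
      right
      rw [pow_zero, mul_one]
      exact Nat.card_le_card_of_injective _ Subtype.val_injective
    | succ j ih =>
      rcases ih with h | h
      · left
        exact eq_bot_iff.2 (h ▸ idealPower_succ_le j)
      · by_cases heq : idealPower I (j + 1) = idealPower I j
        · left
          rw [heq]
          exact hconst j heq
        · right
          obtain ⟨m, hm⟩ := AddSubgroup.card_dvd_of_le (idealPower_succ_le (I := I) j)
          have hpos : 0 < Nat.card (idealPower I j) := Nat.card_pos
          have hm2 : 2 ≤ m := by
            rcases m with _ | _ | m
            · omega
            · exact absurd (AddSubgroup.eq_of_le_of_card_ge (idealPower_succ_le j)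
                (by rw [hm]; simp)) heq
            · omega
          refine le_trans ?_ h
          rw [hm, pow_succ]
          calc _ = Nat.card (idealPower I (j + 1)) * 2 * 2 ^ j := by ring
            _ ≤ _ := by gcongr
  rcases key j with h | h
  · exact h
  · have : 0 < Nat.card (idealPower I j) := Nat.card_pos
    nlinarith

theorem isCentralChain_of_mem {j : ℕ} {l : List R} (h : ∀ b ∈ l, b ∈ idealPower I j) :
    IsCentralChain I (idealPower I (j + 1)) l := by
  induction l with
  | nil => trivial
  | cons b l ih =>
    have hb := h b List.mem_cons_self
    have hle : idealPower I (j + 1) ≤ spanList l ⊔ idealPower I (j + 1) := le_sup_right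
    exact ⟨idealPower_le j hb, fun a ha =>
      ⟨hle (mul_mem_idealPower ha hb), hle (mul_mem_idealPower' ha hb)⟩,
      ih fun b hb => h b (List.mem_cons_of_mem _ hb)⟩

variable {ds : List ℤ} {T : List (List (List ℤ))} {gs : List R}

theorem IsRingCode.nextLevel_spec (h : IsRingCode ds T gs) {S V : List (List ℤ)}
    (hS : spanList (S.map (ev gs)) = I.toAddSubgroup) {j : ℕ}
    (hV : spanList (V.map (ev gs)) = idealPower I j) :
    (∀ v ∈ nextLevel ds T S V, WeaklyReduced ds v) ∧
      spanList ((nextLevel ds T S V).map (ev gs)) = idealPower I (j + 1) := by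
  obtain ⟨h1, h2⟩ := basisRows_spec h.basis
    (V := S.flatMap fun g => V.map fun v => mulVec ds T g v) (by
      intro v hv
      simp only [List.mem_flatMap, List.mem_map] at hv
      obtain ⟨g, -, w, -, rfl⟩ := hv
      exact (h.mulVec_spec g w).1.weaklyReduced)
  refine ⟨h1, h2.trans (le_antisymm ?_ ?_)⟩
  · refine (AddSubgroup.closure_le _).2 fun x hx => ?_
    simp only [List.mem_map, List.mem_flatMap, Set.mem_ofPred_eq] at hx
    obtain ⟨_, ⟨g, hg, w, hw, rfl⟩, rfl⟩ := hx
    rw [(h.mulVec_spec g w).2]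
    refine mul_mem_idealPower ?_ ?_
    · have : ev gs g ∈ I.toAddSubgroup := hS ▸ mem_spanList (List.mem_map_of_mem hg)
      exact this
    · rw [← hV]
      exact mem_spanList (List.mem_map_of_mem hw)
  · refine (AddSubgroup.closure_le _).2 ?_
    rintro x ⟨a, ha, b, hb, rfl⟩
    have ha' : a ∈ spanList (S.map (ev gs)) := by rw [hS]; exact ha
    rw [← hV] at hb
    change a * b ∈ spanList _
    induction ha' using AddSubgroup.closure_induction with
    | mem a ha' =>
      obtain ⟨g, hg, rfl⟩ := List.mem_map.1 ha'
      clear ha ha'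
      induction hb using AddSubgroup.closure_induction with
      | mem b hb =>
        obtain ⟨w, hw, rfl⟩ := List.mem_map.1 hb
        rw [← (h.mulVec_spec g w).2]
        refine mem_spanList (List.mem_map_of_mem ?_)
        simp only [List.mem_flatMap, List.mem_map]
        exact ⟨g, hg, w, hw, rfl⟩
      | zero => rw [mul_zero]; exact zero_mem _
      | add x y _ _ h1 h2 => rw [mul_add]; exact add_mem h1 h2
      | neg x _ h1 => rw [mul_neg]; exact neg_mem h1
    | zero => rw [zero_mul]; exact zero_mem _
    | add x y hx hy h1 h2 =>
      rw [add_mul]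
      have hle {z : R} (hz : z ∈ spanList (S.map (ev gs))) : z ∈ I := by rw [hS] at hz; exact hz
      exact add_mem (h1 (hle hx)) (h2 (hle hy))
    | neg x hx h1 =>
      rw [neg_mul]
      have hle {z : R} (hz : z ∈ spanList (S.map (ev gs))) : z ∈ I := by rw [hS] at hz; exact hz
      exact neg_mem (h1 (hle hx))

/-- The additive generators of the powers of a nilpotent ideal form a central chain: the product of
an element of a power with an element of `I` belongs to the next power, which is generated by the
later entries. -/
theorem IsRingCode.idealBasis_spec [I.IsTwoSided] [Finite R] (h : IsRingCode ds T gs)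
    (hI : IsNilpotent I) {S : List (List ℤ)} (hS : spanList (S.map (ev gs)) = I.toAddSubgroup)
    (hSr : ∀ v ∈ S, WeaklyReduced ds v) :
    (∀ v ∈ idealBasis ds T (Nat.card R) S, WeaklyReduced ds v) ∧
      spanList ((idealBasis ds T (Nat.card R) S).map (ev gs)) = I.toAddSubgroup ∧
      IsCentralChain I ⊥ ((idealBasis ds T (Nat.card R) S).map (ev gs)) := by
  have key {α : Type} (l : List α) (j : ℕ) (s : List (List ℤ) × List (List ℤ))
      (h1 : spanList (s.1.map (ev gs)) = idealPower I j)
      (h2 : ∀ v ∈ s.2, WeaklyReduced ds v)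
      (h3 : spanList (s.2.map (ev gs)) = I.toAddSubgroup)
      (h4 : IsCentralChain I (idealPower I (j + 1)) (s.2.map (ev gs))) :
      let t := l.foldl (fun s _ => (nextLevel ds T S s.1, s.2 ++ nextLevel ds T S s.1)) s
      (∀ v ∈ t.2, WeaklyReduced ds v) ∧ spanList (t.2.map (ev gs)) = I.toAddSubgroup ∧
        IsCentralChain I (idealPower I (j + 1 + l.length)) (t.2.map (ev gs)) := by
    induction l generalizing s j with
    | nil => exact ⟨h2, h3, h4⟩
    | cons x l ih =>
      obtain ⟨h5, h6⟩ := h.nextLevel_spec hS h1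
      have := ih (j + 1) (nextLevel ds T S s.1, s.2 ++ nextLevel ds T S s.1) h6
        (fun v hv => (List.mem_append.1 hv).elim (h2 v) (h5 v)) (by
          rw [List.map_append, spanList_append, h3, h6, sup_eq_left]
          exact idealPower_le _) (by
          rw [List.map_append]
          refine h4.append (by rw [h6]; exact le_sup_left) (isCentralChain_of_mem fun b hb => ?_)
          rw [← h6]
          exact mem_spanList hb)
      rw [show j + 1 + (x :: l).length = j + 1 + 1 + l.length by simp; omega]
      exact this
  obtain ⟨h1, h2, h3⟩ := key (bits (Nat.card R)) 0 (S, S) hS hSr hS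
    (isCentralChain_of_mem fun b hb => by
      have : b ∈ I.toAddSubgroup := by rw [← hS]; exact mem_spanList hb
      exact this)
  rw [idealPower_eq_bot hI] at h3
  · exact ⟨h1, h2, h3⟩
  · rw [length_bits, Int.toNat_natCast]
    exact (Nat.lt_size_self _).trans_le (Nat.pow_le_pow_right (by norm_num) (by omega))

end RingSpec

/-! ### Discrete logarithms -/

section RingSpec

variable {R : Type*} [Ring R] {ds : List ℤ} {T : List (List (List ℤ))} {gs : List R}

/-- Discrete logarithms and orders modulo the group generated by `bs` are computed by elimination in
the group `R × ℤ/D`, where the second component records the coefficient of `b`. What remains after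
the elimination of the coordinates of `R` is the group of the relations of `b`. -/
theorem IsRingCode.discLog_spec (h : IsRingCode ds T gs) {D : ℤ} (hD : 0 < D)
    (hDR : ∀ x : R, D • x = 0) {b w : List ℤ} {bs : List (List ℤ)} (hb : WeaklyReduced ds b)
    (hbs : ∀ v ∈ bs, WeaklyReduced ds v) (hw : w.length = ds.length)
    (hspan : ev gs w ∈ spanList (ev gs b :: bs.map (ev gs))) :
    ev gs w + (discLog ds D b bs w).1 • ev gs b ∈ spanList (bs.map (ev gs)) ∧
      0 < (discLog ds D b bs w).2 ∧
      ∀ c : ℤ, c • ev gs b ∈ spanList (bs.map (ev gs)) ↔ (discLog ds D b bs w).2 ∣ c := by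
  set o : R × ZMod D.toNat := (0, 1) with ho
  set es := gs.map (AddMonoidHom.inl R (ZMod D.toNat)) with hes
  have hcast (c : ℤ) : ((c : ZMod D.toNat) = 0) ↔ D ∣ c := by
    rw [ZMod.intCast_zmod_eq_zero_iff_dvd, Int.toNat_of_nonneg hD.le]
  have hco (c : ℤ) : c • o = (0, (c : ZMod D.toNat)) := by simp [ho]
  have hbo : IsCyclicBasis [D] [o] := by
    refine ⟨hD, ?_, fun c hc => ?_, trivial⟩
    · rw [hco, (hcast D).2 dvd_rfl]; rfl
    · have : c • o = 0 := by simpa [spanList] using hc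
      rw [hco, Prod.mk_eq_zero] at this
      exact (hcast c).1 this.2
  have hB : IsCyclicBasis (ds ++ [D]) (es ++ [o]) := by
    refine (h.basis.map _ (fun x y hxy => by simpa using hxy)).append hbo ?_
    rw [AddSubgroup.disjoint_def]
    intro x hx hx'
    rw [← map_spanList] at hx
    obtain ⟨y, -, rfl⟩ := hx
    obtain ⟨c, z, hz, hc⟩ := mem_spanList_cons.1 hx'
    have : z = 0 := by simpa [spanList] using hz
    rw [this, add_zero, hco] at hc
    have : y = 0 := congrArg Prod.fst hc
    simp [this]
  have hlen := h.basis.length_eq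
  have hev (v : List ℤ) (hv : v.length = ds.length) (c : ℤ) :
      ev (es ++ [o]) (v ++ [c]) = (ev gs v, (c : ZMod D.toNat)) := by
    rw [ev_append _ _ _ _ (by simp [hes, hv, hlen]), hes, ev_map, ev_cons, ev_nil_left, hco]
    simp
  set V := (b ++ [1]) :: bs.map fun v => v ++ [0] with hVdef
  have hV : ∀ v ∈ V, WeaklyReduced (ds ++ [D]) v := by
    intro v hv
    rcases List.mem_cons.1 hv with rfl | hv
    · exact hb.append (.cons ⟨zero_le_one, hD⟩ .nil)
    · obtain ⟨u, hu, rfl⟩ := List.mem_map.1 hv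
      exact (hbs u hu).append (.cons ⟨le_rfl, hD.le⟩ .nil)
  have hVev : V.map (ev (es ++ [o])) =
      (ev gs b, 1) :: (bs.map (ev gs)).map (AddMonoidHom.inl R (ZMod D.toNat)) := by
    rw [hVdef, List.map_cons, hev b hb.length_eq, List.map_map, List.map_map]
    congr 1
    · simp
    · refine List.map_congr_left fun v hv => ?_
      rw [Function.comp_apply, hev v (hbs v hv).length_eq]
      simp
  have hmem (x : R × ZMod D.toNat) : x ∈ spanList (V.map (ev (es ++ [o]))) ↔
      ∃ c : ℤ, x.2 = c ∧ x.1 - c • ev gs b ∈ spanList (bs.map (ev gs)) := by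
    rw [hVev, mem_spanList_cons, ← map_spanList]
    constructor
    · rintro ⟨c, _, ⟨t, ht, rfl⟩, rfl⟩
      exact ⟨c, by simp, by simpa using ht⟩
    · rintro ⟨c, hc, ht⟩
      refine ⟨c, _, ⟨_, ht, rfl⟩, ?_⟩
      ext <;> simp [hc]
  obtain ⟨c0, t0, ht0, hw0⟩ := mem_spanList_cons.1 hspan
  have hdrop1 : (ds ++ [D]).drop ds.length = [D] := List.drop_left
  have hdrop2 : (es ++ [o]).drop ds.length = [o] := by
    rw [hlen, ← List.length_map (f := AddMonoidHom.inl R (ZMod D.toNat))]; exact List.drop_left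
  obtain ⟨V', w', rows', e1, e2, e3, e4, e5, e6⟩ := elim_spec ds hB hV
    (w := w ++ [0]) (by simp [hw]) [] (by simp)
    (x := (-c0) • o) (by
      rw [hdrop2]
      exact zsmul_mem (mem_spanList (by simp)) _) (by
      rw [hev w hw, hmem, hco]
      exact ⟨c0, by simp, by simpa [hw0] using ht0⟩)
  rw [hdrop1] at e1 e2 e3 e4
  rw [hdrop2] at e2 e5 e6
  obtain ⟨p, ps, W, f1, f2, f3, f4, f5, f6, f7⟩ := colStep_spec e2 e3
  cases f3
  obtain ⟨y, rfl⟩ : ∃ y, w' = [y] := List.length_eq_one_iff.1 (by simpa using e4)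
  have hdl : discLog ds D b bs w = (y, p) := by
    simp only [discLog]
    rw [← hVdef, e1, f1]
    rfl
  rw [hdl]
  rw [e5] at f5 f6
  refine ⟨?_, f2, fun c => ⟨fun hc => ?_, fun hc => ?_⟩⟩
  · rw [hev w hw, ev_cons, ev_nil_left, add_zero, hco, hmem] at e6
    obtain ⟨c, hc, hc'⟩ := e6
    simp only [Prod.mk_sub_mk, sub_zero, Int.cast_zero, zero_sub] at hc hc'
    have hd : D ∣ c + y := by
      rw [← hcast, Int.cast_add, ← hc, neg_add_cancel]
    obtain ⟨m, hm⟩ := hd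
    have : y • ev gs b = - (c • ev gs b) := by
      rw [eq_neg_iff_add_eq_zero, ← add_smul, add_comm, hm, mul_comm, mul_zsmul, hDR, smul_zero]
    rw [this, ← sub_eq_add_neg]
    exact hc'
  · refine f6 c 0 (zero_mem _) (AddSubgroup.mem_inf.2 ⟨?_, ?_⟩)
    · rw [add_zero, hco, hmem]
      refine ⟨c, rfl, ?_⟩
      rw [zero_sub]
      exact neg_mem hc
    · rw [add_zero]
      exact zsmul_mem (mem_spanList (by simp)) _
  · obtain ⟨m, rfl⟩ := hc
    have hp : ev [o] [p] ∈ spanList (V.map (ev (es ++ [o]))) := by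
      have : ev [o] [p] ∈ spanList (ev [o] [p] :: W.map (ev [])) := mem_spanList (by simp)
      rw [← f5] at this
      exact this.1
    rw [ev_cons, ev_nil_left, add_zero, hco, hmem] at hp
    obtain ⟨c, hc, hc'⟩ := hp
    rw [zero_sub, neg_mem_iff] at hc'
    have hd : D ∣ p - c := by
      rw [← hcast, Int.cast_sub, sub_eq_zero]
      exact hc
    obtain ⟨k, hk⟩ := hd
    have : p • ev gs b = c • ev gs b := by
      rw [← sub_eq_zero, ← sub_smul, hk, mul_comm, mul_zsmul, hDR, smul_zero]
    rw [mul_comm, mul_zsmul, this]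
    exact zsmul_mem hc' m

end RingSpec

/-! ### Words and presentations of polycyclic type -/

section Words

variable {G : Type*} [Group G]

/-- The element that is spelled by a word in the elements `f i`. -/
def evalWord (f : ℤ → G) (w : List (ℤ × ℤ)) : G := (w.map fun s => f s.1 ^ s.2).prod

@[simp] theorem evalWord_nil (f : ℤ → G) : evalWord f [] = 1 := rfl

@[simp] theorem evalWord_cons (f : ℤ → G) (s : ℤ × ℤ) (w : List (ℤ × ℤ)) :
    evalWord f (s :: w) = f s.1 ^ s.2 * evalWord f w := rfl

theorem map_evalWord {H : Type*} [Group H] (φ : G →* H) (f : ℤ → G) (w : List (ℤ × ℤ)) :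
    φ (evalWord f w) = evalWord (fun i => φ (f i)) w := by
  induction w with
  | nil => simp
  | cons s w ih => simp [ih]

theorem evalWord_mem {f : ℤ → G} {w : List (ℤ × ℤ)} {N : Subgroup G}
    (h : ∀ s ∈ w, f s.1 ∈ N) : evalWord f w ∈ N :=
  N.list_prod_mem fun x hx => by
    obtain ⟨s, hs, rfl⟩ := List.mem_map.1 hx
    exact zpow_mem (h s hs) _

/-- If `x⁻¹ N x ⊆ N` and a positive power of `x` belongs to `N`, then the same inclusion holds for
all powers of `x`: negative powers of `x` are positive ones modulo `N`. -/
theorem conj_zpow_mem {N : Subgroup G} {x : G} (hx : ∀ n ∈ N, x⁻¹ * n * x ∈ N) {r : ℤ}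
    (hr : 0 < r) (hxr : x ^ r ∈ N) (d : ℤ) {n : G} (hn : n ∈ N) : (x ^ d)⁻¹ * n * x ^ d ∈ N := by
  have hnat (k : ℕ) : (x ^ k)⁻¹ * n * x ^ k ∈ N := by
    induction k with
    | zero => simpa using hn
    | succ k ih =>
      have := hx _ ih
      rw [pow_succ, mul_inv_rev]
      simpa only [mul_assoc] using this
  have hd : x ^ d = x ^ (d % r).toNat * (x ^ r) ^ (d / r) := by
    rw [← zpow_natCast, Int.toNat_of_nonneg (Int.emod_nonneg _ hr.ne'), ← zpow_mul, ← zpow_add,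
      Int.emod_add_mul_ediv]
  have h1 := zpow_mem hxr (d / r)
  have h2 := N.mul_mem (N.mul_mem (N.inv_mem h1) (hnat (d % r).toNat)) h1
  rw [hd, mul_inv_rev]
  simpa only [mul_assoc] using h2

/-- If `x` normalizes `N` and the elements of `S` belong to `N` or are equal to `x`, then the
elements of the group generated by `S` are of the form `x ^ c * n` with `n ∈ N`. -/
theorem exists_zpow_mul {N : Subgroup G} {x : G} (hx : ∀ n ∈ N, x⁻¹ * n * x ∈ N) {r : ℤ}
    (hr : 0 < r) (hxr : x ^ r ∈ N) {S : Set G} (hS : ∀ s ∈ S, s = x ∨ s ∈ N) {w : G}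
    (hw : w ∈ Subgroup.closure S) : ∃ c : ℤ, ∃ n ∈ N, w = x ^ c * n := by
  induction hw using Subgroup.closure_induction with
  | mem s hs =>
    rcases hS s hs with rfl | h
    · exact ⟨1, 1, N.one_mem, by simp⟩
    · exact ⟨0, s, h, by simp⟩
  | one => exact ⟨0, 1, N.one_mem, by simp⟩
  | mul u v _ _ hu hv =>
    obtain ⟨c, n, hn, rfl⟩ := hu
    obtain ⟨d, k, hk, rfl⟩ := hv
    refine ⟨c + d, (x ^ d)⁻¹ * n * x ^ d * k, N.mul_mem (conj_zpow_mem hx hr hxr d hn) hk, ?_⟩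
    rw [zpow_add]
    group
  | inv u _ hu =>
    obtain ⟨c, n, hn, rfl⟩ := hu
    refine ⟨-c, (x ^ (-c))⁻¹ * n⁻¹ * x ^ (-c), conj_zpow_mem hx hr hxr _ (N.inv_mem hn), ?_⟩
    group

/-- Let `Nᵢ` be the subgroup of a finitely presented group that is generated by the generators after
`xᵢ`. Suppose that the power `xᵢ ^ rᵢ` and the conjugates `xᵢ⁻¹ xⱼ xᵢ` for `j > i` belong to `Nᵢ`.
Under a homomorphism such that all powers of the image of `xᵢ` that belong to the image of `Nᵢ` have
exponents divisible by `rᵢ`, the kernel is contained in each `Nᵢ` and therefore trivial. -/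
theorem toGroup_injective {m : ℕ} {g : Fin m → G} {rels : Set (FreeGroup (Fin m))}
    (hrel : ∀ r ∈ rels, FreeGroup.lift g r = 1) (r : Fin m → ℤ) (hr : ∀ i, 0 < r i)
    (hpow : ∀ i, (PresentedGroup.of i : PresentedGroup rels) ^ r i ∈
      Subgroup.closure {x | ∃ j, i < j ∧ x = PresentedGroup.of j})
    (hconj : ∀ i j, i < j →
      (PresentedGroup.of i : PresentedGroup rels)⁻¹ * PresentedGroup.of j * PresentedGroup.of i ∈
        Subgroup.closure {x | ∃ j, i < j ∧ x = PresentedGroup.of j})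
    (hord : ∀ i (c : ℤ), g i ^ c ∈ Subgroup.closure {x | ∃ j, i < j ∧ x = g j} → r i ∣ c) :
    Function.Injective (PresentedGroup.toGroup hrel) := by
  rw [injective_iff_map_eq_one]
  intro w hw
  -- An element of the kernel belongs to the subgroup generated by the last `m - k` generators.
  have key (k : ℕ) (hk : k ≤ m) :
      w ∈ Subgroup.closure {x : PresentedGroup rels | ∃ j : Fin m, k ≤ j ∧
        x = PresentedGroup.of j} := by
    induction k with
    | zero =>
      have : w ∈ Subgroup.closure (Set.range (PresentedGroup.of (rels := rels))) := by
        rw [PresentedGroup.closure_range_of]; trivial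
      refine Subgroup.closure_mono ?_ this
      rintro _ ⟨j, rfl⟩
      exact ⟨j, Nat.zero_le _, rfl⟩
    | succ k ih =>
      let i : Fin m := ⟨k, hk⟩
      have hset : {x : PresentedGroup rels | ∃ j : Fin m, k + 1 ≤ (j : ℕ) ∧
          x = PresentedGroup.of j} = {x | ∃ j, i < j ∧ x = PresentedGroup.of j} := by
        ext x
        simp only [Set.mem_ofPred_eq, Fin.lt_def, Nat.succ_le_iff, i]
      rw [hset]
      set N := Subgroup.closure {x : PresentedGroup rels | ∃ j, i < j ∧ x = PresentedGroup.of j}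
        with hN
      have hx : ∀ n ∈ N, (PresentedGroup.of i)⁻¹ * n * PresentedGroup.of i ∈ N := by
        intro n hn
        induction hn using Subgroup.closure_induction with
        | mem x hx =>
          obtain ⟨j, hj, rfl⟩ := hx
          exact hconj i j hj
        | one => simp
        | mul u v _ _ hu hv =>
          have := N.mul_mem hu hv
          convert this using 1
          group
        | inv u _ hu =>
          have := N.inv_mem hu
          convert this using 1
          group
      obtain ⟨c, n, hn, hcn⟩ := exists_zpow_mul hx (hr i) (hpow i)
        (S := {x : PresentedGroup rels | ∃ j : Fin m, k ≤ j ∧ x = PresentedGroup.of j})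
        (by
          rintro s ⟨j, hj, rfl⟩
          rcases hj.lt_or_eq with hj | hj
          · exact Or.inr (Subgroup.subset_closure ⟨j, hj, rfl⟩)
          · exact Or.inl (by rw [show j = i from Fin.ext hj.symm])) (ih (by omega))
      have himg : PresentedGroup.toGroup hrel n ∈
          Subgroup.closure {x | ∃ j, i < j ∧ x = g j} := by
        have : PresentedGroup.toGroup hrel n ∈ N.map (PresentedGroup.toGroup hrel) := ⟨n, hn, rfl⟩
        rw [hN, MonoidHom.map_closure] at this
        refine Subgroup.closure_mono ?_ this
        rintro _ ⟨_, ⟨j, hj, rfl⟩, rfl⟩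
        exact ⟨j, hj, by simp⟩
      have hgc : g i ^ c = (PresentedGroup.toGroup hrel n)⁻¹ := by
        rw [eq_inv_iff_mul_eq_one, ← hw, hcn, map_mul, map_zpow, PresentedGroup.toGroup.of]
      obtain ⟨d, rfl⟩ := hord i c (by rw [hgc]; exact inv_mem himg)
      rw [hcn, zpow_mul]
      exact N.mul_mem (zpow_mem (hpow i) d) hn
  have := key m le_rfl
  have hempty : {x : PresentedGroup rels | ∃ j : Fin m, m ≤ j ∧ x = PresentedGroup.of j} = ∅ := by
    ext x
    simp only [Set.mem_ofPred_eq, Set.mem_empty_iff_false, iff_false, not_exists, not_and]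
    intro j hj
    exact absurd j.2 (by omega)
  rw [hempty, Subgroup.closure_empty, Subgroup.mem_bot] at this
  exact this

end Words

/-! ### The group `1 + I` -/

section OnePlus

variable {R : Type*} [Ring R] {I : Ideal R}

/-- Multiplication with elements of `I` maps the span of a central chain into the span of the
entries after the first one. -/
theorem IsCentralChain.mul_mem {b : R} {bs : List R} (h : IsCentralChain I ⊥ (b :: bs)) {a x : R}
    (ha : a ∈ I) (hx : x ∈ spanList (b :: bs)) :
    a * x ∈ spanList bs ∧ x * a ∈ spanList bs := by
  have key {l : List R} (h : IsCentralChain I ⊥ l) : ∀ c ∈ l,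
      a * c ∈ spanList l.tail ∧ c * a ∈ spanList l.tail := by
    induction l with
    | nil => simp
    | cons b l ih =>
      intro c hc
      rcases List.mem_cons.1 hc with rfl | hc
      · simpa using h.2.1 a ha
      · have hle : spanList l.tail ≤ spanList l :=
          AddSubgroup.closure_mono fun y hy => List.mem_of_mem_tail hy
        exact ⟨hle (ih h.2.2 c hc).1, hle (ih h.2.2 c hc).2⟩
  induction hx using AddSubgroup.closure_induction with
  | mem x hx => exact key h x hx
  | zero => simp
  | add x y _ _ h1 h2 =>
    rw [mul_add, add_mul]
    exact ⟨add_mem h1.1 h2.1, add_mem h1.2 h2.2⟩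
  | neg x _ h1 =>
    rw [mul_neg, neg_mul]
    exact ⟨neg_mem h1.1, neg_mem h1.2⟩

theorem IsCentralChain.mul_mem' {l : List R} (h : IsCentralChain I ⊥ l) {a x : R}
    (ha : a ∈ I) (hx : x ∈ spanList l) : a * x ∈ spanList l ∧ x * a ∈ spanList l := by
  cases l with
  | nil =>
    have : x = 0 := by simpa [spanList] using hx
    simp [this]
  | cons b l =>
    exact ⟨spanList_le_cons _ _ (h.mul_mem ha hx).1, spanList_le_cons _ _ (h.mul_mem ha hx).2⟩

variable [I.IsTwoSided]

theorem sub_one_mem (u : onePlus I) : ((u : Rˣ) : R) - 1 ∈ I := by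
  obtain ⟨a, ha, hu⟩ := u.2
  rw [hu, add_sub_cancel_left]
  exact ha

/-- The subgroup `1 + J` of `1 + I`, where `J` is the additive group generated by a central
chain. -/
def unipotentSubgroup {l : List R} (h : IsCentralChain I ⊥ l) : Subgroup (onePlus I) where
  carrier := {u | ((u : Rˣ) : R) - 1 ∈ spanList l}
  one_mem' := by
    change (1 : R) - 1 ∈ spanList l
    rw [sub_self]
    exact zero_mem _
  mul_mem' := by
    intro u v hu hv
    change ((u : Rˣ) : R) * ((v : Rˣ) : R) - 1 ∈ spanList l
    have e : ((u : Rˣ) : R) * ((v : Rˣ) : R) - 1 =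
        (((u : Rˣ) : R) - 1) + (((v : Rˣ) : R) - 1) +
          (((u : Rˣ) : R) - 1) * (((v : Rˣ) : R) - 1) := by
      noncomm_ring
    rw [e]
    exact add_mem (add_mem hu hv) (h.mul_mem' (sub_one_mem u) hv).1
  inv_mem' := by
    intro u hu
    change (((u⁻¹ : onePlus I) : Rˣ) : R) - 1 ∈ spanList l
    have hinv : (((u⁻¹ : onePlus I) : Rˣ) : R) * ((u : Rˣ) : R) = 1 := by
      rw [Subgroup.coe_inv, Units.inv_mul]
    have e : (((u⁻¹ : onePlus I) : Rˣ) : R) - 1 = -(((u : Rˣ) : R) - 1) -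
        ((((u⁻¹ : onePlus I) : Rˣ) : R) - 1) * (((u : Rˣ) : R) - 1) := by
      rw [sub_mul, mul_sub, hinv]
      noncomm_ring
    rw [e]
    exact sub_mem (neg_mem hu) (h.mul_mem' (sub_one_mem _) hu).1

theorem mem_unipotentSubgroup {l : List R} {h : IsCentralChain I ⊥ l} {u : onePlus I} :
    u ∈ unipotentSubgroup h ↔ ((u : Rˣ) : R) - 1 ∈ spanList l := Iff.rfl

/-- For a central chain with first entry `b`, multiplication in `1 + J` amounts to addition in `J`,
modulo the span of the remaining entries. -/
theorem mul_sub_one_congr {b : R} {bs : List R} (h : IsCentralChain I ⊥ (b :: bs))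
    {u v : onePlus I} (hv : v ∈ unipotentSubgroup h) {x y : R}
    (hx : ((u : Rˣ) : R) - 1 - x ∈ spanList bs) (hy : ((v : Rˣ) : R) - 1 - y ∈ spanList bs) :
    (((u * v : onePlus I) : Rˣ) : R) - 1 - (x + y) ∈ spanList bs := by
  have e : (((u * v : onePlus I) : Rˣ) : R) - 1 - (x + y) =
      (((u : Rˣ) : R) - 1 - x) + (((v : Rˣ) : R) - 1 - y) +
        (((u : Rˣ) : R) - 1) * (((v : Rˣ) : R) - 1) := by
    rw [Subgroup.coe_mul, Units.val_mul]
    noncomm_ring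
  rw [e]
  exact add_mem (add_mem hx hy) (h.mul_mem (sub_one_mem u) hv).1

/-- The power `(1 + b) ^ c` is congruent to `1 + c b` modulo the later entries of the chain. -/
theorem zpow_sub_one_congr {b : R} {bs : List R} (h : IsCentralChain I ⊥ (b :: bs))
    {u : onePlus I} (hu : ((u : Rˣ) : R) = 1 + b) (c : ℤ) :
    (((u ^ c : onePlus I) : Rˣ) : R) - 1 - c • b ∈ spanList bs := by
  have hu1 : u ∈ unipotentSubgroup h := by
    rw [mem_unipotentSubgroup, hu, add_sub_cancel_left]
    exact mem_spanList List.mem_cons_self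
  have hu0 : ((u : Rˣ) : R) - 1 - b ∈ spanList bs := by
    rw [hu, add_sub_cancel_left, sub_self]; exact zero_mem _
  have hinv : (((u⁻¹ : onePlus I) : Rˣ) : R) - 1 - (-b) ∈ spanList bs := by
    have e : (((u⁻¹ : onePlus I) : Rˣ) : R) - 1 - (-b) =
        -(((((u⁻¹ : onePlus I) : Rˣ) : R) - 1) * b) := by
      have h1 : (((u⁻¹ : onePlus I) : Rˣ) : R) * (1 + b) = 1 := by
        rw [← hu, Subgroup.coe_inv, Units.inv_mul]
      rw [mul_add, mul_one] at h1
      rw [sub_mul, one_mul, ← h1]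
      abel
    rw [e]
    exact neg_mem (h.mul_mem (sub_one_mem _) (mem_spanList List.mem_cons_self)).1
  induction c using Int.induction_on with
  | zero => simp
  | succ i ih =>
    have := mul_sub_one_congr h hu1 ih hu0
    rw [zpow_add_one, add_smul, one_smul]
    exact this
  | pred i ih =>
    have := mul_sub_one_congr h (inv_mem hu1) ih hinv
    rw [zpow_sub_one, sub_smul, one_smul, sub_eq_add_neg (_ • b)]
    exact this

end OnePlus

/-! ### Correctness of the algorithms for `1 + I` -/

section UnipotentAlgorithms

variable {R : Type*} [Ring R] {ds : List ℤ} {T : List (List (List ℤ))} {gs : List R}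
  {D : ℤ} {one : List ℤ} {I : Ideal R} [I.IsTwoSided]

/-- The data `ds`, `T`, `D` and `one` describe the finite ring `R`: its additive group, its
multiplication, a common exponent of the additive group and of `1 + I`, and its unit. -/
structure IsUnitalRingCode (ds : List ℤ) (T : List (List (List ℤ))) (gs : List R) (D : ℤ)
    (one : List ℤ) (I : Ideal R) [I.IsTwoSided] : Prop extends IsRingCode ds T gs where
  pos : 0 < D
  smul_eq_zero : ∀ x : R, D • x = 0
  zpow_eq_one : ∀ u : onePlus I, u ^ D = 1
  reducedMod_one : ReducedMod ds one
  ev_one : ev gs one = 1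

/-- The indexed list `B` describes a central chain in `I`, and the element `f i` of `1 + I` is
`1 + b` for the entry `b` with index `i`. -/
structure IsUnipotentBasis (ds : List ℤ) (gs : List R) (I : Ideal R) [I.IsTwoSided]
    (B : List (ℤ × List ℤ)) (f : ℤ → onePlus I) : Prop where
  weaklyReduced : ∀ p ∈ B, WeaklyReduced ds p.2
  chain : IsCentralChain I ⊥ (B.map fun p => ev gs p.2)
  gen : ∀ p ∈ B, ((f p.1 : Rˣ) : R) = 1 + ev gs p.2

variable {B : List (ℤ × List ℤ)} {f : ℤ → onePlus I}

theorem IsUnipotentBasis.tail {p : ℤ × List ℤ} (hB : IsUnipotentBasis ds gs I (p :: B) f) :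
    IsUnipotentBasis ds gs I B f :=
  ⟨fun q hq => hB.weaklyReduced q (List.mem_cons_of_mem _ hq), hB.chain.2.2,
    fun q hq => hB.gen q (List.mem_cons_of_mem _ hq)⟩

theorem IsUnipotentBasis.gen_mem (hB : IsUnipotentBasis ds gs I B f) {p : ℤ × List ℤ}
    (hp : p ∈ B) : f p.1 ∈ unipotentSubgroup hB.chain := by
  rw [mem_unipotentSubgroup, hB.gen p hp, add_sub_cancel_left]
  exact mem_spanList (List.mem_map_of_mem hp)

namespace IsUnitalRingCode

theorem powVec_spec (h : IsUnitalRingCode ds T gs D one I)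
    {u : List ℤ} {U : onePlus I} (hu : ev gs u = ((U : Rˣ) : R)) (e : ℤ) :
    ReducedMod ds (powVec ds T D one u e) ∧
      ev gs (powVec ds T D one u e) = (((U ^ e : onePlus I) : Rˣ) : R) :=
  h.toIsRingCode.powVec_spec h.pos h.reducedMod_one h.ev_one hu
    (congrArg Subtype.val (h.zpow_eq_one U)) e

theorem mulVec_spec (h : IsUnitalRingCode ds T gs D one I)
    {u v : List ℤ} {U V : onePlus I} (hu : ev gs u = ((U : Rˣ) : R))
    (hv : ev gs v = ((V : Rˣ) : R)) :
    ReducedMod ds (mulVec ds T u v) ∧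
      ev gs (mulVec ds T u v) = (((U * V : onePlus I) : Rˣ) : R) := by
  obtain ⟨h1, h2⟩ := h.toIsRingCode.mulVec_spec u v
  exact ⟨h1, by rw [h2, hu, hv]; rfl⟩

theorem ev_gen (h : IsUnitalRingCode ds T gs D one I)
    (hB : IsUnipotentBasis ds gs I B f) {p : ℤ × List ℤ} (hp : p ∈ B) :
    ev gs (subSmul ds (-1) one p.2) = ((f p.1 : Rˣ) : R) := by
  rw [ev_subSmul h.basis (-1) h.reducedMod_one.length_eq (hB.weaklyReduced p hp).length_eq,
    h.ev_one, hB.gen p hp, neg_smul, one_smul, sub_neg_eq_add]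

/-- If `u` belongs to `1 + J`, for the group `J` generated by the list, then the computed word
spells its inverse: each step moves `u` into the next smaller group of this kind, as products in
`1 + J` are sums in `J` modulo the later entries. -/
theorem logWord_spec (h : IsUnitalRingCode ds T gs D one I)
    (hB : IsUnipotentBasis ds gs I B f) {u : List ℤ}
    (hlen : u.length = ds.length) {U : onePlus I} (hu : ev gs u = ((U : Rˣ) : R))
    (hU : U ∈ unipotentSubgroup hB.chain) :
    (∀ s ∈ logWord ds T D one B u, ∃ p ∈ B, s.1 = p.1) ∧
      U * evalWord f (logWord ds T D one B u) = 1 := by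
  have key (acc : List (ℤ × ℤ)) : ∃ w, ((suffixes B).foldl
      (fun s suf => logStep ds T D one s suf) (u, acc)).2 = acc ++ w ∧
      (∀ s ∈ w, ∃ p ∈ B, s.1 = p.1) ∧ U * evalWord f w = 1 := by
    induction B generalizing u U acc with
    | nil =>
      refine ⟨[], by simp [suffixes], by simp, ?_⟩
      have : ((U : Rˣ) : R) - 1 = 0 := by simpa [spanList] using mem_unipotentSubgroup.1 hU
      rw [evalWord_nil, mul_one]
      exact Subtype.ext (Units.ext (sub_eq_zero.1 this))
    | cons p B ih =>
      have hp : p ∈ p :: B := List.mem_cons_self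
      set x := subSmul ds 1 u one with hx
      have hxev : ev gs x = ((U : Rˣ) : R) - 1 := by
        rw [hx, ev_subSmul h.basis 1 hlen h.reducedMod_one.length_eq, hu, h.ev_one, one_smul]
      set y := (discLog ds D p.2 (B.map fun q => q.2) x).1 with hy
      have hd := (h.discLog_spec h.pos h.smul_eq_zero (b := p.2) (w := x)
        (bs := B.map fun q => q.2) (hB.weaklyReduced p hp) (by
          intro v hv
          obtain ⟨q, hq, rfl⟩ := List.mem_map.1 hv
          exact hB.weaklyReduced q (List.mem_cons_of_mem _ hq))
        (length_subSmul 1 hlen h.reducedMod_one.length_eq) (by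
          rw [hxev, List.map_map]; exact hU)).1
      rw [← hy, hxev, List.map_map] at hd
      obtain ⟨h1, h2⟩ := h.powVec_spec (h.ev_gen hB hp) y
      obtain ⟨h3, h4⟩ := h.mulVec_spec hu h2
      have hmem : U * f p.1 ^ y ∈ unipotentSubgroup hB.tail.chain := by
        have h5 := mul_sub_one_congr hB.chain (u := U) (x := ((U : Rˣ) : R) - 1)
          (zpow_mem (hB.gen_mem hp) y) (by rw [sub_self]; exact zero_mem _)
          (zpow_sub_one_congr hB.chain (hB.gen p hp) y)
        rw [mem_unipotentSubgroup]
        have := add_mem h5 hd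
        rwa [sub_add_cancel] at this
      obtain ⟨w, hw1, hw2, hw3⟩ := ih hB.tail h3.length_eq h4 hmem (acc ++ [(p.1, y)])
      refine ⟨(p.1, y) :: w, ?_, ?_, ?_⟩
      · rw [List.append_assoc] at hw1
        exact hw1
      · intro s hs
        rcases List.mem_cons.1 hs with rfl | hs
        · exact ⟨p, hp, rfl⟩
        · obtain ⟨q, hq, e⟩ := hw2 s hs
          exact ⟨q, List.mem_cons_of_mem _ hq, e⟩
      · rw [evalWord_cons, ← mul_assoc, hw3]
  obtain ⟨w, h1, h2⟩ := key []
  rw [List.nil_append] at h1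
  rw [logWord, h1]
  exact h2

/-- The relators that belong to the first generator are satisfied in `1 + I`, and they express the
smallest power of this generator that belongs to the subgroup generated by the later ones. -/
theorem relatorsAt_spec (h : IsUnitalRingCode ds T gs D one I)
    {p : ℤ × List ℤ} (hB : IsUnipotentBasis ds gs I (p :: B) f) :
    ∃ (r : ℤ) (w : List (ℤ × ℤ)) (W : ℤ × List ℤ → List (ℤ × ℤ)),
      relatorsAt ds T D one (p :: B) =
        ((p.1, r) :: w) :: B.map (fun q => (p.1, -1) :: (q.1, 1) :: (p.1, 1) :: W q) ∧
      0 < r ∧ (∀ c : ℤ, f p.1 ^ c ∈ unipotentSubgroup hB.tail.chain → r ∣ c) ∧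
      (∀ s ∈ w, ∃ q ∈ B, s.1 = q.1) ∧ f p.1 ^ r * evalWord f w = 1 ∧
      ∀ q ∈ B, (∀ s ∈ W q, ∃ t ∈ B, s.1 = t.1) ∧
        (f p.1)⁻¹ * f q.1 * f p.1 * evalWord f (W q) = 1 := by
  have hp : p ∈ p :: B := List.mem_cons_self
  obtain ⟨-, hr, hdvd⟩ := h.discLog_spec h.pos h.smul_eq_zero (b := p.2) (w := zeroVec ds)
    (bs := B.map fun q => q.2) (hB.weaklyReduced p hp) (by
      intro v hv
      obtain ⟨q, hq, rfl⟩ := List.mem_map.1 hv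
      exact hB.weaklyReduced q (List.mem_cons_of_mem _ hq))
    (length_zeroVec ds) (by rw [ev_zeroVec]; exact zero_mem _)
  rw [List.map_map] at hdvd
  have hpow (c : ℤ) : f p.1 ^ c ∈ unipotentSubgroup hB.tail.chain ↔
      (discLog ds D p.2 (B.map fun q => q.2) (zeroVec ds)).2 ∣ c := by
    rw [← hdvd, mem_unipotentSubgroup]
    have hc := zpow_sub_one_congr hB.chain (hB.gen p hp) c
    refine ⟨fun hx => ?_, fun hx => ?_⟩
    · have := sub_mem hx hc
      rwa [sub_sub_cancel] at this
    · have := add_mem hc hx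
      rwa [sub_add_cancel] at this
  obtain ⟨h1, h2⟩ := h.powVec_spec (h.ev_gen hB hp)
    (discLog ds D p.2 (B.map fun q => q.2) (zeroVec ds)).2
  obtain ⟨h3, h4⟩ := h.logWord_spec hB.tail h1.length_eq h2 ((hpow _).2 dvd_rfl)
  refine ⟨_, _, _, rfl, hr, fun c hc => (hpow c).1 hc, h3, h4, fun q hq => ?_⟩
  have hq' : q ∈ p :: B := List.mem_cons_of_mem _ hq
  obtain ⟨-, h5⟩ := h.powVec_spec (h.ev_gen hB hp) (-1)
  obtain ⟨-, h6⟩ := h.mulVec_spec h5 (h.ev_gen hB hq')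
  obtain ⟨h7, h8⟩ := h.mulVec_spec h6 (h.ev_gen hB hp)
  rw [zpow_neg_one] at h8
  refine h.logWord_spec hB.tail h7.length_eq h8 ?_
  rw [mem_unipotentSubgroup]
  have hb := mem_unipotentSubgroup.1 (hB.tail.gen_mem hq)
  have e : ((((f p.1)⁻¹ * f q.1 * f p.1 : onePlus I) : Rˣ) : R) - 1 =
      (((f p.1)⁻¹ : onePlus I) : Rˣ) * (((f q.1 : Rˣ) : R) - 1) * ((f p.1 : Rˣ) : R) := by
    rw [mul_sub, sub_mul, mul_one, Subgroup.coe_mul, Subgroup.coe_mul, Subgroup.coe_inv,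
      Units.val_mul, Units.val_mul, Units.inv_mul]
  -- The subgroup generated by the later entries is an ideal of the ring generated by `I` and `1`.
  have hmul (V : onePlus I) {x : R} (hx : x ∈ spanList (B.map fun p => ev gs p.2)) :
      ((V : Rˣ) : R) * x ∈ spanList (B.map fun p => ev gs p.2) ∧
        x * ((V : Rˣ) : R) ∈ spanList (B.map fun p => ev gs p.2) := by
    obtain ⟨a, ha, hV⟩ := V.2
    obtain ⟨h9, h10⟩ := hB.tail.chain.mul_mem' ha hx
    rw [hV, add_mul, mul_add, one_mul, mul_one]
    exact ⟨add_mem hx h9, add_mem hx h10⟩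
  rw [e]
  exact (hmul _ (hmul _ hb).1).2

theorem expWord_spec (h : IsUnitalRingCode ds T gs D one I)
    (hB : IsUnipotentBasis ds gs I B f)
    (hlook : ∀ p ∈ B, lookup p.1 B = p.2) {w : List (ℤ × ℤ)} (hw : ∀ s ∈ w, ∃ p ∈ B, s.1 = p.1) :
    ReducedMod ds (expWord ds T D one B w) ∧
      ev gs (expWord ds T D one B w) = (((evalWord f w : onePlus I) : Rˣ) : R) := by
  have key (acc : List ℤ) (V : onePlus I) (ha : ReducedMod ds acc)
      (hV : ev gs acc = ((V : Rˣ) : R)) :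
      ReducedMod ds (w.foldl (fun acc s => mulVec ds T acc
        (powVec ds T D one (subSmul ds (-1) one (lookup s.1 B)) s.2)) acc) ∧
      ev gs (w.foldl (fun acc s => mulVec ds T acc
        (powVec ds T D one (subSmul ds (-1) one (lookup s.1 B)) s.2)) acc) =
          ((V * evalWord f w : onePlus I) : Rˣ) := by
    induction w generalizing acc V with
    | nil => simpa using ⟨ha, hV⟩
    | cons s w ih =>
      obtain ⟨p, hp, hs⟩ := hw s List.mem_cons_self
      obtain ⟨-, h1⟩ := h.powVec_spec (h.ev_gen hB hp) s.2
      obtain ⟨h2, h3⟩ := h.mulVec_spec hV h1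
      rw [List.foldl_cons, evalWord_cons, ← mul_assoc, hs, hlook p hp]
      exact ih (fun s hs => hw s (List.mem_cons_of_mem _ hs)) _ _ h2 h3
  have := key one 1 h.reducedMod_one h.ev_one
  rwa [one_mul] at this

end IsUnitalRingCode

theorem lookup_indexFrom (l : List (List ℤ)) {p : ℤ × List ℤ} (hp : p ∈ indexFrom 0 l) :
    lookup p.1 (indexFrom 0 l) = p.2 := by
  have hle (l : List (List ℤ)) (k : ℤ) {p : ℤ × List ℤ} (hp : p ∈ indexFrom k l) : k ≤ p.1 := by
    induction l generalizing k with
    | nil => simp [indexFrom] at hp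
    | cons v l ih =>
      rcases List.mem_cons.1 hp with rfl | hp
      · exact le_rfl
      · have := ih (k + 1) hp
        omega
  have hlt (l : List (List ℤ)) (k i : ℤ) (hi : i < k) (acc : List ℤ) :
      (indexFrom k l).foldl (fun acc p => if p.1 = i then p.2 else acc) acc = acc := by
    induction l generalizing k acc with
    | nil => rfl
    | cons v l ih =>
      rw [indexFrom, List.foldl_cons, if_neg (by omega)]
      exact ih (k + 1) (by omega) acc
  have key (k : ℤ) (acc : List ℤ) (l : List (List ℤ)) (hp : p ∈ indexFrom k l) :
      (indexFrom k l).foldl (fun acc q => if q.1 = p.1 then q.2 else acc) acc = p.2 := by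
    induction l generalizing k acc with
    | nil => simp [indexFrom] at hp
    | cons v l ih =>
      rw [indexFrom, List.foldl_cons]
      rcases List.mem_cons.1 hp with rfl | hp
      · rw [if_pos rfl]
        exact hlt l (k + 1) k (by omega) v
      · have := hle l (k + 1) hp
        exact ih (k + 1) _ hp
  exact key 0 [] l hp

end UnipotentAlgorithms

/-! ### The presentation of `1 + I` -/

/-- A word with its generators replaced by their numbers. -/
def GroupWord.intWord {n : ℕ} (w : GroupWord n) : List (ℤ × ℤ) :=
  w.map fun s => (((s.1 : ℕ) : ℤ), s.2)

theorem GroupWord.encode_eq {n : ℕ} (w : GroupWord n) : w.encode = enc w.intWord := by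
  change _ = Data.ofList ((w.map _).map enc)
  rw [List.map_map]
  rfl

theorem GroupWord.map_toFree {n : ℕ} {G : Type*} [Group G] (φ : FreeGroup (Fin n) →* G)
    {f : ℤ → G} (hf : ∀ i : Fin n, φ (FreeGroup.of i) = f ((i : ℕ) : ℤ)) (w : GroupWord n) :
    φ w.toFree = evalWord f w.intWord := by
  induction w with
  | nil => exact map_one φ
  | cons s w ih =>
    have h1 : GroupWord.toFree (s :: w) = FreeGroup.of s.1 ^ s.2 * GroupWord.toFree w := rfl
    rw [h1, map_mul, map_zpow, ih, hf]
    rfl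

theorem GroupWord.exists_intWord_eq {n : ℕ} {w : List (ℤ × ℤ)}
    (hw : ∀ s ∈ w, ∃ i < n, s.1 = (i : ℤ)) : ∃ w' : GroupWord n, w'.intWord = w := by
  have : w ∈ Set.range (List.map fun s : Fin n × ℤ => (((s.1 : ℕ) : ℤ), s.2)) := by
    rw [Set.range_list_map]
    intro s hs
    obtain ⟨i, hi, e⟩ := hw s hs
    exact ⟨(⟨i, hi⟩, s.2), Prod.ext e.symm rfl⟩
  exact this

theorem mem_suffixes {α : Type*} {l s : List α} :
    s ∈ suffixes l ↔ ∃ i < l.length, s = l.drop i := by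
  induction l with
  | nil => simp [suffixes]
  | cons a l ih =>
    rw [suffixes, List.mem_cons, ih]
    constructor
    · rintro (rfl | ⟨i, hi, rfl⟩)
      · exact ⟨0, by simp, rfl⟩
      · exact ⟨i + 1, by simpa using hi, rfl⟩
    · rintro ⟨_ | i, hi, rfl⟩
      · exact Or.inl rfl
      · exact Or.inr ⟨i, by simpa using hi, rfl⟩

theorem exists_of_mem_drop_indexFrom {α : Type*} {l : List α} {k : ℕ} {p : ℤ × α}
    (hp : p ∈ (indexFrom 0 l).drop k) : ∃ i < l.length, k ≤ i ∧ p.1 = (i : ℤ) := by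
  obtain ⟨j, hj, rfl⟩ := List.mem_iff_getElem.1 hp
  have hj' := hj
  rw [List.length_drop, length_indexFrom] at hj'
  exact ⟨k + j, by omega, by omega, by rw [List.getElem_drop, getElem_indexFrom]; simp⟩

section Presentation

variable {R : Type*} [Ring R] {ds : List ℤ} {T : List (List (List ℤ))} {gs : List R}
  {D : ℤ} {one : List ℤ} {I : Ideal R} [I.IsTwoSided] {f : ℤ → onePlus I}

theorem IsUnipotentBasis.drop {B : List (ℤ × List ℤ)} (hB : IsUnipotentBasis ds gs I B f) (k : ℕ) :
    IsUnipotentBasis ds gs I (B.drop k) f := by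
  induction k generalizing B with
  | zero => exact hB
  | succ k ih => cases B with
    | nil => exact hB
    | cons p B => exact ih hB.tail

namespace IsUnitalRingCode

/-- Every element of `1 + I` is spelled by a word in the generators. -/
theorem exists_evalWord_eq (h : IsUnitalRingCode ds T gs D one I) {l : List (List ℤ)}
    (hB : IsUnipotentBasis ds gs I (indexFrom 0 l) f)
    (hspan : spanList ((indexFrom 0 l).map fun p => ev gs p.2) = I.toAddSubgroup)
    {u : List ℤ} {U : onePlus I} (hu : ev gs u = ((U : Rˣ) : R)) :
    ∃ w : GroupWord l.length,
      w.intWord = logWord ds T D one (indexFrom 0 l) (powVec ds T D one u (-1)) ∧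
      evalWord f w.intWord = U := by
  obtain ⟨h1, h2⟩ := h.powVec_spec hu (-1)
  obtain ⟨h3, h4⟩ := h.logWord_spec hB h1.length_eq h2 (by
    rw [mem_unipotentSubgroup, hspan]
    exact sub_one_mem _)
  obtain ⟨w, hw⟩ := GroupWord.exists_intWord_eq (n := l.length) fun s hs => by
    obtain ⟨p, hp, e⟩ := h3 s hs
    obtain ⟨i, hi, -, e'⟩ := exists_of_mem_drop_indexFrom (k := 0) hp
    exact ⟨i, hi, e.trans e'⟩
  refine ⟨w, hw, ?_⟩
  rw [zpow_neg_one, inv_mul_eq_one] at h4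
  rw [hw]
  exact h4.symm

/-- The computed relators define the group `1 + I`: they are satisfied there, every element of
`1 + I` is spelled by a word, and `toGroup_injective` applies. -/
theorem exists_presentation (h : IsUnitalRingCode ds T gs D one I) {l : List (List ℤ)}
    (hB : IsUnipotentBasis ds gs I (indexFrom 0 l) f)
    (hspan : spanList ((indexFrom 0 l).map fun p => ev gs p.2) = I.toAddSubgroup)
    (hev : ∀ x : R, ∃ u, ev gs u = x) :
    ∃ rels : List (GroupWord l.length),
      rels.map GroupWord.intWord = relators ds T D one (indexFrom 0 l) ∧
      ∃ φ : onePlus I ≃* (FinPresentation.mk l.length rels).Presented,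
        ∀ w : GroupWord l.length,
          φ.symm ((FinPresentation.mk l.length rels).spell w) = evalWord f w.intWord := by
  set m := l.length with hm
  set B := indexFrom 0 l with hBdef
  have hBlen : B.length = m := length_indexFrom 0 l
  have hcons (i : ℕ) (hi : i < m) : ∃ v, B.drop i = ((i : ℤ), v) :: B.drop (i + 1) := by
    refine ⟨l[i], ?_⟩
    rw [List.drop_eq_getElem_cons (by omega : i < B.length)]
    congr 1
    rw [getElem_indexFrom, zero_add]
  have hloc (i : Fin m) : ∃ (r : ℤ) (w : List (ℤ × ℤ)) (W : ℤ × List ℤ → List (ℤ × ℤ)),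
      relatorsAt ds T D one (B.drop i) = ((((i : ℕ) : ℤ), r) :: w) ::
        (B.drop (i + 1)).map (fun q =>
          (((i : ℕ) : ℤ), -1) :: (q.1, 1) :: (((i : ℕ) : ℤ), 1) :: W q) ∧
      0 < r ∧ (∀ c : ℤ, f (i : ℕ) ^ c ∈ unipotentSubgroup (hB.drop (i + 1)).chain → r ∣ c) ∧
      (∀ s ∈ w, ∃ q ∈ B.drop (i + 1), s.1 = q.1) ∧ f (i : ℕ) ^ r * evalWord f w = 1 ∧
      ∀ q ∈ B.drop (i + 1), (∀ s ∈ W q, ∃ t ∈ B.drop (i + 1), s.1 = t.1) ∧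
        (f (i : ℕ))⁻¹ * f q.1 * f (i : ℕ) * evalWord f (W q) = 1 := by
    obtain ⟨v, hv⟩ := hcons i i.2
    have h1 := hB.drop i
    rw [hv] at h1
    rw [hv]
    exact h.relatorsAt_spec h1
  choose r w W hrels hr hord hw hwf hW using hloc
  have hmem (x : List (ℤ × ℤ)) : x ∈ relators ds T D one B ↔
      ∃ i : Fin m, x = (((i : ℕ) : ℤ), r i) :: w i ∨ ∃ q ∈ B.drop (i + 1),
        x = (((i : ℕ) : ℤ), -1) :: (q.1, 1) :: (((i : ℕ) : ℤ), 1) :: W i q := by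
    simp only [relators, List.mem_flatMap, mem_suffixes]
    constructor
    · rintro ⟨_, ⟨i, hi, rfl⟩, hx⟩
      rw [hBlen] at hi
      rw [hrels ⟨i, hi⟩, List.mem_cons, List.mem_map] at hx
      refine ⟨⟨i, hi⟩, hx.imp_right ?_⟩
      rintro ⟨q, hq, rfl⟩
      exact ⟨q, hq, rfl⟩
    · rintro ⟨i, hx⟩
      refine ⟨_, ⟨i, by rw [hBlen]; exact i.2, rfl⟩, ?_⟩
      rw [hrels i, List.mem_cons, List.mem_map]
      refine hx.imp_right ?_
      rintro ⟨q, hq, rfl⟩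
      exact ⟨q, hq, rfl⟩
  have hindex {k : ℕ} {q : ℤ × List ℤ} (hq : q ∈ B.drop k) :
      ∃ j : Fin m, k ≤ j ∧ q.1 = ((j : ℕ) : ℤ) := by
    obtain ⟨j, hj, hkj, e⟩ := exists_of_mem_drop_indexFrom hq
    exact ⟨⟨j, hj⟩, hkj, e⟩
  have hrange : relators ds T D one B ∈
      Set.range (List.map (GroupWord.intWord (n := m))) := by
    rw [Set.range_list_map]
    intro x hx
    refine GroupWord.exists_intWord_eq fun s hs => ?_
    have hout {i : Fin m} {s : ℤ × ℤ} (hs : ∃ t ∈ B.drop (i + 1), s.1 = t.1) :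
        ∃ j < m, s.1 = ((j : ℕ) : ℤ) := by
      obtain ⟨t, ht, e⟩ := hs
      obtain ⟨j, -, e'⟩ := hindex ht
      exact ⟨j, j.2, e.trans e'⟩
    obtain ⟨i, rfl | ⟨q, hq, rfl⟩⟩ := (hmem x).1 hx
    · rcases List.mem_cons.1 hs with rfl | hs
      · exact ⟨i, i.2, rfl⟩
      · exact hout (hw i s hs)
    · rcases List.mem_cons.1 hs with rfl | hs
      · exact ⟨i, i.2, rfl⟩
      rcases List.mem_cons.1 hs with rfl | hs
      · exact hout ⟨q, hq, rfl⟩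
      rcases List.mem_cons.1 hs with rfl | hs
      · exact ⟨i, i.2, rfl⟩
      · exact hout ((hW i q hq).1 s hs)
  obtain ⟨rels, hrels'⟩ := hrange
  refine ⟨rels, hrels', ?_⟩
  set P := FinPresentation.mk m rels with hP
  set rset := {r : FreeGroup (Fin m) | ∃ w ∈ rels, r = GroupWord.toFree w} with hrset
  have hrel : ∀ x ∈ rset, FreeGroup.lift (fun i : Fin m => f (i : ℕ)) x = 1 := by
    rintro _ ⟨x, hx, rfl⟩
    rw [GroupWord.map_toFree (f := f) _ fun i => by simp]
    have hx' : x.intWord ∈ relators ds T D one B := by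
      rw [← hrels']; exact List.mem_map_of_mem hx
    obtain ⟨i, e | ⟨q, hq, e⟩⟩ := (hmem _).1 hx'
    · rw [e, evalWord_cons]
      exact hwf i
    · rw [e, evalWord_cons, evalWord_cons, evalWord_cons, zpow_neg_one, zpow_one, zpow_one,
        ← mul_assoc, ← mul_assoc]
      exact (hW i q hq).2
  -- The generators of the presented group, indexed by integers.
  let X : ℤ → PresentedGroup rset :=
    Function.extend (fun i : Fin m => ((i : ℕ) : ℤ)) (fun i => PresentedGroup.of i) 1
  have hX (i : Fin m) : X (i : ℕ) = PresentedGroup.of i :=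
    Function.Injective.extend_apply
      (fun a b hab => Fin.ext (by exact_mod_cast hab)) _ _ i
  have hspell (x : GroupWord m) :
      PresentedGroup.mk rset x.toFree = evalWord X x.intWord :=
    GroupWord.map_toFree (PresentedGroup.mk rset) (fun i => (hX i).symm) x
  have hone {x : List (ℤ × ℤ)} (hx : x ∈ relators ds T D one B) : evalWord X x = 1 := by
    rw [← hrels'] at hx
    obtain ⟨y, hy, rfl⟩ := List.mem_map.1 hx
    rw [← hspell]
    exact PresentedGroup.one_of_mem ⟨y, hy, rfl⟩
  have hcl (i : Fin m) {x : List (ℤ × ℤ)} (hx : ∀ s ∈ x, ∃ q ∈ B.drop (i + 1), s.1 = q.1) :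
      evalWord X x ∈ Subgroup.closure {x | ∃ j, i < j ∧ x = PresentedGroup.of j} := by
    refine evalWord_mem fun s hs => ?_
    obtain ⟨q, hq, e⟩ := hx s hs
    obtain ⟨j, hj, e'⟩ := hindex hq
    rw [e, e', hX]
    exact Subgroup.subset_closure ⟨j, hj, rfl⟩
  have hlater {i j : Fin m} (hij : i < j) : ∃ v, (((j : ℕ) : ℤ), v) ∈ B.drop (i + 1) := by
    obtain ⟨v, hv⟩ := hcons j j.2
    have e : B.drop j = (B.drop (i + 1)).drop (j - (i + 1)) := by
      rw [List.drop_drop]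
      congr 1
      have := Fin.lt_def.1 hij
      omega
    exact ⟨v, List.mem_of_mem_drop (by rw [← e, hv]; exact List.mem_cons_self)⟩
  have hinj : Function.Injective (PresentedGroup.toGroup hrel) := by
    refine toGroup_injective hrel r hr (fun i => ?_) (fun i j hij => ?_) fun i c hc => ?_
    · have h1 := hone ((hmem _).2 ⟨i, Or.inl rfl⟩)
      rw [evalWord_cons, hX] at h1
      rw [eq_inv_of_mul_eq_one_left h1]
      exact inv_mem (hcl i (hw i))
    · obtain ⟨v, hq⟩ := hlater hij
      have h1 := hone ((hmem _).2 ⟨i, Or.inr ⟨_, hq, rfl⟩⟩)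
      rw [evalWord_cons, evalWord_cons, evalWord_cons, zpow_neg_one, zpow_one, zpow_one,
        ← mul_assoc, ← mul_assoc, hX, hX] at h1
      rw [eq_inv_of_mul_eq_one_left h1]
      exact inv_mem (hcl i (hW i _ hq).1)
    · refine hord i c ((Subgroup.closure_le _).2 ?_ hc)
      rintro _ ⟨j, hij, rfl⟩
      obtain ⟨v, hq⟩ := hlater hij
      exact (hB.drop (i + 1)).gen_mem hq
  have hval (x : GroupWord m) :
      PresentedGroup.toGroup hrel (PresentedGroup.mk rset x.toFree) = evalWord f x.intWord := by
    rw [hspell, map_evalWord]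
    have hc := GroupWord.map_toFree (FreeGroup.lift fun i : Fin m => f (i : ℕ))
      (f := f) (fun i => by simp) x
    rw [← hc, GroupWord.map_toFree (f := fun k => PresentedGroup.toGroup hrel (X k))]
    intro i
    rw [hX]
    simp
  have hsurj : Function.Surjective (PresentedGroup.toGroup hrel) := by
    intro U
    obtain ⟨u, hu⟩ := hev ((U : Rˣ) : R)
    obtain ⟨x, -, hx⟩ := h.exists_evalWord_eq hB hspan hu
    exact ⟨_, (hval x).trans hx⟩
  exact ⟨(MulEquiv.ofBijective (PresentedGroup.toGroup hrel) ⟨hinj, hsurj⟩).symm, hval⟩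

end IsUnitalRingCode

end Presentation

/-! ### Codes of finite rings -/

theorem ev_ofFn {A : Type*} [AddCommGroup A] {n : ℕ} (g : Fin n → A) (c : Fin n → ℤ) :
    ev (List.ofFn g) (List.ofFn c) = ∑ i, c i • g i := by
  induction n with
  | zero => simp
  | succ n ih => rw [List.ofFn_succ, List.ofFn_succ, ev_cons, ih, Fin.sum_univ_succ]

theorem forall₂_ofFn {α β : Type*} {P : α → β → Prop} {n : ℕ} {x : Fin n → α} {y : Fin n → β}
    (h : ∀ i, P (x i) (y i)) : List.Forall₂ P (List.ofFn x) (List.ofFn y) := by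
  induction n with
  | zero => simp
  | succ n ih =>
    rw [List.ofFn_succ, List.ofFn_succ]
    exact .cons (h 0) (ih fun i => h i.succ)

theorem isCyclicBasis_ofFn {A : Type*} [AddCommGroup A] {n : ℕ} {d : Fin n → ℤ} {g : Fin n → A}
    (hd : ∀ i, 0 < d i) (hg : ∀ i, d i • g i = 0)
    (h : ∀ c : Fin n → ℤ, ∑ i, c i • g i = 0 → ∀ i, d i ∣ c i) :
    IsCyclicBasis (List.ofFn d) (List.ofFn g) := by
  induction n with
  | zero => simp [IsCyclicBasis]
  | succ n ih =>
    rw [List.ofFn_succ, List.ofFn_succ]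
    refine ⟨hd 0, hg 0, fun c hc => ?_,
      ih (fun i => hd i.succ) (fun i => hg i.succ) fun c hc i => ?_⟩
    · obtain ⟨v, hv, e⟩ := exists_ev_eq hc
      rw [List.length_ofFn] at hv
      obtain ⟨v', rfl⟩ : ∃ v' : Fin n → ℤ, v = List.ofFn v' := by
        subst hv
        exact ⟨v.get, (List.ofFn_get v).symm⟩
      rw [ev_ofFn] at e
      have := h (Fin.cons (-c) v') (by
        rw [Fin.sum_univ_succ]
        simp only [Fin.cons_zero, Fin.cons_succ, e, neg_smul, neg_add_cancel]) 0
      simpa using this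
    · have := h (Fin.cons 0 c) (by
        rw [Fin.sum_univ_succ]
        simpa only [Fin.cons_zero, Fin.cons_succ, zero_smul, zero_add] using hc) i.succ
      simpa using this

namespace RingCoordinates

variable {R : Type*} [Ring R] (C : RingCoordinates R)

/-- The vector of the reduced coordinates of a ring element. -/
def vec (a : R) : List ℤ := List.ofFn fun i => ((C.coord a i).val : ℤ)

/-- The ring and the ideal generated by `gens`, in the form that the algorithms work with. -/
def toCode (gens : List R) : RingIdealCode :=
  ((List.ofFn fun i => (C.d i : ℤ),
    List.ofFn fun i => List.ofFn fun j => C.vec (C.gen i * C.gen j)),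
    gens.map C.vec)

theorem enc_vec (a : R) : enc (C.vec a) = C.encodeElt a := by
  change Data.ofList (List.map _ _) = Data.ofList _
  rw [vec, List.map_ofFn]
  rfl

theorem enc_toCode (gens : List R) : enc (C.toCode gens) = C.encodeRingIdeal gens := by
  have hlist {α : Type} [DataEnc α] (l : List α) : enc l = Data.ofList (l.map enc) := rfl
  have hprod {α β : Type} [DataEnc α] [DataEnc β] (p : α × β) :
      enc p = .cons (enc p.1) (enc p.2) := rfl
  have hv : (enc ∘ C.vec : R → Data) = C.encodeElt := funext C.enc_vec
  have hrow (i : Fin C.n) : enc (List.ofFn fun j => C.vec (C.gen i * C.gen j)) =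
      Data.ofList (List.ofFn fun j => C.encodeElt (C.gen i * C.gen j)) := by
    rw [hlist, List.map_ofFn]
    exact congrArg _ (congrArg _ (funext fun j => C.enc_vec _))
  rw [hprod, hprod, toCode, encodeRingIdeal, encodeRing]
  simp only [hlist (α := List ℤ), hlist (α := List (List ℤ)), hlist (α := ℤ), List.map_ofFn,
    List.map_map, hv]
  rw [show (enc ∘ fun i => List.ofFn fun j => C.vec (C.gen i * C.gen j)) = _ from funext hrow]
  rfl

theorem coord_sum (c : Fin C.n → ℤ) (j : Fin C.n) :
    C.coord (∑ i, c i • C.gen i) j = (c j : ZMod (C.d j)) := by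
  rw [map_sum, Finset.sum_apply, Finset.sum_eq_single j]
  · rw [map_zsmul, Pi.smul_apply, gen, AddEquiv.apply_symm_apply, Pi.single_eq_same, zsmul_one]
  · intro i _ hij
    rw [map_zsmul, Pi.smul_apply, gen, AddEquiv.apply_symm_apply, Pi.single_eq_of_ne hij.symm,
      smul_zero]
  · simp

theorem neZero (i : Fin C.n) : NeZero (C.d i) := ⟨(C.d_pos i).ne'⟩

theorem ev_vec (a : R) : ev (List.ofFn C.gen) (C.vec a) = a := by
  rw [vec, ev_ofFn]
  refine C.coord.injective (funext fun j => ?_)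
  have := C.neZero j
  rw [coord_sum, Int.cast_natCast, ZMod.natCast_zmod_val]

theorem reducedMod_vec (a : R) : ReducedMod (List.ofFn fun i => (C.d i : ℤ)) (C.vec a) :=
  forall₂_ofFn fun i => by
    have := C.neZero i
    exact ⟨Int.natCast_nonneg _, by exact_mod_cast ZMod.val_lt _⟩

theorem isRingCode (gens : List R) :
    IsRingCode (C.toCode gens).ds (C.toCode gens).T (List.ofFn C.gen) where
  basis := by
    refine isCyclicBasis_ofFn (fun i => by exact_mod_cast C.d_pos i) (fun i => ?_) fun c hc i => ?_
    · refine C.coord.injective (funext fun j => ?_)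
      have := C.coord_sum (Pi.single i (C.d i : ℤ)) j
      rw [Finset.sum_eq_single i (fun k _ hk => by rw [Pi.single_eq_of_ne hk, zero_smul])
        (by simp), Pi.single_eq_same] at this
      rw [this, map_zero, Pi.zero_apply]
      by_cases hij : j = i
      · subst hij; simp
      · simp [Pi.single_eq_of_ne hij]
    · have := C.coord_sum c i
      rw [hc, map_zero, Pi.zero_apply] at this
      exact (ZMod.intCast_zmod_eq_zero_iff_dvd _ _).1 this.symm
  span x := by
    rw [← C.ev_vec x]
    exact ev_mem_spanList _ _
  weaklyReduced := by
    intro row hrow v hv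
    obtain ⟨i, rfl⟩ := (List.mem_ofFn' _ _).1 hrow
    obtain ⟨j, rfl⟩ := (List.mem_ofFn' _ _).1 hv
    exact (C.reducedMod_vec _).weaklyReduced
  table := by
    change List.map _ (List.ofFn _) = _
    simp only [List.map_ofFn, Function.comp_def, ev_vec]

theorem finite (C : RingCoordinates R) : Finite R := by
  have := C.neZero
  exact Finite.of_injective C.coord C.coord.injective

theorem D_toCode (gens : List R) : (C.toCode gens).D = Nat.card R := by
  have := C.neZero
  change List.foldl _ 1 (List.ofFn _) = _
  rw [← List.prod_eq_foldl, List.prod_ofFn, Nat.card_congr C.coord.toEquiv, Nat.card_pi]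
  simp

end RingCoordinates

/-- The order of `1 + I` is the order of `I` and thus divides the order of `R`. -/
theorem onePlus_zpow_card {R : Type*} [Ring R] [Finite R] {I : Ideal R} [I.IsTwoSided]
    (hI : IsNilpotent I) (u : onePlus I) : u ^ (Nat.card R : ℤ) = 1 := by
  have hcard : Nat.card (onePlus I) = Nat.card I.toAddSubgroup := by
    refine Nat.card_eq_of_bijective (fun u => ⟨((u : Rˣ) : R) - 1, sub_one_mem u⟩) ⟨?_, ?_⟩
    · intro u v huv
      exact Subtype.ext (Units.ext (sub_left_injective (congrArg Subtype.val huv)))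
    · rintro ⟨a, ha⟩
      obtain ⟨u, hu, e⟩ := exists_mem_onePlus I hI ha
      exact ⟨⟨u, hu⟩, Subtype.ext (by simp [e])⟩
  obtain ⟨k, hk⟩ := AddSubgroup.card_addSubgroup_dvd_card I.toAddSubgroup
  rw [zpow_natCast, hk, ← hcard, pow_mul, pow_card_eq_one', one_pow]

theorem RingCoordinates.isUnitalRingCode {R : Type*} [Ring R] (C : RingCoordinates R) {I : Ideal R}
    [I.IsTwoSided] (hI : IsNilpotent I) (gens : List R) :
    IsUnitalRingCode (C.toCode gens).ds (C.toCode gens).T (List.ofFn C.gen) (C.toCode gens).D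
      (C.toCode gens).one I where
  toIsRingCode := C.isRingCode gens
  pos := by
    have := C.finite
    rw [C.D_toCode]
    exact_mod_cast Nat.card_pos
  smul_eq_zero x := by
    rw [C.D_toCode, natCast_zsmul, card_nsmul_eq_zero']
  zpow_eq_one u := by
    have := C.finite
    rw [C.D_toCode, onePlus_zpow_card hI]
  reducedMod_one := (C.isRingCode gens).findUnit_spec.1
  ev_one := (C.isRingCode gens).findUnit_spec.2

/-- There are algorithms that, for every finite ring `R` and every nilpotent two-sided ideal `I` of
`R`, determine an effective presentation of `1 + I`, in polynomial time. -/
theorem mainTheorem6 :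
    ∃ (presAlg logAlg expAlg : Prog) (q : Polynomial ℕ),
      ∀ (R : Type*) [Ring R] (C : RingCoordinates R) (I : Ideal R) [I.IsTwoSided] (gens : List R),
        IsNilpotent I →
        AddSubgroup.closure {a : R | a ∈ gens} = I.toAddSubgroup →
        ∃ P : FinPresentation,
          presAlg.OutputsIn q (C.encodeRingIdeal gens) P.encode ∧
          IsEffectivePresentation (fun u : onePlus I => C.encodeElt ((u : Rˣ) : R))
            (C.encodeRingIdeal gens) q P logAlg expAlg := by
  obtain ⟨p₁, q₁, h₁⟩ := RingIdealCode.polyTime_presentation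
  obtain ⟨p₂, q₂, h₂⟩ := RingIdealCode.polyTime_log
  obtain ⟨p₃, q₃, h₃⟩ := RingIdealCode.polyTime_exp
  refine ⟨p₁, p₂, p₃, q₁ + q₂ + q₃, fun R _ C I _ gens hI hgens => ?_⟩
  have hmono {p : Prog} {q q' : Polynomial ℕ} {x y : Data} (hle : ∀ n, q.eval n ≤ q'.eval n)
      (h : p.OutputsIn q x y) : p.OutputsIn q' x y := by
    obtain ⟨t, ht, htq⟩ := h
    exact ⟨t, ht, htq.trans (hle _)⟩
  have hle₁ (n : ℕ) : q₁.eval n ≤ (q₁ + q₂ + q₃).eval n := by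
    simp only [Polynomial.eval_add]; omega
  have hle₂ (n : ℕ) : q₂.eval n ≤ (q₁ + q₂ + q₃).eval n := by
    simp only [Polynomial.eval_add]; omega
  have hle₃ (n : ℕ) : q₃.eval n ≤ (q₁ + q₂ + q₃).eval n := by
    simp only [Polynomial.eval_add]; omega
  have := C.finite
  have hc := C.isUnitalRingCode hI gens
  set x := C.toCode gens
  have hx' : enc x = C.encodeRingIdeal gens := C.enc_toCode gens
  set gs := List.ofFn C.gen
  set l := idealBasis x.ds x.T x.D x.2
  have hgens' : (x.2.map (ev gs)) = gens := by
    change List.map _ (List.map _ _) = _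
    rw [List.map_map, show ev gs ∘ C.vec = id from funext C.ev_vec, List.map_id]
  obtain ⟨hl1, hl2, hl3⟩ := hc.toIsRingCode.idealBasis_spec (I := I) (S := x.2) hI
    (by rw [hgens']; exact hgens) (by
      intro v hv
      obtain ⟨a, -, rfl⟩ := List.mem_map.1 hv
      exact (C.reducedMod_vec a).weaklyReduced)
  rw [← C.D_toCode gens] at hl1 hl2 hl3
  have hmapsnd (l : List (List ℤ)) (k : ℤ) :
      ((indexFrom k l).map fun p => ev gs p.2) = l.map (ev gs) := by
    induction l generalizing k with
    | nil => rfl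
    | cons v l ih => rw [indexFrom, List.map_cons, List.map_cons, ih]
  have hI' (i : Fin l.length) : ∃ u : onePlus I, ((u : Rˣ) : R) = 1 + ev gs l[i] := by
    have : ev gs l[i] ∈ I.toAddSubgroup := by
      rw [← hl2]
      exact mem_spanList (List.mem_map_of_mem (List.getElem_mem _))
    obtain ⟨u, hu, e⟩ := exists_mem_onePlus I hI this
    exact ⟨⟨u, hu⟩, e⟩
  choose g hg using hI'
  -- The generators are `1 + b` for the entries `b` of `l`; `1` is assigned to the other integers.
  have hB : IsUnipotentBasis x.ds gs I (indexFrom 0 l)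
      (Function.extend (fun i : Fin l.length => ((i : ℕ) : ℤ)) g 1) := by
    have hp (p) (hp : p ∈ indexFrom 0 l) : ∃ i : Fin l.length, p = (((i : ℕ) : ℤ), l[i]) := by
      obtain ⟨i, hi, rfl⟩ := List.mem_iff_getElem.1 hp
      have hi' := hi
      rw [length_indexFrom] at hi'
      exact ⟨⟨i, hi'⟩, by rw [getElem_indexFrom, zero_add]; rfl⟩
    refine ⟨fun p h => ?_, ?_, fun p h => ?_⟩
    · obtain ⟨i, rfl⟩ := hp p h
      exact hl1 _ (List.getElem_mem _)
    · rw [hmapsnd]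
      exact hl3
    · obtain ⟨i, rfl⟩ := hp p h
      rw [Function.Injective.extend_apply fun a b hab => Fin.ext (by exact_mod_cast hab)]
      exact hg i
  have hspan : spanList ((indexFrom 0 l).map fun p => ev gs p.2) = I.toAddSubgroup := by
    rw [hmapsnd]
    exact hl2
  obtain ⟨rels, hrels, φ, hφ⟩ := hc.exists_presentation hB hspan fun a => ⟨_, C.ev_vec a⟩
  refine ⟨⟨l.length, rels⟩, ?_, φ, fun u => ?_, fun w => ?_⟩
  · have h := hmono hle₁ (h₁ x)
    change p₁.OutputsIn _ (enc x) (enc x.presentation) at h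
    have e : enc x.presentation = FinPresentation.encode ⟨l.length, rels⟩ := by
      have hlen {α : Type} (l : List α) (k : ℤ) :
          l.foldl (fun (n : ℤ) _ => n + 1) k = k + l.length := by
        induction l generalizing k with
        | nil => simp
        | cons a l ih => rw [List.foldl_cons, ih]; push_cast [List.length_cons]; ring
      change Data.cons (.num (List.foldl _ 0 (indexFrom 0 l)))
        (.ofList ((relators x.ds x.T x.D x.one (indexFrom 0 l)).map enc)) = _
      rw [hlen, length_indexFrom, zero_add, ← hrels, List.map_map]
      have : (enc ∘ GroupWord.intWord : GroupWord l.length → Data) = GroupWord.encode :=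
        funext fun w => w.encode_eq.symm
      rw [this]
      rfl
    rw [hx', e] at h
    exact h
  · obtain ⟨w, hw, hwu⟩ := hc.exists_evalWord_eq hB hspan (C.ev_vec ((u : Rˣ) : R))
    refine ⟨w, ?_, ?_⟩
    · have h := hmono hle₂ (h₂ (x, C.vec ((u : Rˣ) : R)))
      change p₂.OutputsIn _ (.cons (enc x) (enc (C.vec ((u : Rˣ) : R))))
        (enc (logWord _ _ _ _ _ _)) at h
      rw [hx', C.enc_vec] at h
      rw [GroupWord.encode_eq, hw]
      exact h
    · rw [← hwu, ← hφ w, MulEquiv.apply_symm_apply]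
  · refine ⟨_, ?_, rfl⟩
    have h := hmono hle₃ (h₃ (x, w.intWord))
    obtain ⟨h4, h5⟩ := hc.expWord_spec hB (fun p hp => lookup_indexFrom l hp) (w := w.intWord) (by
      intro s hs
      obtain ⟨t, -, rfl⟩ := List.mem_map.1 hs
      have ht : (t.1 : ℕ) < (indexFrom 0 l).length := by
        rw [length_indexFrom]; exact t.1.2
      exact ⟨_, List.getElem_mem ht, by rw [getElem_indexFrom]; simp⟩)
    rw [← hφ w] at h5
    have e : x.exp w.intWord =
        C.vec (((φ.symm (FinPresentation.spell _ w) : onePlus I) : Rˣ) : R) :=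
      h4.ext hc.basis (C.reducedMod_vec _) (h5.trans (C.ev_vec _).symm)
    change p₃.OutputsIn _ (.cons (enc x) (enc w.intWord)) (enc (x.exp w.intWord)) at h
    rw [hx', e, C.enc_vec, ← GroupWord.encode_eq] at h
    exact h
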